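/- Let $-\infty<l<r<\infty$, $\rho\in(0,\infty)$, and let $\mu\in C^3([l,r])$, $\sigma^2\in C^4([l,r])$, $\kappa\in C^2([l,r])$ with $\sigma^2>0$ and $\kappa\ge 0$ on $[l,r]$ (drift, squared volatility and killing rate of a diffusion that is sticky at $l$ with stickiness $\rho$ and killed at $r$). Put $$s(x)=\exp\Big(-\int_l^x\frac{2\mu(y)}{\sigma^2(y)}\,dy\Big),\quad m(x)=\frac{2}{\sigma^2(x)s(x)},\quad (f,g)=\frac1\rho f(l)g(l)+\int_l^r f(x)g(x)m(x)\,dx .$$ For $k=1,2,\dots$ let $\varphi_k\in C^2([l,r])$ be an eigenfunction, normalized by $(\varphi_k,\varphi_k)=1$, for the $k$-th smallest eigenvalue $\lambda=\lambda_k$ of the Sturm–Liouville problem $$\mu\varphi'+\tfrac12\sigma^2\varphi''-\kappa\varphi=-\lambda\varphi\ \text{ on }(l,r),\qquad \rho\varphi'(l)-(\kappa(l)-\lambda)\varphi(l)=0,\qquad \varphi(r)=0 .$$ For each $n$ let $\mathbb S_n=\{l=x_0<x_1<\dots<x_n<x_{n+1}=r\}$ be a grid (its points depend on $n$). Write $\delta^+x_i=x_{i+1}-x_i$,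 $\delta^-x_i=x_i-x_{i-1}$, $\delta x_i=\frac12(\delta^+x_i+\delta^-x_i)$, $h_n=\max_{0\le i\le n}\delta^+x_i$, and for functions $g$ on $\mathbb S_n$ put $\nabla^+g(x_i)=\frac{g(x_{i+1})-g(x_i)}{\delta^+x_i}$, $\nabla^-g(x_i)=\frac{g(x_i)-g(x_{i-1})}{\delta^-x_i}$, $\nabla g=\frac{\delta^-x}{2\delta x}\nabla^+g+\frac{\delta^+x}{2\delta x}\nabla^-g$, $\Delta g=\frac1{\delta x}(\nabla^+g-\nabla^-g)$. The generator of the approximating continuous time Markov chain is $$G_ng(x_i)=\mu(x_i)\nabla g(x_i)+\tfrac12\sigma^2(x_i)\Delta g(x_i)-\kappa(x_i)g(x_i)\ (1\le i\le n),\qquad G_ng(x_0)=\rho\beta\nabla^+g(x_0)-\kappa(x_0)g(x_0),$$ where $\beta=1$, $\alpha=\mu(x_0)$ in Scheme 1, and $\beta=\big(1+\frac{\rho-\mu(x_0)}{\sigma^2(x_0)}\delta^+x_0\big)^{-1}$, $\alpha=\rho$ in Scheme 2. Let $M_n(x_0)=\frac1\rho\exp\big(\frac{\alpha}{\sigma^2(x_0)}\delta^+x_0\big)$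 and, for $1\le i\le n$, $M_n(x_i)=m_n(x_i)\,\delta x_i$ with $$m_n(x_i)=M_n(x_0)\,\beta\,\frac{2\rho}{-\mu(x_1)\delta^+x_1+\sigma^2(x_1)}\prod_{j=1}^{i-1}\frac{\mu(x_j)\delta^-x_j+\sigma^2(x_j)}{-\mu(x_{j+1})\delta^+x_{j+1}+\sigma^2(x_{j+1})} .$$ Let $\varphi^n_k$ be an eigenvector for the $k$-th smallest eigenvalue $\lambda^n_k$ of the problem $G_n\varphi(x_i)=-\lambda\varphi(x_i)$ for $0\le i\le n$, $\varphi(x_{n+1})=0$, normalized by $\sum_{i=0}^n\varphi_k^n(x_i)^2M_n(x_i)=1$. Let $\|g\|_{n,\infty}=\max_{x\in\mathbb S_n}|g(x)|$. Suppose that $h_n\to0$ and that $\frac{\max_{0\le i\le n}\delta^+x_i}{\min_{0\le i\le n}\delta^+x_i}$ is bounded uniformly in $n$. Then, for each of the two schemes, there are $\delta>0$ and $C>0$, independent of $k$ and $n$, such that for all $n$ with $h_n<\delta$ and all integers $k$ with $1\le k\le h_n^{-1/5}$, with the sign of $\varphi^n_k$ suitably chosen, $$\|\varphi_k^n-\varphi_k\|_{n,\infty}\le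 C\,k^4\,h_n^{\gamma},$$ where $\gamma=1$ for Scheme 1 and $\gamma=2$ for Scheme 2. -/

import Mathlib

open Set Filter Topology

noncomputable section

/-- Data of a sticky diffusion on `[l, r]`: sticky left boundary `l` with stickiness `ρ ∈ (0, ∞)`,
killing at the right boundary `r`, drift `μ`, volatility `σ` and killing rate `κ`.
Only the values of `μ`, `σ`, `κ` on `[l, r]` matter. -/
structure StickyDiffusion where
  l : ℝ
  r : ℝ
  ρ : ℝ
  μ : ℝ → ℝ
  σ : ℝ → ℝ
  κ : ℝ → ℝ
  l_lt_r : l < r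
  ρ_pos : 0 < ρ

namespace StickyDiffusion

/-- Regularity of the coefficients: `μ ∈ C³`, `σ² ∈ C⁴`, `κ ∈ C²`, `σ² > 0` and `κ ≥ 0`,
up to the boundary of `[l, r]`. -/
structure Regular (D : StickyDiffusion) : Prop where
  drift_smooth : ContDiffOn ℝ 3 D.μ (Icc D.l D.r)
  variance_smooth : ContDiffOn ℝ 4 (fun x => D.σ x ^ 2) (Icc D.l D.r)
  killing_smooth : ContDiffOn ℝ 2 D.κ (Icc D.l D.r)
  variance_pos : ∀ x ∈ Icc D.l D.r, 0 < D.σ x ^ 2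
  killing_nonneg : ∀ x ∈ Icc D.l D.r, 0 ≤ D.κ x

/-- The scale density `s(x) = exp (-∫_l^x 2 μ / σ²)`. -/
def scaleDensity (D : StickyDiffusion) (x : ℝ) : ℝ :=
  Real.exp (-∫ y in D.l..x, 2 * D.μ y / D.σ y ^ 2)

/-- The density `m(x) = 2 / (σ²(x) s(x))` of the speed measure on `(l, r)`. -/
def speedDensity (D : StickyDiffusion) (x : ℝ) : ℝ :=
  2 / (D.σ x ^ 2 * D.scaleDensity x)

/-- The inner product of `L²(M)` for the speed measure `M(dx) = m(x) dx + ρ⁻¹ δ_l(dx)`. -/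
def innerProd (D : StickyDiffusion) (f g : ℝ → ℝ) : ℝ :=
  1 / D.ρ * f D.l * g D.l + ∫ x in D.l..D.r, f x * g x * D.speedDensity x

/-- The action `μ f' + σ² f'' / 2 - κ f` of the generator at interior points. -/
def generator (D : StickyDiffusion) (f : ℝ → ℝ) (x : ℝ) : ℝ :=
  D.μ x * derivWithin f (Icc D.l D.r) x
    + 1 / 2 * D.σ x ^ 2 * iteratedDerivWithin 2 f (Icc D.l D.r) x - D.κ x * f x

/-- `f` is an eigenfunction, for the eigenvalue `lam`, of the Sturm-Liouville problem
`𝒢 f = -lam f` on `(l, r)`, `ρ f'(l) - (κ(l) - lam) f(l) = 0`, `f(r) = 0`. -/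
structure IsEigenfunction (D : StickyDiffusion) (lam : ℝ) (f : ℝ → ℝ) : Prop where
  smooth : ContDiffOn ℝ 2 f (Icc D.l D.r)
  eqn : ∀ x ∈ Ioo D.l D.r, D.generator f x = -lam * f x
  left : D.ρ * derivWithin f (Icc D.l D.r) D.l - (D.κ D.l - lam) * f D.l = 0
  right : f D.r = 0
  nonzero : ∃ x ∈ Icc D.l D.r, f x ≠ 0

/-- The set of eigenvalues of the Sturm-Liouville problem. -/
def eigenvalues (D : StickyDiffusion) : Set ℝ :=
  {lam | ∃ f, D.IsEigenfunction lam f}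

/-- `f` is a `k`-th normalized eigenfunction (`k = 1, 2, …`): an eigenfunction with `(f, f) = 1`
for the `k`-th smallest eigenvalue, that is, the one with exactly `k - 1` eigenvalues below it. -/
def IsNormalizedEigenfunction (D : StickyDiffusion) (k : ℕ) (f : ℝ → ℝ) : Prop :=
  ∃ lam, D.IsEigenfunction lam f ∧
    {ν | ν ∈ D.eigenvalues ∧ ν < lam}.encard + 1 = (k : ℕ∞) ∧ D.innerProd f f = 1

/-- A grid `l = x_0 < x_1 < ⋯ < x_n < x_{n+1} = r`. Points are indexed by `ℕ` for convenience;
only the indices `0, …, n + 1` are used. Likewise a function on the grid is given as `ℕ → ℝ`. -/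
structure Grid (D : StickyDiffusion) (n : ℕ) where
  pt : ℕ → ℝ
  pt_zero : pt 0 = D.l
  pt_last : pt (n + 1) = D.r
  lt_succ : ∀ i ≤ n, pt i < pt (i + 1)

end StickyDiffusion

/-- The two schemes for the transition rates of the Markov chain at the sticky boundary. -/
inductive Scheme
  | one
  | two

/-- The convergence order `γ`. -/
def Scheme.order : Scheme → ℕ
  | .one => 1
  | .two => 2

namespace StickyDiffusion.Grid

variable {D : StickyDiffusion} {n : ℕ}

/-- `δ⁺ x_i = x_{i+1} - x_i` for `i ≤ n`. -/
def dplus (S : D.Grid n) (i : ℕ) : ℝ := S.pt (i + 1) - S.pt i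

/-- `δ⁻ x_i = x_i - x_{i-1}` for `i ≥ 1`, and `δ⁻ x_0 = 0`. -/
def dminus (S : D.Grid n) (i : ℕ) : ℝ := S.pt i - S.pt (i - 1)

/-- `δ x_i = (δ⁺ x_i + δ⁻ x_i) / 2`. -/
def davg (S : D.Grid n) (i : ℕ) : ℝ := (S.dplus i + S.dminus i) / 2

/-- The mesh size `h_n`, the maximum of `δ⁺ x_i` over `i = 0, …, n`. -/
def mesh (S : D.Grid n) : ℝ :=
  (Finset.range (n + 1)).sup' Finset.nonempty_range_add_one S.dplus

/-- The minimum of `δ⁺ x_i` over `i = 0, …, n`. -/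
def minStep (S : D.Grid n) : ℝ :=
  (Finset.range (n + 1)).inf' Finset.nonempty_range_add_one S.dplus

/-- `∇⁺ g(x_i)` -/
def gradPlus (S : D.Grid n) (g : ℕ → ℝ) (i : ℕ) : ℝ := (g (i + 1) - g i) / S.dplus i

/-- `∇⁻ g(x_i)` -/
def gradMinus (S : D.Grid n) (g : ℕ → ℝ) (i : ℕ) : ℝ := (g i - g (i - 1)) / S.dminus i

/-- `∇ g(x_i)` -/
def grad (S : D.Grid n) (g : ℕ → ℝ) (i : ℕ) : ℝ :=
  S.dminus i / (2 * S.davg i) * S.gradPlus g i + S.dplus i / (2 * S.davg i) * S.gradMinus g i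

/-- `Δ g(x_i)` -/
def lap (S : D.Grid n) (g : ℕ → ℝ) (i : ℕ) : ℝ :=
  1 / S.davg i * (S.gradPlus g i - S.gradMinus g i)

/-- The boundary correction `β`. -/
def beta (S : D.Grid n) : Scheme → ℝ
  | .one => 1
  | .two => 1 / (1 + (D.ρ - D.μ (S.pt 0)) / D.σ (S.pt 0) ^ 2 * S.dplus 0)

/-- The constant `α` in the discrete speed measure. -/
def alpha (S : D.Grid n) : Scheme → ℝ
  | .one => D.μ (S.pt 0)
  | .two => D.ρ

/-- The generator `G_n` of the Markov chain, at the grid points `x_0, …, x_n`. -/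
def generator (S : D.Grid n) (sch : Scheme) (g : ℕ → ℝ) (i : ℕ) : ℝ :=
  if i = 0 then D.ρ * S.beta sch * S.gradPlus g 0 - D.κ (S.pt 0) * g 0
  else D.μ (S.pt i) * S.grad g i + 1 / 2 * D.σ (S.pt i) ^ 2 * S.lap g i - D.κ (S.pt i) * g i

/-- The mass `M_n(x_0) = M(x_0) exp (α δ⁺x_0 / σ²(x_0))`, where `M(x_0) = 1 / ρ`. -/
def speedMassZero (S : D.Grid n) (sch : Scheme) : ℝ :=
  1 / D.ρ * Real.exp (S.alpha sch / D.σ (S.pt 0) ^ 2 * S.dplus 0)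

/-- The discrete speed density `m_n(x_i)`, for `i = 1, …, n`. -/
def speedDensity (S : D.Grid n) (sch : Scheme) (i : ℕ) : ℝ :=
  S.speedMassZero sch * S.beta sch
    * (2 * D.ρ / (-D.μ (S.pt 1) * S.dplus 1 + D.σ (S.pt 1) ^ 2))
    * ∏ j ∈ Finset.Ico 1 i, (D.μ (S.pt j) * S.dminus j + D.σ (S.pt j) ^ 2)
        / (-D.μ (S.pt (j + 1)) * S.dplus (j + 1) + D.σ (S.pt (j + 1)) ^ 2)

/-- The discrete speed measure `M_n(x_i)`, for `i = 0, …, n`. -/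
def speedMass (S : D.Grid n) (sch : Scheme) (i : ℕ) : ℝ :=
  if i = 0 then S.speedMassZero sch else S.speedDensity sch i * S.davg i

/-- The inner product `(g₁, g₂)_n`, a sum over `x_0, …, x_n`. -/
def innerProd (S : D.Grid n) (sch : Scheme) (g₁ g₂ : ℕ → ℝ) : ℝ :=
  ∑ i ∈ Finset.range (n + 1), g₁ i * g₂ i * S.speedMass sch i

/-- `g` is an eigenvector, for the eigenvalue `lam`, of the problem `G_n g = -lam g` at
`x_0, …, x_n` with `g(x_{n+1}) = 0`. -/
structure IsEigenvector (S : D.Grid n) (sch : Scheme) (lam : ℝ) (g : ℕ → ℝ) : Prop where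
  eqn : ∀ i ≤ n, S.generator sch g i = -lam * g i
  right : g (n + 1) = 0
  nonzero : ∃ i ≤ n, g i ≠ 0

/-- The set of eigenvalues of the discrete problem. -/
def eigenvalues (S : D.Grid n) (sch : Scheme) : Set ℝ :=
  {lam | ∃ g, S.IsEigenvector sch lam g}

/-- `g` is a `k`-th normalized eigenvector (`k = 1, 2, …`): an eigenvector with `(g, g)_n = 1`
for the `k`-th smallest eigenvalue. -/
def IsNormalizedEigenvector (S : D.Grid n) (sch : Scheme) (k : ℕ) (g : ℕ → ℝ) : Prop :=
  ∃ lam, S.IsEigenvector sch lam g ∧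
    {ν | ν ∈ S.eigenvalues sch ∧ ν < lam}.encard + 1 = (k : ℕ∞) ∧ S.innerProd sch g g = 1

/-- The maximum norm `‖g‖_{n,∞}` over all grid points `x_0, …, x_{n+1}`. -/
def supNorm (_S : D.Grid n) (g : ℕ → ℝ) : ℝ :=
  (Finset.range (n + 2)).sup' Finset.nonempty_range_add_one fun i => |g i|

end StickyDiffusion.Grid

end

/-! ### Calculus: Taylor remainders, trapezoidal rule, Grönwall inequalities. -/

noncomputable section

/-! The proof is a shooting argument carried out in parallel for the diffusion and for the chain.
With a = μ/σ² and b = 2/σ² the eigenvalue equation is y'' = -2a y' + b(κ - λ)y, and the condition at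
l is y'(l) = (κ(l) - λ)y(l)/ρ. Let y_λ be the solution with y_λ(l) = 1. Eigenfunctions are multiples
of y_λ, and eigenvalues are the zeros of λ ↦ y_λ(r). On the grid, the equations of the chain are
exactly the velocity Verlet scheme for this ODE with the discrete velocity eliminated
(`gradPlus_dsY_succ`, `gradPlus_dsY_zero`). Hence eigenvectors are multiples of the Verlet solution
Y_λ with Y_λ(x_0) = 1, and discrete eigenvalues are the zeros of λ ↦ Y_λ(x_{n+1}). In Scheme 2 the
initial Verlet velocity is exact; in Scheme 1 it has a relative error O(h), as has the mass at the
sticky point. This alone separates γ = 2 from γ = 1.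

All estimates are explicit in the frequency w = √(2 + λ) and otherwise uniform in λ. Energy
estimates give y_λ = O(w), y_λ' = O(w²), one more power of w per derivative, and (y_λ, y_λ) ≥ c w².
The Verlet scheme is second order on an arbitrary grid, and one step of length δ inflates a suitable
energy norm by at most 1 + Kδ as long as w³δ² ≤ 1 (`exists_verlet_stability`). So Y_λ - y_λ = O(w
ε), where ε = w³h² for Scheme 2 and ε = w³h² + h for Scheme 1 (`exists_error_bound`).

Eigenvalues: by the Wronskian identity, at an eigenvalue λ the product of the flux at r with y_ν(r)
equals (ν - λ)(y_λ, y_ν). The flux is O(w²) and the inner product is at least c w² for ν near λ, so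
the shooting function crosses zero with slope bounded below uniformly in λ (`exists_hasSlope`, in
both settings). Every zero of one shooting function therefore has a zero of the other nearby,
distinct zeros stay a fixed distance apart, and counting zeros in both directions gives |λ_k^n -
λ_k| = O(w ε) (`exists_eigenvalue_error`).

Eigenvectors: the discrete speed measure is a second order quadrature rule for the speed measure, up
to the boundary error of Scheme 1 and a term at r that vanishes for eigenfunctions
(`exists_quadrature_error`). So the normalizing amplitudes, of size O(1/w), are also close, the
powers of w cancel, and the eigenvector error is O(ε) (`exists_eigenvector_error`). Finally a Prüfer
angle argument gives λ_k = O(k²) (`exists_eigenvalue_bound`), whence w³ ≤ w⁴ = O(k⁴), while k⁵h ≤ 1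
makes w²h as small as needed. -/

theorem exists_derivWithin_bound {l r : ℝ} (hlr : l < r) {f : ℝ → ℝ}
    (hf : ContDiffOn ℝ 2 f (Icc l r)) :
    ∃ f1 f2 : ℝ → ℝ, ∃ B : ℝ, (∀ x ∈ Icc l r, HasDerivWithinAt f (f1 x) (Icc l r) x) ∧
      (∀ x ∈ Icc l r, HasDerivWithinAt f1 (f2 x) (Icc l r) x) ∧
      ∀ x ∈ Icc l r, |f x| ≤ B ∧ |f1 x| ≤ B ∧ |f2 x| ≤ B := by
  have hu : UniqueDiffOn ℝ (Icc l r) := uniqueDiffOn_Icc hlr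
  have h1 : ContDiffOn ℝ 1 (derivWithin f (Icc l r)) (Icc l r) :=
    hf.derivWithin hu (by norm_num)
  have h2 : ContDiffOn ℝ 0 (derivWithin (derivWithin f (Icc l r)) (Icc l r)) (Icc l r) :=
    h1.derivWithin hu (by norm_num)
  obtain ⟨B0, hB0⟩ := isCompact_Icc.exists_bound_of_continuousOn hf.continuousOn
  obtain ⟨B1, hB1⟩ := isCompact_Icc.exists_bound_of_continuousOn h1.continuousOn
  obtain ⟨B2, hB2⟩ := isCompact_Icc.exists_bound_of_continuousOn h2.continuousOn
  refine ⟨derivWithin f (Icc l r), derivWithin (derivWithin f (Icc l r)) (Icc l r),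
    max B0 (max B1 B2), fun x hx => ?_, fun x hx => ?_, fun x hx => ⟨?_, ?_, ?_⟩⟩
  · exact ((hf.differentiableOn (by norm_num)) x hx).hasDerivWithinAt
  · exact ((h1.differentiableOn (by norm_num)) x hx).hasDerivWithinAt
  · exact (hB0 x hx).trans (le_max_left _ _)
  · exact (hB1 x hx).trans ((le_max_left _ _).trans (le_max_right _ _))
  · exact (hB2 x hx).trans ((le_max_right _ _).trans (le_max_right _ _))

/-- Comparison of two functions on an interval through their derivatives. -/
theorem abs_le_of_abs_deriv_le {x z : ℝ} {f f1 g g1 : ℝ → ℝ}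
    (hf : ∀ t ∈ Icc x z, HasDerivWithinAt f (f1 t) (Icc x z) t)
    (hg : ∀ t, HasDerivAt g (g1 t) t) (h0 : |f x| ≤ g x)
    (hle : ∀ t ∈ Icc x z, |f1 t| ≤ g1 t) : ∀ t ∈ Icc x z, |f t| ≤ g t := by
  refine image_norm_le_of_norm_deriv_right_le_deriv_boundary (f' := f1)
    (fun t ht => (hf t ht).continuousWithinAt) (fun t ht => ?_) h0 hg
    (fun t ht => hle t (Ico_subset_Icc_self ht))
  exact (hf t (Ico_subset_Icc_self ht)).mono_of_mem_nhdsWithin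
    (Icc_mem_nhdsGE_of_mem ht)

theorem abs_sub_le_of_deriv_bound {x z B : ℝ} {f f1 : ℝ → ℝ}
    (hf : ∀ t ∈ Icc x z, HasDerivWithinAt f (f1 t) (Icc x z) t)
    (hB : ∀ t ∈ Icc x z, |f1 t| ≤ B) : ∀ t ∈ Icc x z, |f t - f x| ≤ B * (t - x) :=
  abs_le_of_abs_deriv_le (f := fun t => f t - f x) (g := fun t => B * (t - x)) (g1 := fun _ => B)
    (fun t ht => (hf t ht).sub_const _)
    (fun t => by simpa using ((hasDerivAt_id t).sub_const x).const_mul B) (by simp) hB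

theorem abs_taylor_one_le {x z B : ℝ} {f f1 f2 : ℝ → ℝ}
    (hf : ∀ t ∈ Icc x z, HasDerivWithinAt f (f1 t) (Icc x z) t)
    (hf1 : ∀ t ∈ Icc x z, HasDerivWithinAt f1 (f2 t) (Icc x z) t)
    (hB : ∀ t ∈ Icc x z, |f2 t| ≤ B) :
    ∀ t ∈ Icc x z, |f t - f x - (t - x) * f1 x| ≤ B / 2 * (t - x) ^ 2 := by
  refine abs_le_of_abs_deriv_le (f := fun t => f t - f x - (t - x) * f1 x)
    (f1 := fun t => f1 t - f1 x)
    (g := fun t => B / 2 * (t - x) ^ 2) (g1 := fun t => B * (t - x))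
    (fun t ht => ?_) (fun t => ?_) (by simp) (abs_sub_le_of_deriv_bound hf1 hB)
  · exact (((hf t ht).sub_const (f x)).sub
      (((hasDerivWithinAt_id t (Icc x z)).sub_const x).mul_const (f1 x))).congr_deriv (by simp)
  · exact ((((hasDerivAt_id t).sub_const x).pow 2).const_mul (B / 2)).congr_deriv
      (by simp; ring)

theorem abs_taylor_two_le {x z B : ℝ} {f f1 f2 f3 : ℝ → ℝ}
    (hf : ∀ t ∈ Icc x z, HasDerivWithinAt f (f1 t) (Icc x z) t)
    (hf1 : ∀ t ∈ Icc x z, HasDerivWithinAt f1 (f2 t) (Icc x z) t)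
    (hf2 : ∀ t ∈ Icc x z, HasDerivWithinAt f2 (f3 t) (Icc x z) t)
    (hB : ∀ t ∈ Icc x z, |f3 t| ≤ B) :
    ∀ t ∈ Icc x z,
      |f t - f x - (t - x) * f1 x - (t - x) ^ 2 / 2 * f2 x| ≤ B / 6 * (t - x) ^ 3 := by
  refine abs_le_of_abs_deriv_le
    (f := fun t => f t - f x - (t - x) * f1 x - (t - x) ^ 2 / 2 * f2 x)
    (f1 := fun t => f1 t - f1 x - (t - x) * f2 x)
    (g := fun t => B / 6 * (t - x) ^ 3) (g1 := fun t => B / 2 * (t - x) ^ 2)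
    (fun t ht => ?_) (fun t => ?_) (by simp) (abs_taylor_one_le hf1 hf2 hB)
  · exact ((((hf t ht).sub_const (f x)).sub
      (((hasDerivWithinAt_id t (Icc x z)).sub_const x).mul_const (f1 x))).sub
      (((((hasDerivWithinAt_id t (Icc x z)).sub_const x).pow 2).div_const 2).mul_const
        (f2 x))).congr_deriv (by simp)
  · exact ((((hasDerivAt_id t).sub_const x).pow 3).const_mul (B / 6)).congr_deriv
      (by simp; ring)

/-- The error of the trapezoidal rule. -/
theorem abs_trapezoid_le {x z B : ℝ} (hxz : x ≤ z) {f f1 f2 f3 : ℝ → ℝ}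
    (hf : ∀ t ∈ Icc x z, HasDerivWithinAt f (f1 t) (Icc x z) t)
    (hf1 : ∀ t ∈ Icc x z, HasDerivWithinAt f1 (f2 t) (Icc x z) t)
    (hf2 : ∀ t ∈ Icc x z, HasDerivWithinAt f2 (f3 t) (Icc x z) t)
    (hB : ∀ t ∈ Icc x z, |f3 t| ≤ B) :
    |f z - f x - (z - x) / 2 * (f1 x + f1 z)| ≤ B * (z - x) ^ 3 := by
  have hz : z ∈ Icc x z := right_mem_Icc.2 hxz
  have h1 := abs_taylor_two_le hf hf1 hf2 hB z hz
  have h2 := abs_taylor_one_le hf1 hf2 hB z hz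
  have hd : 0 ≤ z - x := sub_nonneg.2 hxz
  have hB0 : 0 ≤ B := (abs_nonneg _).trans (hB z hz)
  have e : f z - f x - (z - x) / 2 * (f1 x + f1 z)
      = (f z - f x - (z - x) * f1 x - (z - x) ^ 2 / 2 * f2 x)
        - (z - x) / 2 * (f1 z - f1 x - (z - x) * f2 x) := by ring
  rw [e]
  refine (abs_sub _ _).trans ?_
  rw [abs_mul, abs_of_nonneg (by positivity : 0 ≤ (z - x) / 2)]
  have h3 : (z - x) / 2 * |f1 z - f1 x - (z - x) * f2 x|
      ≤ (z - x) / 2 * (B / 2 * (z - x) ^ 2) := by gcongr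
  have h4 : 0 ≤ B * (z - x) ^ 3 := by positivity
  nlinarith

theorem abs_integral_trapezoid_le {x z B : ℝ} (hxz : x ≤ z) {f f1 f2 : ℝ → ℝ}
    (hf : ∀ t ∈ Icc x z, HasDerivWithinAt f (f1 t) (Icc x z) t)
    (hf1 : ∀ t ∈ Icc x z, HasDerivWithinAt f1 (f2 t) (Icc x z) t)
    (hB : ∀ t ∈ Icc x z, |f2 t| ≤ B) :
    |(∫ t in x..z, f t) - (z - x) / 2 * (f x + f z)| ≤ B * (z - x) ^ 3 := by
  have hc : ContinuousOn f (Icc x z) := fun t ht => (hf t ht).continuousWithinAt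
  have h := abs_trapezoid_le hxz (f := fun t => ∫ s in x..t, f s)
    (f1 := f) (f2 := f1) (f3 := f2) (fun t ht => ?_) hf hf1 hB
  · simpa using h
  · have hi : IntervalIntegrable f MeasureTheory.volume x t :=
      (hc.mono (Icc_subset_Icc_right ht.2)).intervalIntegrable_of_Icc ht.1
    -- This `Fact` selects the `FTCFilter` instance for `𝓝[Icc x z] t`, so that the fundamental
    -- theorem also yields the one-sided derivatives at the endpoints.
    have : Fact (t ∈ Icc x z) := ⟨ht⟩
    exact intervalIntegral.integral_hasDerivWithinAt_right hi
      (hc.stronglyMeasurableAtFilter_nhdsWithin measurableSet_Icc t) (hc t ht)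

/-- A multiplicative discrete Grönwall inequality. -/
theorem discrete_gronwall_le {n : ℕ} {N t : ℕ → ℝ} {K : ℝ} (hK : 0 ≤ K) (hN0 : 0 ≤ N 0)
    (ht : ∀ i ≤ n, t i ≤ t (i + 1))
    (h : ∀ i ≤ n, N (i + 1) ≤ (1 + K * (t (i + 1) - t i)) * N i) :
    ∀ i ≤ n + 1, N i ≤ Real.exp (K * (t i - t 0)) * N 0 := by
  intro i
  induction i with
  | zero => simp
  | succ i ih =>
    intro hi
    have hi' : i ≤ n := by omega
    have h0 : 0 ≤ K * (t (i + 1) - t i) := mul_nonneg hK (sub_nonneg.2 (ht i hi'))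
    calc N (i + 1) ≤ (1 + K * (t (i + 1) - t i)) * N i := h i hi'
      _ ≤ (1 + K * (t (i + 1) - t i)) * (Real.exp (K * (t i - t 0)) * N 0) := by
        gcongr; exact ih (by omega)
      _ ≤ Real.exp (K * (t (i + 1) - t i)) * (Real.exp (K * (t i - t 0)) * N 0) := by
        gcongr; linarith [Real.add_one_le_exp (K * (t (i + 1) - t i))]
      _ = Real.exp (K * (t (i + 1) - t 0)) * N 0 := by
        rw [← mul_assoc, ← Real.exp_add]; ring_nf

/-- A differential Grönwall inequality. -/
theorem gronwall_le {l r K : ℝ} {E E1 : ℝ → ℝ} (hc : ContinuousOn E (Icc l r))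
    (hd : ∀ x ∈ Ioo l r, HasDerivAt E (E1 x) x) (hE : ∀ x ∈ Ioo l r, E1 x ≤ K * E x) :
    ∀ x ∈ Icc l r, E x ≤ Real.exp (K * (x - l)) * E l := by
  intro x hx
  have hd' : ∀ t ∈ Ioo l r, HasDerivAt (fun s => Real.exp (-(K * (s - l))) * E s)
      (Real.exp (-(K * (t - l))) * (-K) * E t + Real.exp (-(K * (t - l))) * E1 t) t := by
    intro t ht
    have h1 : HasDerivAt (fun s => Real.exp (-(K * (s - l)))) (Real.exp (-(K * (t - l))) * (-K)) t := by
      have := ((((hasDerivAt_id t).sub_const l).const_mul K).neg).exp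
      simpa using this
    exact h1.mul (hd t ht)
  have hanti : AntitoneOn (fun s => Real.exp (-(K * (s - l))) * E s) (Icc l r) := by
    refine antitoneOn_of_deriv_nonpos (convex_Icc l r) ?_ ?_ ?_
    · exact (Continuous.continuousOn (by fun_prop)).mul hc
    · rw [interior_Icc]
      exact fun t ht => (hd' t ht).differentiableAt.differentiableWithinAt
    · rw [interior_Icc]
      intro t ht
      rw [(hd' t ht).deriv]
      have := hE t ht
      have h0 := Real.exp_pos (-(K * (t - l)))
      nlinarith
  have h := hanti (left_mem_Icc.2 (hx.1.trans hx.2)) hx hx.1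
  simp only [sub_self, mul_zero, neg_zero, Real.exp_zero, one_mul] at h
  calc E x = Real.exp (K * (x - l)) * (Real.exp (-(K * (x - l))) * E x) := by
        rw [← mul_assoc, ← Real.exp_add]; simp
    _ ≤ _ := by gcongr

/-! ### Coefficients in normal form and the forward energy estimate. -/

namespace StickyDiffusion

variable {D : StickyDiffusion}

/-- The ratio `μ / σ²`. -/
def driftRatio (D : StickyDiffusion) (x : ℝ) : ℝ := D.μ x / D.σ x ^ 2

/-- The function `2 / σ²`. -/
def twoInvVar (D : StickyDiffusion) (x : ℝ) : ℝ := 2 / D.σ x ^ 2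

/-- The reciprocal `1 / s` of the scale density. -/
def weight (D : StickyDiffusion) (x : ℝ) : ℝ := Real.exp (∫ y in D.l..x, 2 * D.driftRatio y)

/-- Since the weight p = 1/s satisfies p' = 2ap, the equation takes the self-adjoint form (p y')' =
m(κ - λ)y with m = bp. Every Wronskian computation rests on this factorization. -/
theorem speedDensity_eq (x : ℝ) : D.speedDensity x = D.twoInvVar x * D.weight x := by
  have : (fun y => 2 * D.μ y / D.σ y ^ 2) = fun y => 2 * D.driftRatio y := by
    funext y; simp [driftRatio, mul_div_assoc]
  rw [speedDensity, scaleDensity, twoInvVar, weight, this, Real.exp_neg, ← div_div, div_inv_eq_mul]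

/-- The second derivative prescribed by the eigenvalue equation. -/
def accel (D : StickyDiffusion) (lam x y u : ℝ) : ℝ :=
  -2 * D.driftRatio x * u + D.twoInvVar x * (D.κ x - lam) * y

/-- Derivatives and common bounds of the coefficients. -/
structure CoeffBounds (D : StickyDiffusion) where
  a1 : ℝ → ℝ
  a2 : ℝ → ℝ
  b1 : ℝ → ℝ
  b2 : ℝ → ℝ
  c1 : ℝ → ℝ
  c2 : ℝ → ℝ
  B : ℝ
  one_le : 1 ≤ B
  ha : ∀ x ∈ Icc D.l D.r, HasDerivWithinAt D.driftRatio (a1 x) (Icc D.l D.r) x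
  ha1 : ∀ x ∈ Icc D.l D.r, HasDerivWithinAt a1 (a2 x) (Icc D.l D.r) x
  hb : ∀ x ∈ Icc D.l D.r, HasDerivWithinAt D.twoInvVar (b1 x) (Icc D.l D.r) x
  hb1 : ∀ x ∈ Icc D.l D.r, HasDerivWithinAt b1 (b2 x) (Icc D.l D.r) x
  hc : ∀ x ∈ Icc D.l D.r, HasDerivWithinAt D.κ (c1 x) (Icc D.l D.r) x
  hc1 : ∀ x ∈ Icc D.l D.r, HasDerivWithinAt c1 (c2 x) (Icc D.l D.r) x
  a_le : ∀ x ∈ Icc D.l D.r, |D.driftRatio x| ≤ B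
  a1_le : ∀ x ∈ Icc D.l D.r, |a1 x| ≤ B
  a2_le : ∀ x ∈ Icc D.l D.r, |a2 x| ≤ B
  b_le : ∀ x ∈ Icc D.l D.r, |D.twoInvVar x| ≤ B
  b1_le : ∀ x ∈ Icc D.l D.r, |b1 x| ≤ B
  b2_le : ∀ x ∈ Icc D.l D.r, |b2 x| ≤ B
  c_le : ∀ x ∈ Icc D.l D.r, |D.κ x| ≤ B
  c1_le : ∀ x ∈ Icc D.l D.r, |c1 x| ≤ B
  c2_le : ∀ x ∈ Icc D.l D.r, |c2 x| ≤ B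
  var_pos : ∀ x ∈ Icc D.l D.r, 0 < D.σ x ^ 2
  b_ge : ∀ x ∈ Icc D.l D.r, 1 ≤ B * D.twoInvVar x
  c_nonneg : ∀ x ∈ Icc D.l D.r, 0 ≤ D.κ x
  len_le : D.r - D.l ≤ B
  rho_le : D.ρ ≤ B
  rho_ge : 1 / D.ρ ≤ B

theorem Regular.nonempty_coeffBounds (hD : D.Regular) : Nonempty D.CoeffBounds := by
  have hne : ∀ x ∈ Icc D.l D.r, D.σ x ^ 2 ≠ 0 := fun x hx => (hD.variance_pos x hx).ne'
  have hv : ContDiffOn ℝ 2 (fun x => D.σ x ^ 2) (Icc D.l D.r) :=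
    hD.variance_smooth.of_le (by norm_num)
  have ha : ContDiffOn ℝ 2 D.driftRatio (Icc D.l D.r) :=
    (hD.drift_smooth.of_le (by norm_num)).div hv hne
  have hb : ContDiffOn ℝ 2 D.twoInvVar (Icc D.l D.r) := contDiffOn_const.div hv hne
  obtain ⟨a1, a2, Ba, ha, ha1, hBa⟩ := exists_derivWithin_bound D.l_lt_r ha
  obtain ⟨b1, b2, Bb, hb, hb1, hBb⟩ := exists_derivWithin_bound D.l_lt_r hb
  obtain ⟨c1, c2, Bc, hc, hc1, hBc⟩ := exists_derivWithin_bound D.l_lt_r hD.killing_smooth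
  obtain ⟨Bv, hBv⟩ := isCompact_Icc.exists_bound_of_continuousOn hv.continuousOn
  obtain ⟨B, hB⟩ : ∃ B, B = max 1 (max Ba (max Bb (max Bc (max Bv
    (max (D.r - D.l) (max D.ρ (1 / D.ρ))))))) := ⟨_, rfl⟩
  have h1 : 1 ≤ B := by rw [hB]; simp
  have h2 : Ba ≤ B := by rw [hB]; simp
  have h3 : Bb ≤ B := by rw [hB]; simp
  have h4 : Bc ≤ B := by rw [hB]; simp
  have h5 : Bv ≤ B := by rw [hB]; simp
  have h6 : D.r - D.l ≤ B := by rw [hB]; simp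
  have h7 : D.ρ ≤ B := by rw [hB]; simp
  have h8 : 1 / D.ρ ≤ B := by rw [hB]; simp
  refine ⟨⟨a1, a2, b1, b2, c1, c2, B, h1, ha, ha1, hb, hb1, hc, hc1,
    fun x hx => (hBa x hx).1.trans h2, fun x hx => (hBa x hx).2.1.trans h2,
    fun x hx => (hBa x hx).2.2.trans h2, fun x hx => (hBb x hx).1.trans h3,
    fun x hx => (hBb x hx).2.1.trans h3, fun x hx => (hBb x hx).2.2.trans h3,
    fun x hx => (hBc x hx).1.trans h4, fun x hx => (hBc x hx).2.1.trans h4,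
    fun x hx => (hBc x hx).2.2.trans h4, hD.variance_pos, fun x hx => ?_, hD.killing_nonneg,
    h6, h7, h8⟩⟩
  have h9 : D.σ x ^ 2 ≤ B := (le_abs_self _).trans ((hBv x hx).trans h5)
  rw [twoInvVar, mul_div_assoc', le_div_iff₀ (hD.variance_pos x hx)]
  linarith

namespace CoeffBounds

theorem B_pos (H : D.CoeffBounds) : 0 < H.B := one_pos.trans_le H.one_le

theorem b_pos (H : D.CoeffBounds) {x : ℝ} (hx : x ∈ Icc D.l D.r) : 0 < D.twoInvVar x := by
  have := H.var_pos x hx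
  rw [twoInvVar]; positivity

theorem continuousOn_a (H : D.CoeffBounds) : ContinuousOn D.driftRatio (Icc D.l D.r) :=
  fun x hx => (H.ha x hx).continuousWithinAt

theorem continuousOn_b (H : D.CoeffBounds) : ContinuousOn D.twoInvVar (Icc D.l D.r) :=
  fun x hx => (H.hb x hx).continuousWithinAt

theorem continuousOn_c (H : D.CoeffBounds) : ContinuousOn D.κ (Icc D.l D.r) :=
  fun x hx => (H.hc x hx).continuousWithinAt

theorem hasDerivWithinAt_weight (H : D.CoeffBounds) {x : ℝ} (hx : x ∈ Icc D.l D.r) :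
    HasDerivWithinAt D.weight (2 * D.driftRatio x * D.weight x) (Icc D.l D.r) x := by
  have hc : ContinuousOn (fun y => 2 * D.driftRatio y) (Icc D.l D.r) :=
    continuousOn_const.mul H.continuousOn_a
  have hi : IntervalIntegrable (fun y => 2 * D.driftRatio y) MeasureTheory.volume D.l x :=
    (hc.mono (Icc_subset_Icc_right hx.2)).intervalIntegrable_of_Icc hx.1
  have : Fact (x ∈ Icc D.l D.r) := ⟨hx⟩
  exact (intervalIntegral.integral_hasDerivWithinAt_right hi
    (hc.stronglyMeasurableAtFilter_nhdsWithin measurableSet_Icc x) (hc x hx)).exp.congr_deriv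
    (by simp only [weight]; ring)

theorem weight_left : D.weight D.l = 1 := by simp [weight]

theorem weight_pos (x : ℝ) : 0 < D.weight x := Real.exp_pos _

theorem exists_weight_bound (H : D.CoeffBounds) : ∃ C : ℝ, 1 ≤ C ∧ ∀ x ∈ Icc D.l D.r,
    D.weight x ≤ C ∧ 1 ≤ C * D.weight x := by
  refine ⟨Real.exp (2 * H.B * H.B), Real.one_le_exp (by have := H.B_pos; positivity),
    fun x hx => ?_⟩
  have h : |∫ y in D.l..x, 2 * D.driftRatio y| ≤ 2 * H.B * H.B := by
    have h1 := intervalIntegral.norm_integral_le_of_norm_le_const (a := D.l) (b := x)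
      (f := fun y => 2 * D.driftRatio y) (C := 2 * H.B) (fun y hy => by
        rw [uIoc_of_le hx.1] at hy
        rw [norm_mul, Real.norm_two, Real.norm_eq_abs]
        have := H.a_le y ⟨hy.1.le, hy.2.trans hx.2⟩
        linarith)
    rw [Real.norm_eq_abs, abs_of_nonneg (sub_nonneg.2 hx.1)] at h1
    refine h1.trans ?_
    have := H.len_le
    have := H.B_pos
    gcongr
    linarith [hx.2]
  rw [abs_le] at h
  refine ⟨Real.exp_le_exp.2 h.2, ?_⟩
  rw [weight, ← Real.exp_add]
  exact Real.one_le_exp (by linarith)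

/-- The energy estimate for the equation with a forcing term. -/
theorem exists_energy_bound (H : D.CoeffBounds) : ∃ K : ℝ, 1 ≤ K ∧ ∀ lam : ℝ, -1 ≤ lam → ∀ z v f : ℝ → ℝ, ∀ Φ : ℝ,
    ContinuousOn z (Icc D.l D.r) → ContinuousOn v (Icc D.l D.r) →
    (∀ x ∈ Ioo D.l D.r, HasDerivAt z (v x) x) →
    (∀ x ∈ Ioo D.l D.r, HasDerivAt v (D.accel lam x (z x) (v x) + f x) x) →
    (∀ x ∈ Ioo D.l D.r, |f x| ≤ Φ) →
    ∀ x ∈ Icc D.l D.r, (2 + lam) * z x ^ 2 + v x ^ 2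
      ≤ K * ((2 + lam) * z D.l ^ 2 + v D.l ^ 2 + Φ ^ 2) := by
  have hB := H.one_le
  obtain ⟨K, hK⟩ : ∃ K, K = H.B ^ 2 + 4 * H.B + H.B ^ 2 * (H.B + 2) + H.B * (H.B + 2) + 1 :=
    ⟨_, rfl⟩
  have hK0 : 1 ≤ K := by rw [hK]; nlinarith [mul_nonneg (zero_le_one.trans hB) (zero_le_one.trans hB)]
  refine ⟨H.B * (Real.exp (K * H.B) * H.B), ?_, ?_⟩
  · have h1 : 1 ≤ Real.exp (K * H.B) := Real.one_le_exp (by positivity)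
    have h2 : 1 ≤ Real.exp (K * H.B) * H.B := one_le_mul_of_one_le_of_one_le h1 hB
    exact one_le_mul_of_one_le_of_one_le hB h2
  intro lam hlam z v f Φ hz hv hz' hv' hf x hx
  have hΦ : 0 ≤ Φ := by
    have hm : (D.l + D.r) / 2 ∈ Ioo D.l D.r := ⟨by linarith [D.l_lt_r], by linarith [D.l_lt_r]⟩
    exact (abs_nonneg _).trans (hf _ hm)
  have hw : 1 ≤ 2 + lam := by linarith
  -- The weight (2 + λ)b on z² is chosen so that λ drops out: the cross terms 2(2 + λ)b z v and 2b(κ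
  -- - λ)z v add up to 2b(κ + 2)z v. The Grönwall rate K is thus independent of λ. The constant Φ²
  -- is included in the energy to make the inequality homogeneous.
  have key := gronwall_le (l := D.l) (r := D.r) (K := K)
    (E := fun t => (2 + lam) * (D.twoInvVar t * z t ^ 2) + v t ^ 2 + Φ ^ 2)
    (E1 := fun t => (2 + lam) * (H.b1 t * z t ^ 2 + D.twoInvVar t * (2 * z t * v t))
      + 2 * v t * (D.accel lam t (z t) (v t) + f t))
    ?_ ?_ ?_ x hx
  · have hbx := H.b_ge x hx
    have hbl := H.b_le D.l (left_mem_Icc.2 D.l_lt_r.le)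
    have hl : (2 + lam) * (D.twoInvVar D.l * z D.l ^ 2) + v D.l ^ 2 + Φ ^ 2
        ≤ H.B * ((2 + lam) * z D.l ^ 2 + v D.l ^ 2 + Φ ^ 2) := by
      have h1 : (2 + lam) * z D.l ^ 2 * D.twoInvVar D.l ≤ (2 + lam) * z D.l ^ 2 * H.B := by
        gcongr; exact (le_abs_self _).trans hbl
      have h2 : v D.l ^ 2 ≤ H.B * v D.l ^ 2 := le_mul_of_one_le_left (sq_nonneg _) hB
      have h3 : Φ ^ 2 ≤ H.B * Φ ^ 2 := le_mul_of_one_le_left (sq_nonneg _) hB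
      linarith
    have hr : (2 + lam) * z x ^ 2 + v x ^ 2
        ≤ H.B * ((2 + lam) * (D.twoInvVar x * z x ^ 2) + v x ^ 2 + Φ ^ 2) := by
      have h1 : (2 + lam) * z x ^ 2 * 1 ≤ (2 + lam) * z x ^ 2 * (H.B * D.twoInvVar x) := by gcongr
      have h2 : v x ^ 2 ≤ H.B * v x ^ 2 := le_mul_of_one_le_left (sq_nonneg _) hB
      have h3 : 0 ≤ H.B * Φ ^ 2 := by positivity
      linarith
    refine hr.trans ?_
    rw [mul_assoc, mul_assoc]
    refine mul_le_mul_of_nonneg_left (key.trans ?_) H.B_pos.le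
    have h4 : K * (x - D.l) ≤ K * H.B := by
      have := H.len_le
      gcongr
      linarith [hx.2]
    have h5 := Real.exp_le_exp.2 h4
    have h6 : 0 ≤ (2 + lam) * z D.l ^ 2 + v D.l ^ 2 + Φ ^ 2 := by positivity
    refine mul_le_mul h5 hl ?_ (Real.exp_pos _).le
    have := (H.b_pos (left_mem_Icc.2 D.l_lt_r.le)).le
    positivity
  · exact (((continuousOn_const.mul (H.continuousOn_b.mul (hz.pow 2))).add (hv.pow 2)).add
      continuousOn_const)
  · intro t ht
    have htI := Ioo_subset_Icc_self ht
    have hb := (H.hb t htI).hasDerivAt (Icc_mem_nhds ht.1 ht.2)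
    exact ((((hb.mul ((hz' t ht).pow 2)).const_mul (2 + lam)).add ((hv' t ht).pow 2)).add_const
      (Φ ^ 2)).congr_deriv (by simp)
  · intro t ht
    have htI := Ioo_subset_Icc_self ht
    have hft := abs_le.1 (hf t ht)
    have hb := H.b_ge t htI
    have hb0 := H.b_pos htI
    have hbB := (le_abs_self _).trans (H.b_le t htI)
    have hb1 := (le_abs_self _).trans (H.b1_le t htI)
    have ha := abs_le.1 (H.a_le t htI)
    have hc0 := H.c_nonneg t htI
    have hcB := (le_abs_self _).trans (H.c_le t htI)
    simp only [accel]
    obtain ⟨X, hX⟩ : ∃ X, X = (2 + lam) * (D.twoInvVar t * z t ^ 2) := ⟨_, rfl⟩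
    have hX0 : 0 ≤ X := by rw [hX]; positivity
    have hz2 : (2 + lam) * z t ^ 2 ≤ H.B * X := by
      have : (2 + lam) * z t ^ 2 * 1 ≤ (2 + lam) * z t ^ 2 * (H.B * D.twoInvVar t) := by gcongr
      rw [hX]; linarith
    have hz1 : z t ^ 2 ≤ H.B * X := by
      refine le_trans ?_ hz2
      exact le_mul_of_one_le_left (sq_nonneg _) hw
    have e1 : (2 + lam) * (H.b1 t * z t ^ 2 + D.twoInvVar t * (2 * z t * v t))
      + 2 * v t * (-2 * D.driftRatio t * v t + D.twoInvVar t * (D.κ t - lam) * z t + f t)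
      = H.b1 t * ((2 + lam) * z t ^ 2) + 4 * (-D.driftRatio t) * v t ^ 2
        + D.twoInvVar t * (D.κ t + 2) * (2 * z t * v t) + 2 * v t * f t := by ring
    rw [e1, ← hX]
    have t1 : H.b1 t * ((2 + lam) * z t ^ 2) ≤ H.B * (H.B * X) := by
      refine mul_le_mul hb1 hz2 (by positivity) H.B_pos.le
    have t2 : 4 * (-D.driftRatio t) * v t ^ 2 ≤ 4 * H.B * v t ^ 2 := by
      gcongr; linarith
    have t3 : D.twoInvVar t * (D.κ t + 2) * (2 * z t * v t)
        ≤ H.B * (H.B + 2) * (H.B * X + v t ^ 2) := by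
      have h1 : 2 * z t * v t ≤ H.B * X + v t ^ 2 := by nlinarith [sq_nonneg (z t - v t)]
      calc _ ≤ D.twoInvVar t * (D.κ t + 2) * (H.B * X + v t ^ 2) := by gcongr
        _ ≤ _ := by gcongr
    have t4 : 2 * v t * f t ≤ v t ^ 2 + Φ ^ 2 := by
      have : f t ^ 2 ≤ Φ ^ 2 := sq_le_sq' hft.1 hft.2
      nlinarith [sq_nonneg (v t - f t)]
    have hv2 := sq_nonneg (v t)
    have hp2 := sq_nonneg Φ
    have q1 : 0 ≤ (4 * H.B + H.B * (H.B + 2) + 1) * X := by positivity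
    have q2 : 0 ≤ (H.B ^ 2 + H.B ^ 2 * (H.B + 2)) * v t ^ 2 := by positivity
    have q3 : 0 ≤ (H.B ^ 2 + 4 * H.B + H.B ^ 2 * (H.B + 2) + H.B * (H.B + 2)) * Φ ^ 2 := by
      positivity
    rw [hK]
    linarith

end CoeffBounds
end StickyDiffusion

/-! ### Existence of solutions and the backward energy estimate. -/

namespace StickyDiffusion

variable {D : StickyDiffusion}

/-- The truncation of a real number to `[-R, R]`. -/
def clamp (R x : ℝ) : ℝ := max (-R) (min R x)

theorem abs_clamp_sub_clamp_le (R x y : ℝ) : |clamp R x - clamp R y| ≤ |x - y| := by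
  have h : LipschitzWith 1 (clamp R) := (LipschitzWith.id.const_min R).const_max (-R)
  simpa [Real.dist_eq] using h.dist_le_mul x y

theorem abs_clamp_le {R : ℝ} (hR : 0 ≤ R) (x : ℝ) : |clamp R x| ≤ R :=
  abs_le.2 ⟨le_max_left _ _, max_le (by linarith) (min_le_left _ _)⟩

theorem clamp_eq_self {R x : ℝ} (hx : |x| ≤ R) : clamp R x = x := by
  rw [abs_le] at hx
  rw [clamp, min_eq_right hx.2, max_eq_right hx.1]

theorem abs_clamp_le_abs {R : ℝ} (hR : 0 ≤ R) (x : ℝ) : |clamp R x| ≤ |x| := by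
  have h := abs_clamp_sub_clamp_le R x 0
  rwa [clamp_eq_self (x := 0) (by simpa), sub_zero, sub_zero] at h

namespace CoeffBounds

theorem abs_accel_le (H : D.CoeffBounds) (lam : ℝ) {x y u S : ℝ} (hx : x ∈ Icc D.l D.r)
    (hy : |y| ≤ S) (hu : |u| ≤ S) :
    |D.accel lam x y u| ≤ (2 * H.B + H.B * (H.B + |lam|)) * S := by
  have h1 : |-2 * D.driftRatio x * u| ≤ 2 * H.B * S := by
    rw [abs_mul, abs_mul, abs_neg, abs_two]
    have := H.a_le x hx
    have := H.B_pos
    gcongr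
  have h2 : |D.twoInvVar x * (D.κ x - lam) * y| ≤ H.B * (H.B + |lam|) * S := by
    rw [abs_mul, abs_mul]
    have := H.b_le x hx
    have := H.B_pos
    have := H.c_le x hx
    have : |D.κ x - lam| ≤ H.B + |lam| := (abs_sub _ _).trans (by gcongr)
    gcongr
  exact (abs_add_le _ _).trans (by linarith)

/-- Picard–Lindelöf is applied to the first order system truncated at level R, where R is the
Grönwall bound for solutions with these initial values. Truncation makes the field bounded, and
since it does not increase absolute values, the truncated solution obeys the same Grönwall bound. It
therefore never leaves the region where the truncation is the identity. -/
theorem exists_solution (H : D.CoeffBounds) (lam y0 u0 : ℝ) : ∃ y u : ℝ → ℝ,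
    (∀ x ∈ Icc D.l D.r, HasDerivWithinAt y (u x) (Icc D.l D.r) x) ∧
    (∀ x ∈ Icc D.l D.r, HasDerivWithinAt u (D.accel lam x (y x) (u x)) (Icc D.l D.r) x) ∧
    y D.l = y0 ∧ u D.l = u0 := by
  have hB := H.B_pos
  obtain ⟨K, hK⟩ : ∃ K, K = 2 * H.B + H.B * (H.B + |lam|) + 1 := ⟨_, rfl⟩
  have hK0 : 1 ≤ K := by rw [hK]; have : 0 ≤ 2 * H.B + H.B * (H.B + |lam|) := by positivity
                         linarith
  obtain ⟨R, hR⟩ : ∃ R, R = ‖((y0, u0) : ℝ × ℝ)‖ * Real.exp (K * (D.r - D.l)) := ⟨_, rfl⟩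
  have hR0 : 0 ≤ R := by rw [hR]; positivity
  have hlen : 0 ≤ D.r - D.l := by linarith [D.l_lt_r]
  let f : ℝ → ℝ × ℝ → ℝ × ℝ := fun t z =>
    (clamp R z.2, D.accel lam t (clamp R z.1) (clamp R z.2))
  have hsmall : ∀ t ∈ Icc D.l D.r, ∀ z : ℝ × ℝ, ∀ S : ℝ, |clamp R z.1| ≤ S → |clamp R z.2| ≤ S →
      ‖f t z‖ ≤ K * S := by
    intro t ht z S h1 h2
    have hS : 0 ≤ S := (abs_nonneg _).trans h1
    refine max_le ?_ ?_
    · exact h2.trans (le_mul_of_one_le_left hS hK0)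
    · refine (H.abs_accel_le lam ht h1 h2).trans ?_
      gcongr
      linarith
  -- The truncated field is bounded by K R, so a ball of radius K R (r - l) is large enough to reach
  -- the whole interval in one application.
  have hPL : IsPicardLindelof f (⟨D.l, left_mem_Icc.2 D.l_lt_r.le⟩ : Icc D.l D.r) (y0, u0)
      (⟨K * R * (D.r - D.l), by positivity⟩ : NNReal) 0 ⟨K * R, by positivity⟩
      ⟨K, by linarith⟩ := by
    refine ⟨fun t ht => ?_, fun z _ => ?_, fun t ht z _ => ?_, ?_⟩
    · refine LipschitzOnWith.of_dist_le_mul fun z _ z' _ => ?_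
      have h1 : |clamp R z.1 - clamp R z'.1| ≤ dist z z' :=
        (abs_clamp_sub_clamp_le _ _ _).trans (le_max_left _ _)
      have h2 : |clamp R z.2 - clamp R z'.2| ≤ dist z z' :=
        (abs_clamp_sub_clamp_le _ _ _).trans (le_max_right _ _)
      refine max_le ?_ ?_
      · exact h2.trans (le_mul_of_one_le_left dist_nonneg hK0)
      · change |_ - _| ≤ K * dist z z'
        have e : D.accel lam t (clamp R z.1) (clamp R z.2)
            - D.accel lam t (clamp R z'.1) (clamp R z'.2)
            = D.accel lam t (clamp R z.1 - clamp R z'.1) (clamp R z.2 - clamp R z'.2) := by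
          simp only [accel]; ring
        rw [e]
        refine (H.abs_accel_le lam ht h1 h2).trans ?_
        gcongr
        linarith
    · refine continuousOn_const.prodMk ?_
      simp only [accel]
      exact ((continuousOn_const.mul H.continuousOn_a).mul continuousOn_const).add
        ((H.continuousOn_b.mul (H.continuousOn_c.sub continuousOn_const)).mul continuousOn_const)
    · exact hsmall t ht z R (abs_clamp_le hR0 _) (abs_clamp_le hR0 _)
    · change K * R * max (D.r - D.l) (D.l - D.l) ≤ K * R * (D.r - D.l) - 0
      rw [sub_self, max_eq_left hlen, sub_zero]
  obtain ⟨α, hα0, hα⟩ := hPL.exists_eq_forall_mem_Icc_hasDerivWithinAt₀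
  have hbound : ∀ t ∈ Icc D.l D.r, ‖α t‖ ≤ R := by
    intro t ht
    have h := norm_le_gronwallBound_of_norm_deriv_right_le (f := α) (f' := fun t => f t (α t))
      (δ := ‖((y0, u0) : ℝ × ℝ)‖) (K := K) (ε := 0) (a := D.l) (b := D.r)
      (fun t ht => (hα t ht).continuousWithinAt)
      (fun t ht => (hα t (Ico_subset_Icc_self ht)).mono_of_mem_nhdsWithin
        (Icc_mem_nhdsGE_of_mem ht))
      (by rw [show α D.l = (y0, u0) from hα0])
      (fun t ht => by
        rw [add_zero]
        exact hsmall t (Ico_subset_Icc_self ht) _ _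
          ((abs_clamp_le_abs hR0 _).trans (le_max_left _ _))
          ((abs_clamp_le_abs hR0 _).trans (le_max_right _ _))) t ht
    rw [gronwallBound_ε0] at h
    refine h.trans ?_
    rw [hR]
    gcongr
    exact ht.2
  have hf : ∀ t ∈ Icc D.l D.r, f t (α t) = ((α t).2, D.accel lam t (α t).1 (α t).2) := by
    intro t ht
    have h := hbound t ht
    simp only [f]
    rw [clamp_eq_self ((le_max_left _ _).trans h), clamp_eq_self ((le_max_right _ _).trans h)]
  refine ⟨fun t => (α t).1, fun t => (α t).2, fun t ht => ?_, fun t ht => ?_, ?_, ?_⟩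
  · have h := hα t ht
    rw [hf t ht] at h
    exact (ContinuousLinearMap.fst ℝ ℝ ℝ).hasFDerivAt.comp_hasDerivWithinAt t h
  · have h := hα t ht
    rw [hf t ht] at h
    exact (ContinuousLinearMap.snd ℝ ℝ ℝ).hasFDerivAt.comp_hasDerivWithinAt t h
  · exact congrArg Prod.fst hα0
  · exact congrArg Prod.snd hα0

/-- The energy E of the forward estimate also satisfies E' ≥ -K E, so it cannot decay by more than a
fixed factor. This prevents a solution with a large initial slope from becoming small further to the
right. -/
theorem exists_energy_lower (H : D.CoeffBounds) : ∃ K : ℝ, 1 ≤ K ∧ ∀ lam : ℝ, -1 ≤ lam →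
    ∀ z v : ℝ → ℝ,
    (∀ x ∈ Icc D.l D.r, HasDerivWithinAt z (v x) (Icc D.l D.r) x) →
    (∀ x ∈ Icc D.l D.r, HasDerivWithinAt v (D.accel lam x (z x) (v x)) (Icc D.l D.r) x) →
    ∀ x ∈ Icc D.l D.r, (2 + lam) * z D.l ^ 2 + v D.l ^ 2
      ≤ K * ((2 + lam) * z x ^ 2 + v x ^ 2) := by
  have hB := H.one_le
  obtain ⟨K, hK⟩ : ∃ K, K = H.B ^ 2 + 4 * H.B + H.B ^ 2 * (H.B + 2) + H.B * (H.B + 2) :=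
    ⟨_, rfl⟩
  have hK0 : 0 ≤ K := by rw [hK]; positivity
  refine ⟨H.B * (Real.exp (K * H.B) * H.B), ?_, ?_⟩
  · have h1 : 1 ≤ Real.exp (K * H.B) := Real.one_le_exp (by positivity)
    have h2 : 1 ≤ Real.exp (K * H.B) * H.B := one_le_mul_of_one_le_of_one_le h1 hB
    exact one_le_mul_of_one_le_of_one_le hB h2
  intro lam hlam z v hz' hv' x hx
  have hw : 1 ≤ 2 + lam := by linarith
  have hz : ContinuousOn z (Icc D.l D.r) := fun t ht => (hz' t ht).continuousWithinAt
  have hv : ContinuousOn v (Icc D.l D.r) := fun t ht => (hv' t ht).continuousWithinAt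
  -- The forward Grönwall inequality is applied to F = -E exp(2K(t - l)): from -E' ≤ K E one gets F'
  -- ≤ (K E - 2K E) exp(2K(t - l)) = K F.
  have key := gronwall_le (l := D.l) (r := D.r) (K := K)
    (E := fun t => -((2 + lam) * (D.twoInvVar t * z t ^ 2) + v t ^ 2) * Real.exp (2 * K * (t - D.l)))
    (E1 := fun t => -((2 + lam) * (H.b1 t * z t ^ 2 + D.twoInvVar t * (2 * z t * v t))
      + 2 * v t * (D.accel lam t (z t) (v t))) * Real.exp (2 * K * (t - D.l))
      + -((2 + lam) * (D.twoInvVar t * z t ^ 2) + v t ^ 2) *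
        (Real.exp (2 * K * (t - D.l)) * (2 * K)))
    ?_ ?_ ?_ x hx
  · have hbl := H.b_ge D.l (left_mem_Icc.2 D.l_lt_r.le)
    have hbx := H.b_le x hx
    have hb0 := (H.b_pos hx).le
    have hr : (2 + lam) * (D.twoInvVar x * z x ^ 2) + v x ^ 2
        ≤ H.B * ((2 + lam) * z x ^ 2 + v x ^ 2) := by
      have h1 : (2 + lam) * z x ^ 2 * D.twoInvVar x ≤ (2 + lam) * z x ^ 2 * H.B := by
        gcongr; exact (le_abs_self _).trans hbx
      have h2 : v x ^ 2 ≤ H.B * v x ^ 2 := le_mul_of_one_le_left (sq_nonneg _) hB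
      linarith
    have hl : (2 + lam) * z D.l ^ 2 + v D.l ^ 2
        ≤ H.B * ((2 + lam) * (D.twoInvVar D.l * z D.l ^ 2) + v D.l ^ 2) := by
      have h1 : (2 + lam) * z D.l ^ 2 * 1 ≤ (2 + lam) * z D.l ^ 2 * (H.B * D.twoInvVar D.l) := by
        gcongr
      have h2 : v D.l ^ 2 ≤ H.B * v D.l ^ 2 := le_mul_of_one_le_left (sq_nonneg _) hB
      linarith
    refine hl.trans ?_
    rw [mul_assoc, mul_assoc]
    refine mul_le_mul_of_nonneg_left ?_ H.B_pos.le
    have h4 : K * (x - D.l) ≤ K * H.B := by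
      have := H.len_le
      gcongr
      linarith [hx.2]
    have h5 := Real.exp_le_exp.2 h4
    have e2 : Real.exp (2 * K * (x - D.l)) = Real.exp (K * (x - D.l)) * Real.exp (K * (x - D.l)) := by
      rw [← Real.exp_add]; ring_nf
    have hp := Real.exp_pos (K * (x - D.l))
    simp only [sub_self, mul_zero, Real.exp_zero, mul_one] at key
    rw [e2] at key
    have h6 : (2 + lam) * (D.twoInvVar D.l * z D.l ^ 2) + v D.l ^ 2
        ≤ Real.exp (K * (x - D.l)) * ((2 + lam) * (D.twoInvVar x * z x ^ 2) + v x ^ 2) := by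
      by_contra hcon
      push Not at hcon
      have := mul_lt_mul_of_pos_left hcon hp
      linarith
    exact h6.trans (mul_le_mul h5 hr (by positivity) (Real.exp_pos _).le)
  · exact ((continuousOn_const.mul (H.continuousOn_b.mul (hz.pow 2))).add (hv.pow 2)).neg.mul
      (Continuous.continuousOn (by fun_prop))
  · intro t ht
    have htI := Ioo_subset_Icc_self ht
    have hn := Icc_mem_nhds ht.1 ht.2
    have hb := (H.hb t htI).hasDerivAt hn
    have he : HasDerivAt (fun s => Real.exp (2 * K * (s - D.l)))
        (Real.exp (2 * K * (t - D.l)) * (2 * K)) t :=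
      (((hasDerivAt_id t).sub_const D.l).const_mul (2 * K)).exp.congr_deriv (by simp)
    exact ((((hb.mul (((hz' t htI).hasDerivAt hn).pow 2)).const_mul (2 + lam)).add
      (((hv' t htI).hasDerivAt hn).pow 2)).neg.mul he).congr_deriv (by simp)
  · intro t ht
    have htI := Ioo_subset_Icc_self ht
    have hb := H.b_ge t htI
    have hb0 := H.b_pos htI
    have hbB := (le_abs_self _).trans (H.b_le t htI)
    have hb1 := (neg_le_abs _).trans (H.b1_le t htI)
    have ha := abs_le.1 (H.a_le t htI)
    have hc0 := H.c_nonneg t htI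
    have hcB := (le_abs_self _).trans (H.c_le t htI)
    simp only [accel]
    obtain ⟨X, hX⟩ : ∃ X, X = (2 + lam) * (D.twoInvVar t * z t ^ 2) := ⟨_, rfl⟩
    have hX0 : 0 ≤ X := by rw [hX]; positivity
    have hz2 : (2 + lam) * z t ^ 2 ≤ H.B * X := by
      have : (2 + lam) * z t ^ 2 * 1 ≤ (2 + lam) * z t ^ 2 * (H.B * D.twoInvVar t) := by gcongr
      rw [hX]; linarith
    have hz1 : z t ^ 2 ≤ H.B * X := by
      refine le_trans ?_ hz2
      exact le_mul_of_one_le_left (sq_nonneg _) hw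
    have e1 : -((2 + lam) * (H.b1 t * z t ^ 2 + D.twoInvVar t * (2 * z t * v t))
      + 2 * v t * (-2 * D.driftRatio t * v t + D.twoInvVar t * (D.κ t - lam) * z t))
      = -H.b1 t * ((2 + lam) * z t ^ 2) + 4 * (D.driftRatio t) * v t ^ 2
        + D.twoInvVar t * (D.κ t + 2) * (-(2 * z t * v t)) := by ring
    rw [e1, ← hX]
    have t1 : -H.b1 t * ((2 + lam) * z t ^ 2) ≤ H.B * (H.B * X) := by
      refine mul_le_mul hb1 hz2 (by positivity) H.B_pos.le
    have t2 : 4 * (D.driftRatio t) * v t ^ 2 ≤ 4 * H.B * v t ^ 2 := by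
      gcongr; linarith
    have t3 : D.twoInvVar t * (D.κ t + 2) * (-(2 * z t * v t))
        ≤ H.B * (H.B + 2) * (H.B * X + v t ^ 2) := by
      have h1 : -(2 * z t * v t) ≤ H.B * X + v t ^ 2 := by nlinarith [sq_nonneg (z t + v t)]
      calc _ ≤ D.twoInvVar t * (D.κ t + 2) * (H.B * X + v t ^ 2) := by gcongr
        _ ≤ _ := by gcongr
    have q1 : 0 ≤ (4 * H.B + H.B * (H.B + 2)) * X := by positivity
    have q2 : 0 ≤ (H.B ^ 2 + H.B ^ 2 * (H.B + 2)) * v t ^ 2 := by positivity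
    have t5 : -H.b1 t * ((2 + lam) * z t ^ 2) + 4 * (D.driftRatio t) * v t ^ 2
        + D.twoInvVar t * (D.κ t + 2) * (-(2 * z t * v t)) ≤ K * (X + v t ^ 2) := by
      rw [hK]; linarith
    have t6 := mul_le_mul_of_nonneg_right t5 (Real.exp_pos (2 * K * (t - D.l))).le
    linarith

end CoeffBounds
end StickyDiffusion

/-! ### The frequency scale and the shooting solution: size and dependence on λ. -/

/-- The frequency scale `√(2 + lam)`. -/
def freq (lam : ℝ) : ℝ := Real.sqrt (2 + lam)

theorem freq_sq {lam : ℝ} (h : -1 ≤ lam) : freq lam ^ 2 = 2 + lam := Real.sq_sqrt (by linarith)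

theorem one_le_freq {lam : ℝ} (h : -1 ≤ lam) : 1 ≤ freq lam := Real.one_le_sqrt.2 (by linarith)

theorem freq_mono {lam nu : ℝ} (h : lam ≤ nu) : freq lam ≤ freq nu :=
  Real.sqrt_le_sqrt (by linarith)

theorem freq_le_two_mul {lam nu : ℝ} (h : -1 ≤ lam) (h' : nu ≤ lam + freq lam) :
    freq nu ≤ 2 * freq lam := by
  have h1 := one_le_freq h
  have h2 := freq_sq h
  refine Real.sqrt_le_iff.2 ⟨by positivity, ?_⟩
  nlinarith

namespace StickyDiffusion

variable {D : StickyDiffusion}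

/-- `(y, u)` is the solution of the eigenvalue equation and its derivative, with the boundary
condition at `l` and `y(l) = 1`. -/
structure IsShooting (D : StickyDiffusion) (lam : ℝ) (y u : ℝ → ℝ) : Prop where
  deriv : ∀ x ∈ Icc D.l D.r, HasDerivWithinAt y (u x) (Icc D.l D.r) x
  deriv_deriv : ∀ x ∈ Icc D.l D.r,
    HasDerivWithinAt u (D.accel lam x (y x) (u x)) (Icc D.l D.r) x
  left : y D.l = 1
  left_deriv : u D.l = (D.κ D.l - lam) / D.ρ

theorem left_mem : D.l ∈ Icc D.l D.r := left_mem_Icc.2 D.l_lt_r.le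

theorem right_mem : D.r ∈ Icc D.l D.r := right_mem_Icc.2 D.l_lt_r.le

theorem IsShooting.continuousOn {lam : ℝ} {y u : ℝ → ℝ} (h : D.IsShooting lam y u) :
    ContinuousOn y (Icc D.l D.r) := fun x hx => (h.deriv x hx).continuousWithinAt

theorem IsShooting.continuousOn_deriv {lam : ℝ} {y u : ℝ → ℝ} (h : D.IsShooting lam y u) :
    ContinuousOn u (Icc D.l D.r) := fun x hx => (h.deriv_deriv x hx).continuousWithinAt

theorem IsShooting.hasDerivAt {lam : ℝ} {y u : ℝ → ℝ} (h : D.IsShooting lam y u) {x : ℝ}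
    (hx : x ∈ Ioo D.l D.r) : HasDerivAt y (u x) x :=
  (h.deriv x (Ioo_subset_Icc_self hx)).hasDerivAt (Icc_mem_nhds hx.1 hx.2)

theorem IsShooting.hasDerivAt_deriv {lam : ℝ} {y u : ℝ → ℝ} (h : D.IsShooting lam y u) {x : ℝ}
    (hx : x ∈ Ioo D.l D.r) : HasDerivAt u (D.accel lam x (y x) (u x)) x :=
  (h.deriv_deriv x (Ioo_subset_Icc_self hx)).hasDerivAt (Icc_mem_nhds hx.1 hx.2)

namespace CoeffBounds

theorem exists_isShooting (H : D.CoeffBounds) (lam : ℝ) : ∃ y u, D.IsShooting lam y u := by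
  obtain ⟨y, u, h1, h2, h3, h4⟩ := H.exists_solution lam 1 ((D.κ D.l - lam) / D.ρ)
  exact ⟨y, u, h1, h2, h3, h4⟩

/-- The sticky condition contains the spectral parameter, so the initial slope (κ(l) - λ)/ρ is O(w²)
and the energy w²y² + u² is O(w⁴). This is why the solution with value 1 at l may grow to size w,
and it fixes the powers of w in all later bounds. -/
theorem exists_shooting_bound (H : D.CoeffBounds) : ∃ C : ℝ, 1 ≤ C ∧ ∀ lam : ℝ, -1 ≤ lam →
    ∀ y u, D.IsShooting lam y u → ∀ x ∈ Icc D.l D.r,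
      |y x| ≤ C * freq lam ∧ |u x| ≤ C * freq lam ^ 2 := by
  obtain ⟨K, hK1, hK⟩ := H.exists_energy_bound
  have hB := H.one_le
  obtain ⟨A, hA⟩ : ∃ A, A = 1 + ((H.B + 2) * H.B) ^ 2 := ⟨_, rfl⟩
  have hA1 : 1 ≤ A := by rw [hA]; linarith [sq_nonneg ((H.B + 2) * H.B)]
  refine ⟨K * A, one_le_mul_of_one_le_of_one_le hK1 hA1, fun lam hlam y u h x hx => ?_⟩
  have hw := one_le_freq hlam
  have hw2 := freq_sq hlam
  have key := hK lam hlam y u (fun _ => 0) 0 h.continuousOn h.continuousOn_deriv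
    (fun x hx => h.hasDerivAt hx) (fun x hx => by simpa using h.hasDerivAt_deriv hx)
    (by simp) x hx
  rw [h.left, h.left_deriv, ← hw2] at key
  have hinit : |(D.κ D.l - lam) / D.ρ| ≤ (H.B + 2) * H.B * freq lam ^ 2 := by
    rw [abs_div, abs_of_pos D.ρ_pos, div_eq_mul_one_div]
    have h1 := H.rho_ge
    have h2 := abs_le.1 (H.c_le D.l left_mem)
    have h3 := H.c_nonneg D.l left_mem
    have h4 : |D.κ D.l - lam| ≤ (H.B + 2) * freq lam ^ 2 := by
      rw [hw2, abs_le]; constructor <;> nlinarith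
    have h5 : 0 ≤ 1 / D.ρ := by have := D.ρ_pos; positivity
    calc _ ≤ (H.B + 2) * freq lam ^ 2 * H.B := by gcongr
      _ = _ := by ring
  have hinit2 : ((D.κ D.l - lam) / D.ρ) ^ 2 ≤ ((H.B + 2) * H.B * freq lam ^ 2) ^ 2 := by
    rw [← sq_abs]; gcongr
  have hpow : freq lam ^ 2 ≤ freq lam ^ 4 := pow_le_pow_right₀ hw (by norm_num)
  have hE : freq lam ^ 2 * y x ^ 2 + u x ^ 2 ≤ K * A * freq lam ^ 4 := by
    refine key.trans ?_
    rw [mul_assoc]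
    gcongr
    rw [hA]
    nlinarith
  have hKA : 1 ≤ K * A := one_le_mul_of_one_le_of_one_le hK1 hA1
  have hKA2 : K * A ≤ (K * A) ^ 2 := by nlinarith
  constructor
  · refine abs_le_of_sq_le_sq ?_ (by positivity)
    have h1 : freq lam ^ 2 * y x ^ 2 ≤ freq lam ^ 2 * (K * A * freq lam) ^ 2 := by
      have : K * A * freq lam ^ 4 ≤ (K * A) ^ 2 * freq lam ^ 4 := by gcongr
      nlinarith [sq_nonneg (u x)]
    exact le_of_mul_le_mul_left h1 (by positivity)
  · refine abs_le_of_sq_le_sq ?_ (by positivity)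
    have : K * A * freq lam ^ 4 ≤ (K * A) ^ 2 * freq lam ^ 4 := by gcongr
    nlinarith [mul_nonneg (sq_nonneg (freq lam)) (sq_nonneg (y x))]

/-- Lipschitz dependence of the solution on the spectral parameter. -/
theorem exists_shooting_lipschitz (H : D.CoeffBounds) : ∃ C : ℝ, 1 ≤ C ∧ ∀ lam nu : ℝ, -1 ≤ lam →
    -1 ≤ nu → nu ≤ lam + freq lam → ∀ y u y' u', D.IsShooting lam y u → D.IsShooting nu y' u' →
    ∀ x ∈ Icc D.l D.r, |y' x - y x| ≤ C * |nu - lam| ∧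
      |u' x - u x| ≤ C * |nu - lam| * freq lam := by
  obtain ⟨K, hK1, hK⟩ := H.exists_energy_bound
  obtain ⟨C, hC1, hC⟩ := H.exists_shooting_bound
  have hB := H.one_le
  obtain ⟨A, hA⟩ : ∃ A, A = H.B ^ 2 + (2 * H.B * C) ^ 2 := ⟨_, rfl⟩
  have hA1 : 1 ≤ A := by rw [hA]; nlinarith [sq_nonneg (2 * H.B * C)]
  refine ⟨K * A, one_le_mul_of_one_le_of_one_le hK1 hA1,
    fun lam nu hlam hnu hnl y u y' u' h h' x hx => ?_⟩
  have hw := one_le_freq hlam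
  have hw2 := freq_sq hlam
  have hwn := freq_le_two_mul hlam hnl
  -- The difference of the two solutions solves the equation at λ with forcing b(λ - ν)y', which is
  -- O(w |ν - λ|); the initial slopes differ by (ν - λ)/ρ in absolute value.
  have key := hK lam hlam (fun x => y' x - y x) (fun x => u' x - u x)
    (fun x => D.twoInvVar x * (lam - nu) * y' x) (2 * H.B * C * freq lam * |nu - lam|)
    (h'.continuousOn.sub h.continuousOn)
    (h'.continuousOn_deriv.sub h.continuousOn_deriv)
    (fun x hx => (h'.hasDerivAt hx).sub (h.hasDerivAt hx))
    (fun x hx => ((h'.hasDerivAt_deriv hx).sub (h.hasDerivAt_deriv hx)).congr_deriv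
      (by simp only [accel]; ring)) (fun t ht => ?_) x hx
  · have e : (u' D.l - u D.l) ^ 2 ≤ H.B ^ 2 * |nu - lam| ^ 2 := by
      rw [h.left_deriv, h'.left_deriv, ← mul_pow, ← sq_abs]
      have e1 : (D.κ D.l - nu) / D.ρ - (D.κ D.l - lam) / D.ρ = (1 / D.ρ) * -(nu - lam) := by ring
      have h5 : 0 < 1 / D.ρ := by have := D.ρ_pos; positivity
      rw [e1, abs_mul, abs_neg, abs_of_pos h5]
      have := H.rho_ge
      gcongr
    simp only [h.left, h'.left, sub_self] at key
    have hE : freq lam ^ 2 * (y' x - y x) ^ 2 + (u' x - u x) ^ 2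
        ≤ K * A * (|nu - lam| ^ 2 * freq lam ^ 2) := by
      rw [hw2]
      refine key.trans ?_
      rw [mul_assoc K A]
      refine mul_le_mul_of_nonneg_left ?_ (by linarith)
      rw [hA, ← hw2]
      have h6 : H.B ^ 2 * |nu - lam| ^ 2 * 1 ≤ H.B ^ 2 * |nu - lam| ^ 2 * freq lam ^ 2 := by
        gcongr; nlinarith
      nlinarith
    have hKA : 1 ≤ K * A := one_le_mul_of_one_le_of_one_le hK1 hA1
    have hKA2 : K * A ≤ (K * A) ^ 2 := by nlinarith
    have h7 : K * A * (|nu - lam| ^ 2 * freq lam ^ 2)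
        ≤ (K * A) ^ 2 * (|nu - lam| ^ 2 * freq lam ^ 2) := by gcongr
    constructor
    · refine abs_le_of_sq_le_sq ?_ (by positivity)
      have h1 : freq lam ^ 2 * (y' x - y x) ^ 2 ≤ freq lam ^ 2 * (K * A * |nu - lam|) ^ 2 := by
        nlinarith [sq_nonneg (u' x - u x)]
      exact le_of_mul_le_mul_left h1 (by positivity)
    · refine abs_le_of_sq_le_sq ?_ (by positivity)
      nlinarith [mul_nonneg (sq_nonneg (freq lam)) (sq_nonneg (y' x - y x))]
  · have htI := Ioo_subset_Icc_self ht
    have h1 := H.b_le t htI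
    have h2 := (hC nu hnu y' u' h' t htI).1
    rw [abs_mul, abs_mul, abs_sub_comm lam nu]
    have := H.B_pos
    calc _ ≤ H.B * |nu - lam| * (C * (2 * freq lam)) := by
          gcongr
          exact h2.trans (by gcongr)
      _ = _ := by ring

/-- Solutions with the boundary condition at `l` are multiples of the shooting solution. -/
theorem eq_mul_of_solution (H : D.CoeffBounds) {lam : ℝ} (hlam : -1 ≤ lam) {y u z v : ℝ → ℝ}
    (h : D.IsShooting lam y u)
    (hz : ContinuousOn z (Icc D.l D.r)) (hv : ContinuousOn v (Icc D.l D.r))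
    (hz' : ∀ x ∈ Ioo D.l D.r, HasDerivAt z (v x) x)
    (hv' : ∀ x ∈ Ioo D.l D.r, HasDerivAt v (D.accel lam x (z x) (v x)) x)
    (hl : v D.l = (D.κ D.l - lam) / D.ρ * z D.l) :
    ∀ x ∈ Icc D.l D.r, z x = z D.l * y x := by
  obtain ⟨K, -, hK⟩ := H.exists_energy_bound
  intro x hx
  have key := hK lam hlam (fun x => z x - z D.l * y x) (fun x => v x - z D.l * u x) (fun _ => 0) 0
    (hz.sub (continuousOn_const.mul h.continuousOn))
    (hv.sub (continuousOn_const.mul h.continuousOn_deriv))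
    (fun x hx => (hz' x hx).sub ((h.hasDerivAt hx).const_mul _))
    (fun x hx => ((hv' x hx).sub ((h.hasDerivAt_deriv hx).const_mul (z D.l))).congr_deriv
      (by simp only [accel]; ring)) (by simp) x hx
  have e : v D.l - z D.l * ((D.κ D.l - lam) / D.ρ) = 0 := by rw [hl]; ring
  simp only [h.left, h.left_deriv, e, mul_one, sub_self] at key
  have h0 : (z x - z D.l * y x) ^ 2 ≤ 0 := by
    nlinarith [sq_nonneg (v x - z D.l * u x), sq_nonneg (z x - z D.l * y x)]
  have : z x - z D.l * y x = 0 := by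
    nlinarith [sq_nonneg (z x - z D.l * y x), pow_eq_zero_iff (two_ne_zero) |>.1
      (le_antisymm h0 (sq_nonneg _))]
  linarith

end CoeffBounds
end StickyDiffusion

/-! ### The Wronskian identity and lower bounds for inner products. -/

namespace StickyDiffusion

variable {D : StickyDiffusion}

namespace CoeffBounds

theorem continuousOn_speedDensity (H : D.CoeffBounds) :
    ContinuousOn D.speedDensity (Icc D.l D.r) := by
  have : D.speedDensity = fun x => D.twoInvVar x * D.weight x := funext fun x => speedDensity_eq x
  rw [this]
  exact H.continuousOn_b.mul fun x hx => (H.hasDerivWithinAt_weight hx).continuousWithinAt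

theorem exists_speedDensity_bound (H : D.CoeffBounds) : ∃ C : ℝ, 1 ≤ C ∧ ∀ x ∈ Icc D.l D.r,
    0 < D.speedDensity x ∧ D.speedDensity x ≤ C ∧ 1 ≤ C * D.speedDensity x := by
  obtain ⟨C, hC1, hC⟩ := H.exists_weight_bound
  have hB := H.one_le
  refine ⟨H.B * C, one_le_mul_of_one_le_of_one_le hB hC1, fun x hx => ?_⟩
  have hw := weight_pos (D := D) x
  have hb := H.b_pos hx
  rw [speedDensity_eq]
  refine ⟨by positivity, ?_, ?_⟩
  · have := (le_abs_self _).trans (H.b_le x hx)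
    have := (hC x hx).1
    gcongr
  · calc 1 ≤ (H.B * D.twoInvVar x) * (C * D.weight x) :=
        one_le_mul_of_one_le_of_one_le (H.b_ge x hx) (hC x hx).2
      _ = _ := by ring

theorem intervalIntegrable_of_continuousOn {f : ℝ → ℝ} (hf : ContinuousOn f (Icc D.l D.r)) :
    IntervalIntegrable f MeasureTheory.volume D.l D.r :=
  hf.intervalIntegrable_of_Icc D.l_lt_r.le

/-- The Wronskian identity. -/
theorem wronskian (H : D.CoeffBounds) {lam nu : ℝ} {y u y' u' : ℝ → ℝ}
    (h : D.IsShooting lam y u) (h' : D.IsShooting nu y' u') :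
    D.weight D.r * u D.r * y' D.r - y D.r * (D.weight D.r * u' D.r)
      = (nu - lam) * D.innerProd y y' := by
  have hp : ContinuousOn D.weight (Icc D.l D.r) :=
    fun x hx => (H.hasDerivWithinAt_weight hx).continuousWithinAt
  have key := intervalIntegral.integral_eq_sub_of_hasDerivAt_of_le D.l_lt_r.le
    (f := fun x => D.weight x * (u x * y' x - y x * u' x))
    (f' := fun x => (nu - lam) * (y x * y' x * D.speedDensity x))
    (hp.mul ((h.continuousOn_deriv.mul h'.continuousOn).sub
      (h.continuousOn.mul h'.continuousOn_deriv)))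
    (fun x hx => ?_) (intervalIntegrable_of_continuousOn (continuousOn_const.mul
      ((h.continuousOn.mul h'.continuousOn).mul H.continuousOn_speedDensity)))
  -- The boundary term at l is (ν - λ)/ρ by the sticky condition, which is precisely the
  -- contribution of the atom of the speed measure.
  · rw [intervalIntegral.integral_const_mul, weight_left, h.left, h'.left, h.left_deriv,
      h'.left_deriv] at key
    rw [innerProd, h.left, h'.left, mul_add, key]
    ring
  · have hw := (H.hasDerivWithinAt_weight (Ioo_subset_Icc_self hx)).hasDerivAt
      (Icc_mem_nhds hx.1 hx.2)
    exact (hw.mul (((h.hasDerivAt_deriv hx).mul (h'.hasDerivAt hx)).sub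
      ((h.hasDerivAt hx).mul (h'.hasDerivAt_deriv hx)))).congr_deriv (by
        simp only [accel, speedDensity_eq, Pi.sub_apply, Pi.mul_apply]; ring)

theorem innerProd_self_ge (H : D.CoeffBounds) {lam : ℝ} {y u : ℝ → ℝ} (h : D.IsShooting lam y u) :
    1 / H.B ≤ D.innerProd y y := by
  obtain ⟨C, -, hC⟩ := H.exists_speedDensity_bound
  have h1 : 0 ≤ ∫ x in D.l..D.r, y x * y x * D.speedDensity x :=
    intervalIntegral.integral_nonneg D.l_lt_r.le fun x hx =>
      mul_nonneg (mul_self_nonneg _) (hC x hx).1.le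
  have h2 : 1 / H.B ≤ 1 / D.ρ := one_div_le_one_div_of_le D.ρ_pos H.rho_le
  rw [innerProd, h.left]
  linarith

/-- At high frequency the initial slope has order w², so by the backward energy estimate w²y² + u² ≥
c w⁴ on the whole interval. Integrating (yu)' = u² + y y'' bounds ∫u² by a constant times w²∫y² plus
O(w³), which gives ∫y²m ≥ c w². At bounded frequency the atom at l suffices. -/
theorem exists_innerProd_lower (H : D.CoeffBounds) : ∃ c : ℝ, 0 < c ∧ ∀ lam : ℝ, -1 ≤ lam →
    ∀ y u, D.IsShooting lam y u → c * freq lam ^ 2 ≤ D.innerProd y y := by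
  obtain ⟨Cm, hCm1, hCm⟩ := H.exists_speedDensity_bound
  obtain ⟨C, hC1, hC⟩ := H.exists_shooting_bound
  obtain ⟨K, hK1, hK⟩ := H.exists_energy_lower
  have hB := H.one_le
  have hB0 := H.B_pos
  have hL : 0 < D.r - D.l := sub_pos.2 D.l_lt_r
  obtain ⟨A, hA⟩ : ∃ A, A = (1 + H.B) * Cm := ⟨_, rfl⟩
  have hA0 : 0 < A := by rw [hA]; positivity
  obtain ⟨e, he⟩ : ∃ e, e = (D.r - D.l) / (4 * H.B ^ 2 * K) := ⟨_, rfl⟩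
  have he0 : 0 < e := by rw [he]; positivity
  obtain ⟨G, hG⟩ : ∃ G, G = 2 * C ^ 2 + (D.r - D.l) * (2 * H.B * C ^ 2) := ⟨_, rfl⟩
  have hG0 : 0 < G := by rw [hG]; positivity
  -- for large frequencies the energy is shared equally between the solution and its derivative
  have hlarge : ∀ lam : ℝ, -1 ≤ lam → 2 * (H.B + 2) ≤ freq lam ^ 2 → 2 * G / e ≤ freq lam →
      ∀ y u, D.IsShooting lam y u → e / (2 * A) * freq lam ^ 2 ≤ D.innerProd y y := by
    intro lam hlam hw1 hw2 y u h
    have hw := one_le_freq hlam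
    have hwsq := freq_sq hlam
    obtain ⟨w, hwdef⟩ : ∃ w, w = freq lam := ⟨_, rfl⟩
    rw [← hwdef] at hw1 hw2 hw hwsq ⊢
    have hy := hC lam hlam y u h
    rw [← hwdef] at hy
    have hyu : ∀ x ∈ Icc D.l D.r, |y x * u x| ≤ C ^ 2 * w ^ 3 := by
      intro x hx
      rw [abs_mul]
      calc _ ≤ (C * w) * (C * w ^ 2) := by gcongr; exacts [(hy x hx).1, (hy x hx).2]
        _ = _ := by ring
    -- As λ = w² - 2 and κ ≤ B, the assumption w² ≥ 2(B + 2) gives λ - κ(l) ≥ w²/2, so the initial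
    -- slope alone supplies this energy.
    have hEl : w ^ 4 / (4 * H.B ^ 2) ≤ (2 + lam) * y D.l ^ 2 + u D.l ^ 2 := by
      have hk := (le_abs_self _).trans (H.c_le D.l left_mem)
      have h1 : w ^ 2 / (2 * H.B) ≤ (lam - D.κ D.l) / D.ρ := by
        have := D.ρ_pos
        have h2 := H.rho_le
        rw [div_le_div_iff₀ (by positivity) this]
        have : w ^ 2 / 2 ≤ lam - D.κ D.l := by linarith
        calc w ^ 2 * D.ρ ≤ w ^ 2 * H.B := by gcongr
          _ = w ^ 2 / 2 * (2 * H.B) := by ring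
          _ ≤ _ := by gcongr
      have h3 : (w ^ 2 / (2 * H.B)) ^ 2 ≤ ((lam - D.κ D.l) / D.ρ) ^ 2 := by gcongr
      rw [h.left_deriv]
      have e1 : ((D.κ D.l - lam) / D.ρ) ^ 2 = ((lam - D.κ D.l) / D.ρ) ^ 2 := by ring
      have e2 : (w ^ 2 / (2 * H.B)) ^ 2 = w ^ 4 / (4 * H.B ^ 2) := by ring
      rw [e1, ← e2]
      have : 0 ≤ (2 + lam) * y D.l ^ 2 := by rw [← hwsq]; positivity
      linarith
    have hcont : ContinuousOn (fun x => u x * u x + y x * D.accel lam x (y x) (u x))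
        (Icc D.l D.r) := by
      have h1 := h.continuousOn
      have h2 := h.continuousOn_deriv
      have h3 := H.continuousOn_a
      have h4 := H.continuousOn_b
      have h5 := H.continuousOn_c
      simp only [accel]
      fun_prop
    have hcm : ContinuousOn (fun x => y x * y x * D.speedDensity x) (Icc D.l D.r) :=
      (h.continuousOn.mul h.continuousOn).mul H.continuousOn_speedDensity
    have hint := intervalIntegral.integral_eq_sub_of_hasDerivAt_of_le D.l_lt_r.le
      (f := fun x => y x * u x)
      (f' := fun x => u x * u x + y x * D.accel lam x (y x) (u x))
      (h.continuousOn.mul h.continuousOn_deriv)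
      (fun x hx => (h.hasDerivAt hx).mul (h.hasDerivAt_deriv hx))
      (intervalIntegrable_of_continuousOn hcont)
    -- Pointwise form of the equipartition: adding A w² y² m to (yu)' = u² + y y'' compensates the
    -- negative part -bλy² and completes the energy, up to the drift term of order w³.
    have hmono := intervalIntegral.integral_mono_on D.l_lt_r.le
      (f := fun _ => w ^ 4 / (4 * H.B ^ 2) / K - 2 * H.B * C ^ 2 * w ^ 3)
      (g := fun x => (u x * u x + y x * D.accel lam x (y x) (u x))
        + A * w ^ 2 * (y x * y x * D.speedDensity x))
      intervalIntegrable_const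
      ((intervalIntegrable_of_continuousOn hcont).add
        ((intervalIntegrable_of_continuousOn hcm).const_mul _)) (fun x hx => ?_)
    · rw [intervalIntegral.integral_add (intervalIntegrable_of_continuousOn hcont)
        ((intervalIntegrable_of_continuousOn hcm).const_mul _), hint,
        intervalIntegral.integral_const_mul, intervalIntegral.integral_const, smul_eq_mul] at hmono
      have h1 := abs_le.1 (hyu D.r right_mem)
      have h2 := abs_le.1 (hyu D.l left_mem)
      have h3 : ∫ x in D.l..D.r, y x * y x * D.speedDensity x ≤ D.innerProd y y := by
        rw [innerProd, h.left]
        have : 0 < 1 / D.ρ := by have := D.ρ_pos; positivity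
        linarith
      have h4 : A * w ^ 2 * (∫ x in D.l..D.r, y x * y x * D.speedDensity x)
          ≤ A * w ^ 2 * D.innerProd y y := by gcongr
      have e3 : (D.r - D.l) * (w ^ 4 / (4 * H.B ^ 2) / K) = e * w ^ 4 := by
        rw [he]; field_simp
      have h5 : e * w ^ 4 - G * w ^ 3 ≤ A * w ^ 2 * D.innerProd y y := by
        rw [hG]; linarith
      have h6 : G * w ^ 3 ≤ e / 2 * w ^ 4 := by
        rw [div_le_iff₀ he0] at hw2
        have := mul_le_mul_of_nonneg_right hw2 (by positivity : 0 ≤ w ^ 3)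
        linarith
      have h7 : w ^ 2 * (e / (2 * A) * w ^ 2) ≤ w ^ 2 * D.innerProd y y := by
        have : A * (w ^ 2 * (e / (2 * A) * w ^ 2)) ≤ A * (w ^ 2 * D.innerProd y y) := by
          calc A * (w ^ 2 * (e / (2 * A) * w ^ 2)) = e / 2 * w ^ 4 := by field_simp
            _ ≤ _ := by linarith
        exact le_of_mul_le_mul_left this hA0
      exact le_of_mul_le_mul_left h7 (by positivity)
    · have hE := hK lam hlam y u h.deriv h.deriv_deriv x hx
      have hE2 : w ^ 4 / (4 * H.B ^ 2) / K ≤ (2 + lam) * y x ^ 2 + u x ^ 2 := by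
        rw [div_le_iff₀ (by linarith)]
        linarith
      have hm := hCm x hx
      have h1 : y x ^ 2 ≤ Cm * (y x * y x * D.speedDensity x) := by
        have : y x ^ 2 * 1 ≤ y x ^ 2 * (Cm * D.speedDensity x) := by gcongr; exact hm.2.2
        linarith
      have h2 : (1 + H.B) * w ^ 2 * y x ^ 2 ≤ A * w ^ 2 * (y x * y x * D.speedDensity x) := by
        rw [hA]
        calc _ ≤ (1 + H.B) * w ^ 2 * (Cm * (y x * y x * D.speedDensity x)) := by gcongr
          _ = _ := by ring
      have h3 : -(2 * D.driftRatio x * (y x * u x)) ≥ -(2 * H.B * (C ^ 2 * w ^ 3)) := by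
        have : |2 * D.driftRatio x * (y x * u x)| ≤ 2 * H.B * (C ^ 2 * w ^ 3) := by
          rw [abs_mul, abs_mul, abs_two]
          have := H.a_le x hx
          have := hyu x hx
          gcongr
        linarith [le_abs_self (2 * D.driftRatio x * (y x * u x))]
      have h4 : D.twoInvVar x * (lam - D.κ x) * y x ^ 2 ≤ H.B * w ^ 2 * y x ^ 2 := by
        have hb := (le_abs_self _).trans (H.b_le x hx)
        have hb0 := H.b_pos hx
        have hk := H.c_nonneg x hx
        have hlk : lam - D.κ x ≤ w ^ 2 := by linarith
        calc D.twoInvVar x * (lam - D.κ x) * y x ^ 2 ≤ D.twoInvVar x * w ^ 2 * y x ^ 2 := by gcongr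
          _ ≤ _ := by gcongr
      simp only [accel]
      rw [← hwsq] at hE2
      linarith
  -- W is the threshold between the two regimes; it dominates both conditions of the high-frequency
  -- case.
  obtain ⟨W, hW⟩ : ∃ W, W = max (2 * (H.B + 2)) (2 * G / e) := ⟨_, rfl⟩
  have hW1 : 2 * (H.B + 2) ≤ W := by rw [hW]; exact le_max_left _ _
  have hW2 : 2 * G / e ≤ W := by rw [hW]; exact le_max_right _ _
  have hW0 : 0 < W := by linarith
  refine ⟨min (e / (2 * A)) (1 / (H.B * W ^ 2)), lt_min (by positivity) (by positivity),
    fun lam hlam y u h => ?_⟩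
  have hw := one_le_freq hlam
  rcases le_total W (freq lam) with hle | hle
  · have h1 : W ≤ freq lam ^ 2 := by nlinarith
    refine le_trans ?_ (hlarge lam hlam (by linarith) (by linarith) y u h)
    gcongr
    exact min_le_left _ _
  · refine le_trans ?_ (H.innerProd_self_ge h)
    calc _ ≤ 1 / (H.B * W ^ 2) * W ^ 2 := by
          gcongr
          exact min_le_right _ _
      _ = 1 / H.B := by field_simp

theorem exists_innerProd_lipschitz (H : D.CoeffBounds) : ∃ A : ℝ, 1 ≤ A ∧
    ∀ lam nu : ℝ, -1 ≤ lam → -1 ≤ nu → nu ≤ lam + freq lam →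
    ∀ y u y' u', D.IsShooting lam y u → D.IsShooting nu y' u' →
    |D.innerProd y y' - D.innerProd y y| ≤ A * freq lam * |nu - lam| := by
  obtain ⟨Cm, hCm1, hCm⟩ := H.exists_speedDensity_bound
  obtain ⟨C, hC1, hC⟩ := H.exists_shooting_bound
  obtain ⟨C', hC'1, hC'⟩ := H.exists_shooting_lipschitz
  have hB := H.one_le
  refine ⟨C * C' * Cm * H.B, ?_, fun lam nu hlam hnu hn y u y' u' h h' => ?_⟩
  · exact one_le_mul_of_one_le_of_one_le (one_le_mul_of_one_le_of_one_le
      (one_le_mul_of_one_le_of_one_le hC1 hC'1) hCm1) hB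
  have hw := one_le_freq hlam
  have hd : D.innerProd y y' - D.innerProd y y
      = ∫ x in D.l..D.r, y x * (y' x - y x) * D.speedDensity x := by
    have i1 : IntervalIntegrable (fun x => y x * y' x * D.speedDensity x) MeasureTheory.volume
        D.l D.r := intervalIntegrable_of_continuousOn
          ((h.continuousOn.mul h'.continuousOn).mul H.continuousOn_speedDensity)
    have i2 : IntervalIntegrable (fun x => y x * y x * D.speedDensity x) MeasureTheory.volume
        D.l D.r := intervalIntegrable_of_continuousOn
          ((h.continuousOn.mul h.continuousOn).mul H.continuousOn_speedDensity)
    rw [innerProd, innerProd, h.left, h'.left, add_sub_add_left_eq_sub,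
      ← intervalIntegral.integral_sub i1 i2]
    congr 1
    funext x
    ring
  have h1 := intervalIntegral.norm_integral_le_of_norm_le_const (a := D.l) (b := D.r)
    (f := fun x => y x * (y' x - y x) * D.speedDensity x)
    (C := C * freq lam * (C' * |nu - lam|) * Cm) (fun x hx => by
      rw [uIoc_of_le D.l_lt_r.le] at hx
      have hx' := Ioc_subset_Icc_self hx
      have h2 := (hC lam hlam y u h x hx').1
      have h4 := (hC' lam nu hlam hnu hn y u y' u' h h' x hx').1
      have h3 := hCm x hx'
      rw [Real.norm_eq_abs, abs_mul, abs_mul, abs_of_pos h3.1]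
      gcongr
      exacts [h3.1.le, h3.2.1])
  rw [Real.norm_eq_abs, abs_of_pos (sub_pos.2 D.l_lt_r), ← hd] at h1
  refine h1.trans ?_
  have := H.len_le
  calc C * freq lam * (C' * |nu - lam|) * Cm * (D.r - D.l)
      ≤ C * freq lam * (C' * |nu - lam|) * Cm * H.B := by gcongr
    _ = _ := by ring

/-- Nearby solutions have a large inner product. -/
theorem exists_innerProd_near (H : D.CoeffBounds) : ∃ c c' : ℝ, 0 < c ∧ 0 < c' ∧ c' ≤ 1 ∧
    ∀ lam nu : ℝ, -1 ≤ lam → -1 ≤ nu → |nu - lam| ≤ c' * freq lam →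
    ∀ y u y' u', D.IsShooting lam y u → D.IsShooting nu y' u' →
    c * freq lam ^ 2 ≤ D.innerProd y y' := by
  obtain ⟨c, hc0, hc⟩ := H.exists_innerProd_lower
  obtain ⟨A, hA1, hA⟩ := H.exists_innerProd_lipschitz
  refine ⟨c / 2, min 1 (c / (2 * A)), by positivity, lt_min one_pos (by positivity),
    min_le_left _ _, fun lam nu hlam hnu hn y u y' u' h h' => ?_⟩
  have hw := one_le_freq hlam
  have hn1 : |nu - lam| ≤ freq lam := hn.trans (by
    calc _ ≤ 1 * freq lam := by gcongr; exact min_le_left _ _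
      _ = _ := one_mul _)
  have hn2 : |nu - lam| ≤ c / (2 * A) * freq lam := hn.trans (by gcongr; exact min_le_right _ _)
  have h1 := hA lam nu hlam hnu (by linarith [le_abs_self (nu - lam)]) y u y' u' h h'
  have h5 : A * freq lam * |nu - lam| ≤ c / 2 * freq lam ^ 2 := by
    calc _ ≤ A * freq lam * (c / (2 * A) * freq lam) := by gcongr
      _ = _ := by field_simp
  have h6 := hc lam hlam y u h
  have h7 := (abs_le.1 h1).1
  linarith

end CoeffBounds
end StickyDiffusion

/-! ### Eigenvalues as zeros of the shooting function: positivity, gaps, growth. -/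

namespace StickyDiffusion

variable {D : StickyDiffusion}

theorem iteratedDerivWithin_two_eq (f : ℝ → ℝ) (s : Set ℝ) (x : ℝ) :
    iteratedDerivWithin 2 f s x = derivWithin (derivWithin f s) s x := by
  rw [show (2 : ℕ) = 1 + 1 from rfl, iteratedDerivWithin_succ,
    show iteratedDerivWithin 1 f s = derivWithin f s from iteratedDerivWithin_one]

theorem IsEigenfunction.hasDerivWithinAt {lam : ℝ} {f : ℝ → ℝ} (h : D.IsEigenfunction lam f) {x : ℝ}
    (hx : x ∈ Icc D.l D.r) :
    HasDerivWithinAt f (derivWithin f (Icc D.l D.r) x) (Icc D.l D.r) x :=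
  ((h.smooth.differentiableOn (by norm_num)) x hx).hasDerivWithinAt

theorem IsEigenfunction.continuousOn_deriv {lam : ℝ} {f : ℝ → ℝ} (h : D.IsEigenfunction lam f) :
    ContinuousOn (derivWithin f (Icc D.l D.r)) (Icc D.l D.r) :=
  h.smooth.continuousOn_derivWithin (uniqueDiffOn_Icc D.l_lt_r) (by norm_num)

theorem IsEigenfunction.hasDerivAt_deriv (H : D.CoeffBounds) {lam : ℝ} {f : ℝ → ℝ}
    (h : D.IsEigenfunction lam f) {x : ℝ} (hx : x ∈ Ioo D.l D.r) :
    HasDerivAt (derivWithin f (Icc D.l D.r))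
      (D.accel lam x (f x) (derivWithin f (Icc D.l D.r) x)) x := by
  have hu := uniqueDiffOn_Icc D.l_lt_r
  have hxI := Ioo_subset_Icc_self hx
  have h1 : ContDiffOn ℝ 1 (derivWithin f (Icc D.l D.r)) (Icc D.l D.r) :=
    h.smooth.derivWithin hu (by norm_num)
  have h2 := ((h1.differentiableOn (by norm_num)) x hxI).hasDerivWithinAt.hasDerivAt
    (Icc_mem_nhds hx.1 hx.2)
  have heq := h.eqn x hx
  rw [generator, iteratedDerivWithin_two_eq] at heq
  refine h2.congr_deriv ?_
  have hs : D.σ x ≠ 0 := fun h0 => (H.var_pos x hxI).ne' (by simp [h0])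
  rw [accel, driftRatio, twoInvVar]
  field_simp
  linarith

/-- If λ < 0, then p f f' has derivative p(f'² + b(κ - λ)f²) ≥ 0, is nonnegative at l by the sticky
condition, and vanishes at r. So f f' = 0 throughout, f² is constant, and f(r) = 0 forces f = 0. -/
theorem IsEigenfunction.nonneg (H : D.CoeffBounds) {lam : ℝ} {f : ℝ → ℝ}
    (h : D.IsEigenfunction lam f) : 0 ≤ lam := by
  by_contra hneg
  push Not at hneg
  obtain ⟨v, hv⟩ : ∃ v, v = derivWithin f (Icc D.l D.r) := ⟨_, rfl⟩
  have hfc : ContinuousOn f (Icc D.l D.r) := h.smooth.continuousOn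
  have hvc : ContinuousOn v (Icc D.l D.r) := hv ▸ h.continuousOn_deriv
  have hpc : ContinuousOn D.weight (Icc D.l D.r) :=
    fun x hx => (H.hasDerivWithinAt_weight hx).continuousWithinAt
  have hfd : ∀ x ∈ Ioo D.l D.r, HasDerivAt f (v x) x := fun x hx =>
    hv ▸ (h.hasDerivWithinAt (Ioo_subset_Icc_self hx)).hasDerivAt (Icc_mem_nhds hx.1 hx.2)
  have hvd : ∀ x ∈ Ioo D.l D.r, HasDerivAt v (D.accel lam x (f x) (v x)) x := fun x hx =>
    hv ▸ h.hasDerivAt_deriv H hx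
  have hgd : ∀ x ∈ Ioo D.l D.r, HasDerivAt (fun x => D.weight x * (f x * v x))
      (D.weight x * (v x ^ 2 + D.twoInvVar x * (D.κ x - lam) * f x ^ 2)) x := fun x hx =>
    (((H.hasDerivWithinAt_weight (Ioo_subset_Icc_self hx)).hasDerivAt
      (Icc_mem_nhds hx.1 hx.2)).mul ((hfd x hx).mul (hvd x hx))).congr_deriv
      (by simp only [accel, Pi.mul_apply]; ring)
  have hmono : MonotoneOn (fun x => D.weight x * (f x * v x)) (Icc D.l D.r) := by
    refine monotoneOn_of_deriv_nonneg (convex_Icc _ _) (hpc.mul (hfc.mul hvc)) ?_ ?_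
    · rw [interior_Icc]
      exact fun x hx => (hgd x hx).differentiableAt.differentiableWithinAt
    · rw [interior_Icc]
      intro x hx
      rw [(hgd x hx).deriv]
      have h1 := CoeffBounds.weight_pos (D := D) x
      have h2 := H.b_pos (Ioo_subset_Icc_self hx)
      have h3 := H.c_nonneg x (Ioo_subset_Icc_self hx)
      have h4 : 0 ≤ D.κ x - lam := by linarith
      positivity
  have hl : 0 ≤ D.weight D.l * (f D.l * v D.l) := by
    have h1 := h.left
    rw [← hv] at h1
    have h2 : v D.l = (D.κ D.l - lam) / D.ρ * f D.l := by
      have := D.ρ_pos.ne'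
      field_simp
      linarith
    have h3 : 0 ≤ D.κ D.l - lam := by linarith [H.c_nonneg D.l left_mem]
    have h4 : f D.l * v D.l = (D.κ D.l - lam) / D.ρ * f D.l ^ 2 := by rw [h2]; ring
    rw [h4]
    have := D.ρ_pos
    have := CoeffBounds.weight_pos (D := D) D.l
    positivity
  have hr : D.weight D.r * (f D.r * v D.r) = 0 := by rw [h.right]; ring
  have hzero : ∀ x ∈ Icc D.l D.r, f x * v x = 0 := by
    intro x hx
    have h1 := hmono left_mem hx hx.1
    have h2 := hmono hx right_mem hx.2
    simp only at h1 h2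
    have h3 : D.weight x * (f x * v x) = 0 := by linarith
    exact (mul_eq_zero.1 h3).resolve_left (CoeffBounds.weight_pos x).ne'
  obtain ⟨x, hx, hfx⟩ := h.nonzero
  have hconst : ∀ x ∈ Icc D.l D.r, f x ^ 2 = f D.r ^ 2 := by
    have hd : ∀ x ∈ Icc D.l D.r, HasDerivWithinAt (fun x => f x ^ 2) 0 (Icc D.l D.r) x :=
      fun x hx => ((h.hasDerivWithinAt hx).pow 2).congr_deriv (by
        have := hzero x hx
        rw [hv] at this
        push_cast
        rw [pow_one, mul_assoc, this, mul_zero])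
    intro x hx
    have h1 := abs_sub_le_of_deriv_bound (B := 0) hd (by simp) x hx
    have h2 := abs_sub_le_of_deriv_bound (B := 0) hd (by simp) D.r right_mem
    rw [zero_mul] at h1 h2
    have h3 := abs_nonpos_iff.1 h1
    have h4 := abs_nonpos_iff.1 h2
    linarith
  have := hconst x hx
  rw [h.right] at this
  exact hfx (by simpa using this)

theorem IsShooting.isEigenfunction (H : D.CoeffBounds) {lam : ℝ} {y u : ℝ → ℝ}
    (h : D.IsShooting lam y u) (hr : y D.r = 0) : D.IsEigenfunction lam y := by
  have hu := uniqueDiffOn_Icc D.l_lt_r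
  have h1 : ∀ x ∈ Icc D.l D.r, derivWithin y (Icc D.l D.r) x = u x :=
    fun x hx => (h.deriv x hx).derivWithin (hu x hx)
  have h2 : ∀ x ∈ Icc D.l D.r, derivWithin u (Icc D.l D.r) x = D.accel lam x (y x) (u x) :=
    fun x hx => (h.deriv_deriv x hx).derivWithin (hu x hx)
  have hacc : ContinuousOn (fun x => D.accel lam x (y x) (u x)) (Icc D.l D.r) := by
    have h1 := h.continuousOn
    have h2 := h.continuousOn_deriv
    have h3 := H.continuousOn_a
    have h4 := H.continuousOn_b
    have h5 := H.continuousOn_c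
    simp only [accel]
    fun_prop
  have hcu : ContDiffOn ℝ 1 u (Icc D.l D.r) := by
    rw [show (1 : WithTop ℕ∞) = 0 + 1 from (zero_add 1).symm, contDiffOn_succ_iff_derivWithin hu]
    refine ⟨fun x hx => (h.deriv_deriv x hx).differentiableWithinAt, by simp, ?_⟩
    exact (contDiffOn_zero.2 hacc).congr h2
  have hcy : ContDiffOn ℝ 2 y (Icc D.l D.r) := by
    rw [show (2 : WithTop ℕ∞) = 1 + 1 from one_add_one_eq_two.symm,
      contDiffOn_succ_iff_derivWithin hu]
    exact ⟨fun x hx => (h.deriv x hx).differentiableWithinAt, by simp, hcu.congr h1⟩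
  refine ⟨hcy, fun x hx => ?_, ?_, hr, D.l, left_mem, by rw [h.left]; norm_num⟩
  · have hxI := Ioo_subset_Icc_self hx
    rw [generator, iteratedDerivWithin_two_eq,
      derivWithin_congr (fun t ht => h1 t ht) (h1 x hxI), h2 x hxI, h1 x hxI, accel, driftRatio,
      twoInvVar]
    have hs : D.σ x ≠ 0 := fun h0 => (H.var_pos x hxI).ne' (by simp [h0])
    field_simp
    ring
  · rw [h1 D.l left_mem, h.left, h.left_deriv]
    have := D.ρ_pos.ne'
    field_simp
    ring

namespace CoeffBounds

/-- The shooting solution. -/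
def sol (H : D.CoeffBounds) (lam : ℝ) : ℝ → ℝ := (H.exists_isShooting lam).choose

/-- The derivative of the shooting solution. -/
def dsol (H : D.CoeffBounds) (lam : ℝ) : ℝ → ℝ := (H.exists_isShooting lam).choose_spec.choose

theorem isShooting (H : D.CoeffBounds) (lam : ℝ) : D.IsShooting lam (H.sol lam) (H.dsol lam) :=
  (H.exists_isShooting lam).choose_spec.choose_spec

theorem eq_mul_sol (H : D.CoeffBounds) {lam : ℝ} {f : ℝ → ℝ} (h : D.IsEigenfunction lam f) :
    ∀ x ∈ Icc D.l D.r, f x = f D.l * H.sol lam x := by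
  refine H.eq_mul_of_solution (by linarith [h.nonneg H]) (H.isShooting lam)
    h.smooth.continuousOn h.continuousOn_deriv
    (fun x hx => (h.hasDerivWithinAt (Ioo_subset_Icc_self hx)).hasDerivAt
      (Icc_mem_nhds hx.1 hx.2)) (fun x hx => h.hasDerivAt_deriv H hx) ?_
  have := D.ρ_pos.ne'
  have := h.left
  field_simp
  linarith

theorem sol_right_eq_zero (H : D.CoeffBounds) {lam : ℝ} {f : ℝ → ℝ}
    (h : D.IsEigenfunction lam f) : f D.l ≠ 0 ∧ H.sol lam D.r = 0 := by
  have h1 := H.eq_mul_sol h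
  have h2 : f D.l ≠ 0 := by
    intro h0
    obtain ⟨x, hx, hfx⟩ := h.nonzero
    exact hfx (by rw [h1 x hx, h0, zero_mul])
  have h3 := h1 D.r right_mem
  rw [h.right] at h3
  exact ⟨h2, (mul_eq_zero.1 h3.symm).resolve_left h2⟩

/-- The sticky condition determines a solution up to its value at l, so only the condition at r
remains to be met. -/
theorem mem_eigenvalues_iff (H : D.CoeffBounds) {lam : ℝ} :
    lam ∈ D.eigenvalues ↔ H.sol lam D.r = 0 :=
  ⟨fun ⟨_, h⟩ => (H.sol_right_eq_zero h).2, fun h => ⟨_, (H.isShooting lam).isEigenfunction H h⟩⟩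

theorem nonneg_of_mem_eigenvalues (H : D.CoeffBounds) {lam : ℝ} (h : lam ∈ D.eigenvalues) :
    0 ≤ lam := h.elim fun _ h => h.nonneg H

theorem continuousAt_sol_right (H : D.CoeffBounds) {lam : ℝ} (hlam : -1 < lam) :
    ContinuousAt (fun nu => H.sol nu D.r) lam := by
  obtain ⟨C, -, hC⟩ := H.exists_shooting_lipschitz
  have hw := one_le_freq hlam.le
  rw [ContinuousAt, tendsto_iff_norm_sub_tendsto_zero]
  have h0 : Tendsto (fun nu => C * |nu - lam|) (𝓝 lam) (𝓝 0) := by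
    have : ContinuousAt (fun nu => C * |nu - lam|) lam := by fun_prop
    simpa [ContinuousAt] using this
  refine squeeze_zero' (Eventually.of_forall fun _ => norm_nonneg _) ?_ h0
  filter_upwards [Ioo_mem_nhds hlam (lt_add_one lam)] with nu hnu
  exact (hC lam nu hlam.le hnu.1.le (by linarith [hnu.2]) _ _ _ _ (H.isShooting lam)
    (H.isShooting nu) D.r right_mem).1

/-- A gap in the set of eigenvalues up to `Λ` has length `O(√Λ)`. -/
theorem exists_gap_bound (H : D.CoeffBounds) : ∃ C : ℝ, 1 ≤ C ∧ ∀ Λ a b : ℝ, 0 ≤ a → a ≤ b → b ≤ Λ →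
    (∀ nu ∈ Icc a b, H.sol nu D.r ≠ 0) → b - a ≤ C * freq Λ := by
  obtain ⟨c, hc0, hc⟩ := H.exists_innerProd_lower
  obtain ⟨A, hA1, hA⟩ := H.exists_innerProd_lipschitz
  obtain ⟨C, hC1, hC⟩ := H.exists_shooting_bound
  obtain ⟨Cp, hCp1, hCp⟩ := H.exists_weight_bound
  obtain ⟨c0, hc0'⟩ : ∃ c0, c0 = c / (C ^ 2 * (1 + Cp ^ 2)) := ⟨_, rfl⟩
  have hc00 : 0 < c0 := by rw [hc0']; positivity
  refine ⟨max 1 (Real.pi / c0), le_max_left _ _, fun Λ a b ha hab hb hF => ?_⟩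
  obtain ⟨F, hFdef⟩ : ∃ F : ℝ → ℝ, F = fun nu => H.sol nu D.r := ⟨_, rfl⟩
  obtain ⟨G, hGdef⟩ : ∃ G : ℝ → ℝ, G = fun nu => D.weight D.r * H.dsol nu D.r := ⟨_, rfl⟩
  have hW : ∀ nu t, G nu * F t - F nu * G t = (t - nu) * D.innerProd (H.sol nu) (H.sol t) := by
    intro nu t
    rw [hFdef, hGdef]
    exact H.wronskian (H.isShooting nu) (H.isShooting t)
  have hF0 : ∀ nu ∈ Icc a b, F nu ≠ 0 := by rw [hFdef]; exact hF
  have hΩ : 1 ≤ freq Λ := one_le_freq (by linarith)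
  -- Dividing the Wronskian identity by (t - ν)F(ν)F(t) shows that the difference quotients of -G/F
  -- are (y_ν, y_t)/(F(ν)F(t)), so no differentiability of the solution in λ is needed.
  have hQ : ∀ nu ∈ Icc a b, HasDerivAt (fun t => -(G t / F t))
      (D.innerProd (H.sol nu) (H.sol nu) / F nu ^ 2) nu := by
    intro nu hnu
    have hnu0 : -1 < nu := by linarith [hnu.1]
    have hFc : ContinuousAt F nu := hFdef ▸ H.continuousAt_sol_right hnu0
    have hIc : ContinuousAt (fun t => D.innerProd (H.sol nu) (H.sol t)) nu := by
      rw [ContinuousAt, tendsto_iff_norm_sub_tendsto_zero]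
      have h0 : Tendsto (fun t => A * freq nu * |t - nu|) (𝓝 nu) (𝓝 0) := by
        have : ContinuousAt (fun t => A * freq nu * |t - nu|) nu := by fun_prop
        simpa [ContinuousAt] using this
      refine squeeze_zero' (Eventually.of_forall fun _ => norm_nonneg _) ?_ h0
      filter_upwards [Ioo_mem_nhds hnu0 (lt_add_one nu)] with t ht
      exact hA nu t hnu0.le ht.1.le (by linarith [ht.2, one_le_freq hnu0.le]) _ _ _ _
        (H.isShooting nu) (H.isShooting t)
    rw [hasDerivAt_iff_tendsto_slope]
    have hlim : Tendsto (fun t => D.innerProd (H.sol nu) (H.sol t) / (F nu * F t)) (𝓝[≠] nu)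
        (𝓝 (D.innerProd (H.sol nu) (H.sol nu) / F nu ^ 2)) := by
      rw [sq]
      exact ((hIc.div (continuousAt_const.mul hFc)
        (mul_ne_zero (hF0 nu hnu) (hF0 nu hnu))).tendsto).mono_left nhdsWithin_le_nhds
    refine hlim.congr' ?_
    have hne : ∀ᶠ t in 𝓝[≠] nu, F t ≠ 0 :=
      (hFc.eventually_ne (hF0 nu hnu)).filter_mono nhdsWithin_le_nhds
    filter_upwards [hne, self_mem_nhdsWithin] with t ht htn
    have htn' : t - nu ≠ 0 := sub_ne_zero.2 htn
    have hFn := hF0 nu hnu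
    have hI : D.innerProd (H.sol nu) (H.sol t) = (G nu * F t - F nu * G t) / (t - nu) := by
      rw [hW, mul_div_cancel_left₀ _ htn']
    rw [slope_def_field, hI]
    field_simp
    ring
  -- A Prüfer angle, scaled by Ω = √(2 + Λ). Its derivative is Ω(y, y)/(F²Ω² + G²). Since F² =
  -- O(w²), G² = O(w²Ω²) and (y, y) ≥ c w², this is at least c₀/Ω. On an interval free of zeros of F
  -- the angle varies by less than π, so the interval has length at most πΩ/c₀.
  have hθ : ∀ nu ∈ Icc a b, HasDerivAt (fun t => Real.arctan (-(G t / F t) / freq Λ))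
      (1 / (1 + (-(G nu / F nu) / freq Λ) ^ 2) *
        (D.innerProd (H.sol nu) (H.sol nu) / F nu ^ 2 / freq Λ)) nu :=
    fun nu hnu => ((hQ nu hnu).div_const _).arctan
  have key := Convex.mul_sub_le_image_sub_of_le_deriv (convex_Icc a b)
    (f := fun t => Real.arctan (-(G t / F t) / freq Λ))
    (fun nu hnu => (hθ nu hnu).continuousAt.continuousWithinAt)
    (fun nu hnu => (hθ nu (interior_subset hnu)).differentiableAt.differentiableWithinAt)
    (C := c0 / freq Λ) (fun nu hnu => ?_) a (left_mem_Icc.2 hab) b (right_mem_Icc.2 hab) hab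
  · have h1 := Real.arctan_lt_pi_div_two (-(G b / F b) / freq Λ)
    have h2 := Real.neg_pi_div_two_lt_arctan (-(G a / F a) / freq Λ)
    have h3 : c0 / freq Λ * (b - a) ≤ Real.pi := by linarith
    calc b - a = c0 / freq Λ * (b - a) * (freq Λ / c0) := by field_simp
      _ ≤ Real.pi * (freq Λ / c0) := by gcongr
      _ = Real.pi / c0 * freq Λ := by ring
      _ ≤ _ := by gcongr; exact le_max_right _ _
  · have hnu' := interior_subset hnu
    rw [(hθ nu hnu').deriv]
    have hnu1 : -1 ≤ nu := by linarith [hnu'.1]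
    have hw := one_le_freq hnu1
    have hwΩ : freq nu ≤ freq Λ := freq_mono (hnu'.2.trans hb)
    have hy := hC nu hnu1 _ _ (H.isShooting nu) D.r right_mem
    have hI := hc nu hnu1 _ _ (H.isShooting nu)
    have hFle : F nu ^ 2 ≤ C ^ 2 * freq nu ^ 2 := by
      rw [hFdef, ← mul_pow, ← sq_abs]
      exact pow_le_pow_left₀ (abs_nonneg _) hy.1 2
    have hGle : G nu ^ 2 ≤ Cp ^ 2 * C ^ 2 * freq nu ^ 2 * freq Λ ^ 2 := by
      have hp := weight_pos (D := D) D.r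
      have : |G nu| ≤ Cp * (C * freq nu ^ 2) := by
        rw [hGdef]
        simp only
        rw [abs_mul, abs_of_pos hp]
        have := (hCp D.r right_mem).1
        gcongr
        exact hy.2
      calc G nu ^ 2 = |G nu| ^ 2 := (sq_abs _).symm
        _ ≤ (Cp * (C * (freq nu * freq nu))) ^ 2 := by rw [← sq]; gcongr
        _ ≤ (Cp * (C * (freq nu * freq Λ))) ^ 2 := by gcongr
        _ = _ := by ring
    have hFn := hF0 nu hnu'
    have hF2 : 0 < F nu ^ 2 := by positivity
    have hΩ2 : 0 < freq Λ ^ 2 := by positivity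
    have hmain : c0 * (F nu ^ 2 * freq Λ ^ 2 + G nu ^ 2)
        ≤ D.innerProd (H.sol nu) (H.sol nu) * freq Λ ^ 2 := by
      calc _ ≤ c0 * (C ^ 2 * freq nu ^ 2 * freq Λ ^ 2
            + Cp ^ 2 * C ^ 2 * freq nu ^ 2 * freq Λ ^ 2) := by gcongr
        _ = c0 * (C ^ 2 * (1 + Cp ^ 2)) * freq nu ^ 2 * freq Λ ^ 2 := by ring
        _ = c * freq nu ^ 2 * freq Λ ^ 2 := by rw [hc0']; field_simp
        _ ≤ _ := by gcongr
    have e : 1 / (1 + (-(G nu / F nu) / freq Λ) ^ 2) *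
        (D.innerProd (H.sol nu) (H.sol nu) / F nu ^ 2 / freq Λ)
        = D.innerProd (H.sol nu) (H.sol nu) * freq Λ ^ 2
          / (F nu ^ 2 * freq Λ ^ 2 + G nu ^ 2) / freq Λ := by
      have h3 : F nu ^ 2 * freq Λ ^ 2 + G nu ^ 2 ≠ 0 := by positivity
      have h4 : 1 + (-(G nu / F nu) / freq Λ) ^ 2
          = (F nu ^ 2 * freq Λ ^ 2 + G nu ^ 2) / (F nu ^ 2 * freq Λ ^ 2) := by
        field_simp
      rw [h4]
      field_simp
    rw [e]
    gcongr
    rw [le_div_iff₀ (by positivity)]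
    exact hmain

/-- The `k`-th eigenvalue is `O(k²)`. -/
theorem exists_eigenvalue_bound (H : D.CoeffBounds) : ∃ C : ℝ, 1 ≤ C ∧ ∀ k : ℕ, 1 ≤ k → ∀ lam : ℝ,
    {nu | nu ∈ D.eigenvalues ∧ nu < lam}.encard + 1 = (k : ℕ∞) → lam ≤ C * (k : ℝ) ^ 2 := by
  obtain ⟨C, hC1, hC⟩ := H.exists_gap_bound
  obtain ⟨M, hM⟩ : ∃ M, M = 4 * (C + 1) ^ 2 := ⟨_, rfl⟩
  have hM1 : 1 ≤ M := by rw [hM]; nlinarith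
  refine ⟨2 * M, by linarith, fun k hk lam hlam => ?_⟩
  by_contra hcon
  push Not at hcon
  have hk1 : (1 : ℝ) ≤ k := by exact_mod_cast hk
  obtain ⟨Λ, hΛ⟩ : ∃ Λ, Λ = 2 * M * (k : ℝ) ^ 2 := ⟨_, rfl⟩
  have hΛ0 : 0 ≤ Λ := by rw [hΛ]; positivity
  have hΩ : 1 ≤ freq Λ := one_le_freq (by linarith)
  have hΩ2 := freq_sq (lam := Λ) (by linarith)
  -- The length s exceeds the largest possible gap C√(2 + Λ), so each of the k disjoint intervals
  -- [2js, 2js + s], j < k, contains an eigenvalue. The choice M = 4(C + 1)² makes them all lie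
  -- below Λ = 2Mk² < λ, although only k - 1 eigenvalues do.
  obtain ⟨s, hs⟩ : ∃ s, s = (C + 1) * freq Λ := ⟨_, rfl⟩
  have hs0 : 0 < s := by rw [hs]; positivity
  have hsk : 2 * k * s ≤ Λ := by
    refine le_of_sq_le_sq ?_ hΛ0
    have e : (2 * k * s) ^ 2 = M * (k : ℝ) ^ 2 * (2 + Λ) := by rw [hs, hM, ← hΩ2]; ring
    rw [e, hΛ]
    have h1 : 1 ≤ M * (k : ℝ) ^ 2 := one_le_mul_of_one_le_of_one_le hM1 (one_le_pow₀ hk1)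
    nlinarith
  have hz : ∀ j : ℕ, j < k → ∃ nu ∈ Icc (2 * j * s) (2 * j * s + s), H.sol nu D.r = 0 := by
    intro j hj
    by_contra hno
    push Not at hno
    have hj' : (j : ℝ) + 1 ≤ k := by exact_mod_cast hj
    have hb : 2 * j * s + s ≤ Λ := by nlinarith
    have := hC Λ (2 * j * s) (2 * j * s + s) (by positivity) (by linarith) hb hno
    rw [add_sub_cancel_left, hs] at this
    nlinarith
  choose! z hz1 hz2 using hz
  have hinj : InjOn z (Finset.range k : Set ℕ) := by
    intro i hi j hj hij
    have hi' := hz1 i (by simpa using hi)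
    have hj' := hz1 j (by simpa using hj)
    rw [← hij] at hj'
    by_contra hne
    rcases lt_or_gt_of_ne hne with hlt | hlt
    · have : (i : ℝ) + 1 ≤ j := by exact_mod_cast hlt
      nlinarith [hi'.2, hj'.1]
    · have : (j : ℝ) + 1 ≤ i := by exact_mod_cast hlt
      nlinarith [hj'.2, hi'.1]
  have hsub : z '' (Finset.range k : Set ℕ) ⊆ {nu | nu ∈ D.eigenvalues ∧ nu < lam} := by
    rintro _ ⟨j, hj, rfl⟩
    have hj2 : j < k := by simpa using hj
    refine ⟨H.mem_eigenvalues_iff.2 (hz2 j hj2), ?_⟩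
    have hj' : (j : ℝ) + 1 ≤ k := by exact_mod_cast hj2
    have := (hz1 j hj2).2
    nlinarith
  have hcard := encard_le_encard hsub
  rw [hinj.encard_image, encard_coe_eq_coe_finsetCard, Finset.card_range] at hcard
  have h2 : (k : ℕ∞) + 1 ≤ k := by
    calc (k : ℕ∞) + 1 ≤ _ + 1 := by gcongr
      _ = k := hlam
  have h3 : k + 1 ≤ k := by exact_mod_cast h2
  omega

end CoeffBounds
end StickyDiffusion

/-! ### Higher derivatives of the shooting solution and local errors. -/

theorem abs_add_le_add {x y X Y : ℝ} (hx : |x| ≤ X) (hy : |y| ≤ Y) : |x + y| ≤ X + Y :=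
  (abs_add_le _ _).trans (add_le_add hx hy)

theorem abs_mul_le_mul {x y X Y : ℝ} (hx : |x| ≤ X) (hy : |y| ≤ Y) : |x * y| ≤ X * Y := by
  rw [abs_mul]
  exact mul_le_mul hx hy (abs_nonneg _) ((abs_nonneg _).trans hx)

namespace StickyDiffusion

variable {D : StickyDiffusion}

namespace CoeffBounds

/-- The derivative of `b (κ - lam)`. -/
def pot1 (H : D.CoeffBounds) (lam x : ℝ) : ℝ :=
  H.b1 x * (D.κ x - lam) + D.twoInvVar x * H.c1 x

/-- The second derivative of `b (κ - lam)`. -/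
def pot2 (H : D.CoeffBounds) (lam x : ℝ) : ℝ :=
  H.b2 x * (D.κ x - lam) + 2 * (H.b1 x * H.c1 x) + D.twoInvVar x * H.c2 x

/-- The third derivative of a solution with value `y` and derivative `u`. -/
def accel1 (H : D.CoeffBounds) (lam x y u : ℝ) : ℝ :=
  -2 * H.a1 x * u + -2 * D.driftRatio x * D.accel lam x y u
    + H.pot1 lam x * y + D.twoInvVar x * (D.κ x - lam) * u

/-- The fourth derivative of a solution with value `y` and derivative `u`. -/
def accel2 (H : D.CoeffBounds) (lam x y u : ℝ) : ℝ :=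
  -2 * H.a2 x * u + -4 * H.a1 x * D.accel lam x y u + -2 * D.driftRatio x * H.accel1 lam x y u
    + H.pot2 lam x * y + 2 * H.pot1 lam x * u + D.twoInvVar x * (D.κ x - lam) * D.accel lam x y u

theorem hasDerivWithinAt_accel (H : D.CoeffBounds) {lam : ℝ} {y u : ℝ → ℝ}
    (h : D.IsShooting lam y u) {x : ℝ} (hx : x ∈ Icc D.l D.r) :
    HasDerivWithinAt (fun t => D.accel lam t (y t) (u t)) (H.accel1 lam x (y x) (u x))
      (Icc D.l D.r) x :=
  ((((H.ha x hx).const_mul (-2)).mul (h.deriv_deriv x hx)).add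
    (((H.hb x hx).mul ((H.hc x hx).sub_const lam)).mul (h.deriv x hx))).congr_deriv (by
      simp only [accel1, pot1, Pi.mul_apply]; ring)

theorem hasDerivWithinAt_accel1 (H : D.CoeffBounds) {lam : ℝ} {y u : ℝ → ℝ}
    (h : D.IsShooting lam y u) {x : ℝ} (hx : x ∈ Icc D.l D.r) :
    HasDerivWithinAt (fun t => H.accel1 lam t (y t) (u t)) (H.accel2 lam x (y x) (u x))
      (Icc D.l D.r) x :=
  ((((((H.ha1 x hx).const_mul (-2)).mul (h.deriv_deriv x hx)).add
    (((H.ha x hx).const_mul (-2)).mul (H.hasDerivWithinAt_accel h hx))).add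
    ((((H.hb1 x hx).mul ((H.hc x hx).sub_const lam)).add
      ((H.hb x hx).mul (H.hc1 x hx))).mul (h.deriv x hx))).add
    (((H.hb x hx).mul ((H.hc x hx).sub_const lam)).mul (h.deriv_deriv x hx))).congr_deriv (by
      simp only [accel2, pot1, pot2, Pi.mul_apply, Pi.add_apply]; ring)

theorem abs_killing_sub_le (H : D.CoeffBounds) {lam : ℝ} (hlam : -1 ≤ lam) {x : ℝ}
    (hx : x ∈ Icc D.l D.r) : |D.κ x - lam| ≤ (H.B + 2) * freq lam ^ 2 := by
  have h2 := abs_le.1 (H.c_le x hx)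
  have h3 := H.c_nonneg x hx
  have hB := H.one_le
  rw [freq_sq hlam, abs_le]
  constructor <;> nlinarith

/-- Starting from y = O(w) and y' = O(w²), each differentiation costs one power of w: the potential
b(κ - λ) and its derivatives are O(w²), and the remaining coefficients are bounded. -/
theorem exists_derivatives_bound (H : D.CoeffBounds) : ∃ C : ℝ, 1 ≤ C ∧ ∀ lam : ℝ, -1 ≤ lam →
    ∀ y u, D.IsShooting lam y u → ∀ x ∈ Icc D.l D.r,
      |D.accel lam x (y x) (u x)| ≤ C * freq lam ^ 3 ∧
      |H.accel1 lam x (y x) (u x)| ≤ C * freq lam ^ 4 ∧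
      |H.accel2 lam x (y x) (u x)| ≤ C * freq lam ^ 5 := by
  obtain ⟨C, hC1, hC⟩ := H.exists_shooting_bound
  obtain ⟨B, hBdef⟩ : ∃ B, B = H.B := ⟨_, rfl⟩
  have hB : 1 ≤ B := hBdef ▸ H.one_le
  obtain ⟨C0, h0⟩ : ∃ C0, C0 = 2 * B * C + B * (B + 2) * C := ⟨_, rfl⟩
  obtain ⟨P1, hP1⟩ : ∃ P1, P1 = B * (B + 2) + B * B := ⟨_, rfl⟩
  obtain ⟨P2, hP2⟩ : ∃ P2, P2 = B * (B + 2) + 2 * (B * B) + B * B := ⟨_, rfl⟩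
  obtain ⟨C1, h1⟩ : ∃ C1, C1 = 2 * B * C + 2 * B * C0 + P1 * C + B * (B + 2) * C := ⟨_, rfl⟩
  obtain ⟨C2, h2⟩ : ∃ C2, C2 = 2 * B * C + 4 * B * C0 + 2 * B * C1 + P2 * C + 2 * P1 * C
    + B * (B + 2) * C0 := ⟨_, rfl⟩
  have hC0 : 1 ≤ C0 := by
    have e1 := one_le_mul_of_one_le_of_one_le hB hC1
    have e2 : 0 ≤ B * (B + 2) * C := by positivity
    linarith
  have hP10 : 0 ≤ P1 := by rw [hP1]; positivity
  have hP20 : 0 ≤ P2 := by rw [hP2]; positivity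
  have hC10 : 0 ≤ C1 := by rw [h1]; positivity
  have hC20 : 0 ≤ C2 := by rw [h2]; positivity
  refine ⟨C0 + C1 + C2, by linarith, fun lam hlam y u h x hx => ?_⟩
  have hw := one_le_freq hlam
  have hk := H.abs_killing_sub_le hlam hx
  obtain ⟨w, hwdef⟩ : ∃ w, w = freq lam := ⟨_, rfl⟩
  obtain ⟨hy, hu⟩ := hC lam hlam y u h x hx
  rw [← hwdef] at hw hk hy hu ⊢
  rw [← hBdef] at hk
  have hw0 : 0 ≤ w := by linarith
  have up : ∀ {i j : ℕ} {z K : ℝ}, i ≤ j → 0 ≤ K → |z| ≤ K * w ^ i → |z| ≤ K * w ^ j :=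
    fun hij hK hz => hz.trans (mul_le_mul_of_nonneg_left (pow_le_pow_right₀ hw hij) hK)
  have hy1 : |y x| ≤ C * w ^ 1 := by simpa using hy
  have ha : |D.driftRatio x| ≤ B := hBdef ▸ H.a_le x hx
  have ha1 : |H.a1 x| ≤ B := hBdef ▸ H.a1_le x hx
  have ha2 : |H.a2 x| ≤ B := hBdef ▸ H.a2_le x hx
  have hb : |D.twoInvVar x| ≤ B := hBdef ▸ H.b_le x hx
  have hb1 : |H.b1 x| ≤ B := hBdef ▸ H.b1_le x hx
  have hb2 : |H.b2 x| ≤ B := hBdef ▸ H.b2_le x hx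
  have hc1 : |H.c1 x| ≤ B := hBdef ▸ H.c1_le x hx
  have hc2 : |H.c2 x| ≤ B := hBdef ▸ H.c2_le x hx
  have n2 : |(-2 : ℝ)| ≤ 2 := by norm_num
  have n4 : |(-4 : ℝ)| ≤ 4 := by norm_num
  have p2 : |(2 : ℝ)| ≤ 2 := by norm_num
  have hBw : B ≤ B * w ^ 2 := le_mul_of_one_le_right (by linarith) (one_le_pow₀ hw)
  have hacc : |D.accel lam x (y x) (u x)| ≤ C0 * w ^ 3 := by
    refine (abs_add_le_add (abs_mul_le_mul (abs_mul_le_mul n2 ha) (up (j := 3) (by norm_num)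
      (by linarith) hu)) (abs_mul_le_mul (abs_mul_le_mul hb hk) hy1)).trans_eq ?_
    rw [h0]; ring
  have hp1 : |H.pot1 lam x| ≤ P1 * w ^ 2 := by
    refine (abs_add_le_add (abs_mul_le_mul hb1 hk) (abs_mul_le_mul hb (hc1.trans hBw))).trans_eq ?_
    rw [hP1]; ring
  have hp2 : |H.pot2 lam x| ≤ P2 * w ^ 2 := by
    refine (abs_add_le_add (abs_add_le_add (abs_mul_le_mul hb2 hk) (abs_mul_le_mul p2
      (abs_mul_le_mul hb1 (hc1.trans hBw)))) (abs_mul_le_mul hb (hc2.trans hBw))).trans_eq ?_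
    rw [hP2]; ring
  have hacc1 : |H.accel1 lam x (y x) (u x)| ≤ C1 * w ^ 4 := by
    refine (abs_add_le_add (abs_add_le_add (abs_add_le_add
      (abs_mul_le_mul (abs_mul_le_mul n2 ha1) (up (j := 4) (by norm_num) (by linarith) hu))
      (abs_mul_le_mul (abs_mul_le_mul n2 ha) (up (j := 4) (by norm_num) (by linarith) hacc)))
      (abs_mul_le_mul hp1 (up (j := 2) (by norm_num) (by linarith) hy1)))
      (abs_mul_le_mul (abs_mul_le_mul hb hk) hu)).trans_eq ?_
    rw [h1]; ring
  have hacc2 : |H.accel2 lam x (y x) (u x)| ≤ C2 * w ^ 5 := by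
    refine (abs_add_le_add (abs_add_le_add (abs_add_le_add (abs_add_le_add (abs_add_le_add
      (abs_mul_le_mul (abs_mul_le_mul n2 ha2) (up (j := 5) (by norm_num) (by linarith) hu))
      (abs_mul_le_mul (abs_mul_le_mul n4 ha1) (up (j := 5) (by norm_num) (by linarith) hacc)))
      (abs_mul_le_mul (abs_mul_le_mul n2 ha) (up (j := 5) (by norm_num) hC10 hacc1)))
      (abs_mul_le_mul hp2 (up (j := 3) (by norm_num) (by linarith) hy1)))
      (abs_mul_le_mul (abs_mul_le_mul p2 hp1) (up (j := 3) (by norm_num) (by linarith) hu)))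
      (abs_mul_le_mul (abs_mul_le_mul hb hk) hacc)).trans_eq ?_
    rw [h2]; ring
  refine ⟨hacc.trans ?_, hacc1.trans ?_, hacc2.trans ?_⟩ <;> gcongr <;> linarith

/-- Local errors of the velocity Verlet scheme. -/
theorem exists_local_error (H : D.CoeffBounds) : ∃ C : ℝ, 1 ≤ C ∧ ∀ lam : ℝ, -1 ≤ lam →
    ∀ y u, D.IsShooting lam y u → ∀ x z : ℝ, x ∈ Icc D.l D.r → z ∈ Icc D.l D.r → x ≤ z →
      |y z - y x - (z - x) * u x - (z - x) ^ 2 / 2 * D.accel lam x (y x) (u x)|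
        ≤ C * freq lam ^ 4 * (z - x) ^ 3 ∧
      |u z - u x - (z - x) / 2 * (D.accel lam x (y x) (u x) + D.accel lam z (y z) (u z))|
        ≤ C * freq lam ^ 5 * (z - x) ^ 3 := by
  obtain ⟨C, hC1, hC⟩ := H.exists_derivatives_bound
  refine ⟨C, hC1, fun lam hlam y u h x z hx hz hxz => ?_⟩
  have hsub : Icc x z ⊆ Icc D.l D.r := Icc_subset_Icc hx.1 hz.2
  have d1 : ∀ t ∈ Icc x z, HasDerivWithinAt y (u t) (Icc x z) t :=
    fun t ht => (h.deriv t (hsub ht)).mono hsub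
  have d2 : ∀ t ∈ Icc x z, HasDerivWithinAt u (D.accel lam t (y t) (u t)) (Icc x z) t :=
    fun t ht => (h.deriv_deriv t (hsub ht)).mono hsub
  have d3 : ∀ t ∈ Icc x z, HasDerivWithinAt (fun t => D.accel lam t (y t) (u t))
      (H.accel1 lam t (y t) (u t)) (Icc x z) t :=
    fun t ht => (H.hasDerivWithinAt_accel h (hsub ht)).mono hsub
  have d4 : ∀ t ∈ Icc x z, HasDerivWithinAt (fun t => H.accel1 lam t (y t) (u t))
      (H.accel2 lam t (y t) (u t)) (Icc x z) t :=
    fun t ht => (H.hasDerivWithinAt_accel1 h (hsub ht)).mono hsub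
  have hd : 0 ≤ z - x := sub_nonneg.2 hxz
  have hw := one_le_freq hlam
  constructor
  · refine (abs_taylor_two_le d1 d2 d3 (fun t ht => (hC lam hlam y u h t (hsub ht)).2.1) z
      (right_mem_Icc.2 hxz)).trans ?_
    gcongr
    have : 0 ≤ C * freq lam ^ 4 := by positivity
    linarith
  · exact abs_trapezoid_le hxz d2 d3 d4 (fun t ht => (hC lam hlam y u h t (hsub ht)).2.2)

end CoeffBounds
end StickyDiffusion

/-! ### Stability of the velocity Verlet step. -/

theorem sqrt_add_sq_le (x y x' y' : ℝ) :
    √((x + x') ^ 2 + (y + y') ^ 2) ≤ √(x ^ 2 + y ^ 2) + |x'| + |y'| := by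
  have h0 := Real.sqrt_nonneg (x ^ 2 + y ^ 2)
  have h1 := Real.sq_sqrt (by positivity : 0 ≤ x ^ 2 + y ^ 2)
  have hx : |x| ≤ √(x ^ 2 + y ^ 2) := Real.abs_le_sqrt (by nlinarith [sq_nonneg y])
  have hy : |y| ≤ √(x ^ 2 + y ^ 2) := Real.abs_le_sqrt (by nlinarith [sq_nonneg x])
  refine Real.sqrt_le_iff.2 ⟨by positivity, ?_⟩
  have e1 : x * x' ≤ √(x ^ 2 + y ^ 2) * |x'| := (le_abs_self _).trans (abs_mul_le_mul hx le_rfl)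
  have e2 : y * y' ≤ √(x ^ 2 + y ^ 2) * |y'| := (le_abs_self _).trans (abs_mul_le_mul hy le_rfl)
  have e3 := sq_abs x'
  have e4 := sq_abs y'
  have e5 : 0 ≤ |x'| * |y'| := by positivity
  nlinarith

set_option maxHeartbeats 1000000 in
/-- One step of the velocity Verlet scheme is stable in the energy norm, uniformly in the
frequency `w`, as long as `w ^ 3 * δ ^ 2 ≤ 1`. -/
theorem exists_verlet_stability {B : ℝ} (hB : 1 ≤ B) : ∃ K : ℝ, 1 ≤ K ∧
    ∀ w δ T a b c a' b' c' e d e' d' τ₁ τ₂ : ℝ, 1 ≤ w → 0 < δ → w ^ 3 * δ ^ 2 ≤ 1 → K * δ ≤ 1 →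
    |a| ≤ B → |a'| ≤ B → |c| ≤ B → |c'| ≤ B → 1 ≤ B * b → b ≤ B → b' ≤ B → 0 < b' →
    |b' - b| ≤ B * δ → w * |τ₁| ≤ δ * T → |τ₂| ≤ δ * T →
    e' = e + δ * d + δ ^ 2 / 2 * (-2 * a * d + b * (c + 2 - w ^ 2) * e) + τ₁ →
    d' = d + δ / 2 * ((-2 * a * d + b * (c + 2 - w ^ 2) * e)
      + (-2 * a' * d' + b' * (c' + 2 - w ^ 2) * e')) + τ₂ →
    √(w ^ 2 * b' * e' ^ 2 + d' ^ 2) + T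
      ≤ (1 + K * δ) * (√(w ^ 2 * b * e ^ 2 + d ^ 2) + T) := by
  obtain ⟨R0, hR0⟩ : ∃ R0, R0 = 2 * B + B ^ 2 * (B + 2) := ⟨_, rfl⟩
  obtain ⟨K1, hK1⟩ : ∃ K1, K1 = B ^ 3 * ((1 + B) * (2 + B * (1 + B))) := ⟨_, rfl⟩
  obtain ⟨K2, hK2⟩ : ∃ K2, K2 = R0 + B ^ 2 := ⟨_, rfl⟩
  obtain ⟨K3, hK3⟩ : ∃ K3, K3 = K1 + (1 + B) * (B * (R0 + 1)) + (R0 + 1) := ⟨_, rfl⟩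
  obtain ⟨K4, hK4⟩ : ∃ K4, K4 = K3 + K2 * (2 * (1 + K3)) := ⟨_, rfl⟩
  have hR00 : 0 ≤ R0 := by rw [hR0]; positivity
  have hK10 : 0 ≤ K1 := by rw [hK1]; positivity
  have hK20 : 1 ≤ K2 := by rw [hK2]; linarith [one_le_pow₀ hB (n := 2)]
  have hK30 : 0 ≤ K3 := by rw [hK3]; positivity
  have hK40 : 0 ≤ K4 := by rw [hK4]; positivity
  -- K4 is the growth rate in the norm with b frozen at the left node, B²(1 + K4) pays for replacing
  -- b by b' in the norm, and 2·K2 ensures K2 δ ≤ 1/2, needed to solve the implicit velocity update.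
  refine ⟨K4 + B ^ 2 * (1 + K4) + 2 * K2, ?_, ?_⟩
  · have : 0 ≤ B ^ 2 * (1 + K4) := by positivity
    linarith
  intro w δ T a b c a' b' c' e d e' d' τ₁ τ₂ hw hδ hwδ hKδ ha ha' hc hc' hb hbB hb'B hb'0 hbb hτ₁
    hτ₂ he' hd'
  have hT : 0 ≤ T := by
    have : 0 ≤ δ * T := (abs_nonneg _).trans hτ₂
    exact nonneg_of_mul_nonneg_right this hδ
  have hb0 : 0 < b := (mul_pos_iff_of_pos_left (by linarith)).1 (one_pos.trans_le hb)
  have hKδ' : 0 ≤ B ^ 2 * (1 + K4) * δ := by positivity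
  have hK4δ : 0 ≤ K4 * δ := by positivity
  have hK2δ : K2 * δ ≤ 1 / 2 := by linarith
  have hδ1 : δ ≤ 1 := by linarith [le_mul_of_one_le_left hδ.le hK20]
  have hwδ1 : w * δ ≤ 1 := by
    have : (w * δ) ^ 2 ≤ 1 := by
      calc (w * δ) ^ 2 = w ^ 2 * δ ^ 2 := by ring
        _ ≤ w ^ 3 * δ ^ 2 := by gcongr; norm_num
        _ ≤ 1 := hwδ
    exact (sq_le_one_iff₀ (by positivity)).1 this
  obtain ⟨s, hs⟩ : ∃ s, s = w * √b := ⟨_, rfl⟩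
  have hsb := Real.sq_sqrt hb0.le
  have hs2 : s ^ 2 = w ^ 2 * b := by rw [hs, mul_pow, hsb]
  have hsqb : √b ≤ B := Real.sqrt_le_iff.2 ⟨by linarith, hbB.trans (le_self_pow₀ hB two_ne_zero)⟩
  have hsqb' : 1 ≤ B * √b := by
    have : 1 ≤ (B * √b) ^ 2 := by
      rw [mul_pow, hsb, sq, mul_assoc]
      exact one_le_mul_of_one_le_of_one_le hB hb
    exact (one_le_sq_iff₀ (by positivity)).1 this
  have hs0 : 0 < s := by rw [hs]; positivity
  have hsB : s ≤ B * w := by rw [hs, mul_comm]; gcongr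
  have hws : w ≤ B * s := by
    calc w = w * 1 := (mul_one _).symm
      _ ≤ w * (B * √b) := by gcongr
      _ = B * s := by rw [hs]; ring
  -- rescaled variables
  obtain ⟨X, hX⟩ : ∃ X, X = s * e := ⟨_, rfl⟩
  obtain ⟨X', hX'⟩ : ∃ X', X' = s * e' := ⟨_, rfl⟩
  obtain ⟨N, hN⟩ : ∃ N, N = √(X ^ 2 + d ^ 2) := ⟨_, rfl⟩
  obtain ⟨N1, hN1⟩ : ∃ N1, N1 = √(X' ^ 2 + d' ^ 2) := ⟨_, rfl⟩
  have hNeq : √(w ^ 2 * b * e ^ 2 + d ^ 2) = N := by rw [hN, hX, mul_pow, hs2]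
  have hN0 : 0 ≤ N := hN ▸ Real.sqrt_nonneg _
  have hN10 : 0 ≤ N1 := hN1 ▸ Real.sqrt_nonneg _
  have hNsq : N ^ 2 = X ^ 2 + d ^ 2 := by rw [hN]; exact Real.sq_sqrt (by positivity)
  have hN1sq : N1 ^ 2 = X' ^ 2 + d' ^ 2 := by rw [hN1]; exact Real.sq_sqrt (by positivity)
  have hXN : |X| ≤ N := by rw [hN]; exact Real.abs_le_sqrt (by linarith [sq_nonneg d])
  have hdN : |d| ≤ N := by rw [hN]; exact Real.abs_le_sqrt (by linarith [sq_nonneg X])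
  have hXN' : |X'| ≤ N1 := by rw [hN1]; exact Real.abs_le_sqrt (by linarith [sq_nonneg d'])
  have hdN' : |d'| ≤ N1 := by rw [hN1]; exact Real.abs_le_sqrt (by linarith [sq_nonneg X'])
  have hwe : w * |e| ≤ B * N := by
    calc w * |e| ≤ B * s * |e| := by gcongr
      _ = B * |X| := by rw [hX, abs_mul, abs_of_pos hs0]; ring
      _ ≤ _ := by gcongr
  have hwe' : w * |e'| ≤ B * N1 := by
    calc w * |e'| ≤ B * s * |e'| := by gcongr
      _ = B * |X'| := by rw [hX', abs_mul, abs_of_pos hs0]; ring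
      _ ≤ _ := by gcongr
  have heN : |e| ≤ B * N := (le_mul_of_one_le_left (abs_nonneg _) hw).trans hwe
  have heN' : |e'| ≤ B * N1 := (le_mul_of_one_le_left (abs_nonneg _) hw).trans hwe'
  have n2 : |(-2 : ℝ)| ≤ 2 := by norm_num
  -- The drift and killing parts of the acceleration are lower order: |d| and w|e| are both
  -- controlled by the energy norm, so they contribute only O(δ) per step. The dangerous term is
  -- -w²b e.
  obtain ⟨ρ, hρ⟩ : ∃ ρ, ρ = -2 * a * d + b * (c + 2) * e := ⟨_, rfl⟩
  obtain ⟨ρ', hρ'⟩ : ∃ ρ', ρ' = -2 * a' * d' + b' * (c' + 2) * e' := ⟨_, rfl⟩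
  have hρN : |ρ| ≤ R0 * N := by
    rw [hρ]
    refine (abs_add_le_add (abs_mul_le_mul (abs_mul_le_mul n2 ha) hdN)
      (abs_mul_le_mul (abs_mul_le_mul (abs_le.2 ⟨by linarith, hbB⟩)
        (abs_add_le_add hc (by norm_num : |(2 : ℝ)| ≤ 2))) heN)).trans_eq ?_
    rw [hR0]; ring
  have hρN' : |ρ'| ≤ R0 * N1 := by
    rw [hρ']
    refine (abs_add_le_add (abs_mul_le_mul (abs_mul_le_mul n2 ha') hdN')
      (abs_mul_le_mul (abs_mul_le_mul (abs_le.2 ⟨by linarith, hb'B⟩)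
        (abs_add_le_add hc' (by norm_num : |(2 : ℝ)| ≤ 2))) heN')).trans_eq ?_
    rw [hR0]; ring
  obtain ⟨q, hq⟩ : ∃ q, q = s * δ := ⟨_, rfl⟩
  have hq0 : 0 < q := by rw [hq]; positivity
  have hqB : q ≤ B := by
    calc q ≤ B * w * δ := by rw [hq]; gcongr
      _ = B * (w * δ) := by ring
      _ ≤ B * 1 := by gcongr
      _ = B := mul_one _
  have hq3 : q ^ 3 ≤ B ^ 3 * δ := by
    calc q ^ 3 ≤ (B * w * δ) ^ 3 := by rw [hq]; gcongr
      _ = B ^ 3 * δ * (w ^ 3 * δ ^ 2) := by ring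
      _ ≤ B ^ 3 * δ * 1 := by gcongr
      _ = _ := mul_one _
  -- Principal part of the step, a kick–drift–kick for the harmonic oscillator with unit frequency
  -- and time step q = sδ in the rescaled variables.
  obtain ⟨v, hv⟩ : ∃ v, v = d - q / 2 * X := ⟨_, rfl⟩
  obtain ⟨X0, hX0⟩ : ∃ X0, X0 = X + q * v := ⟨_, rfl⟩
  obtain ⟨d0, hd0⟩ : ∃ d0, d0 = v - q / 2 * X0 := ⟨_, rfl⟩
  have hvN : |v| ≤ (1 + B) * N := by
    rw [hv]
    have h1 : |q / 2 * X| ≤ B * N := abs_mul_le_mul (by rw [abs_of_pos (by positivity)]; linarith) hXN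
    calc _ ≤ |d| + |q / 2 * X| := abs_sub _ _
      _ ≤ N + B * N := add_le_add hdN h1
      _ = _ := by ring
  have hXX : |X + X0| ≤ (2 + B * (1 + B)) * N := by
    have h1 : |q * v| ≤ B * ((1 + B) * N) := abs_mul_le_mul (by rw [abs_of_pos hq0]; exact hqB) hvN
    have e1 : X + X0 = 2 * X + q * v := by rw [hX0]; ring
    rw [e1]
    refine (abs_add_le_add (abs_mul_le_mul (by norm_num : |(2 : ℝ)| ≤ 2) hXN) h1).trans_eq ?_
    ring
  -- The energy is conserved up to a cubic term in q, and q³ ≤ B³w³δ³ ≤ B³δ exactly under the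
  -- condition w³δ² ≤ 1.
  have henergy : X0 ^ 2 + d0 ^ 2 = X ^ 2 + d ^ 2 + q ^ 3 / 4 * (v * (X + X0)) := by
    rw [hd0, hX0, hv]; ring
  have hprinc : √(X0 ^ 2 + d0 ^ 2) ≤ (1 + K1 * δ) * N := by
    refine Real.sqrt_le_iff.2 ⟨by positivity, ?_⟩
    rw [henergy, ← hNsq]
    have h1 : q ^ 3 / 4 * (v * (X + X0)) ≤ B ^ 3 * δ * ((1 + B) * N * ((2 + B * (1 + B)) * N)) := by
      refine (le_abs_self _).trans (abs_mul_le_mul ?_ (abs_mul_le_mul hvN hXX))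
      rw [abs_of_pos (by positivity)]
      have : 0 < q ^ 3 := by positivity
      linarith
    have h2 : B ^ 3 * δ * ((1 + B) * N * ((2 + B * (1 + B)) * N)) = K1 * δ * N ^ 2 := by
      rw [hK1]; ring
    have h3 : 0 ≤ K1 * δ * N ^ 2 := by positivity
    have h4 : 0 ≤ (K1 * δ) ^ 2 * N ^ 2 := by positivity
    linarith
  obtain ⟨r1, hr1⟩ : ∃ r1, r1 = s * (δ ^ 2 / 2 * ρ + τ₁) := ⟨_, rfl⟩
  obtain ⟨r2, hr2⟩ : ∃ r2, r2 = δ / 2 * (ρ + ρ') - δ / 2 * (w ^ 2 * (b' - b) * e') + τ₂ := ⟨_, rfl⟩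
  have eX' : X' = X0 + r1 := by
    rw [hX', hr1, hX0, hv, hX, hq, he', hρ]
    have : s ^ 3 = s * (w ^ 2 * b) := by rw [← hs2]; ring
    linear_combination (δ ^ 2 / 2 * e) * this
  have ed' : d' = d0 + (-(q / 2 * r1) + r2) := by
    have h1 : d0 - q / 2 * r1 = v - q / 2 * X' := by rw [eX', hd0]; ring
    have h2 : d' = v - q / 2 * X' + r2 := by
      rw [hr2, hv, hX, hX', hq, hρ, hρ']
      linear_combination hd' + (δ / 2 * e) * hs2 + (δ / 2 * e') * hs2
    linarith
  have hr1le : |r1| ≤ B * (R0 + 1) * δ * (N + T) := by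
    have h1 : |r1| ≤ s * (δ ^ 2 / 2 * (R0 * N) + |τ₁|) := by
      rw [hr1, abs_mul, abs_of_pos hs0]
      gcongr
      refine abs_add_le_add (abs_mul_le_mul ?_ hρN) le_rfl
      rw [abs_of_pos (by positivity)]
    calc |r1| ≤ s * (δ ^ 2 / 2 * (R0 * N) + |τ₁|) := h1
      _ ≤ B * w * (δ ^ 2 / 2 * (R0 * N) + |τ₁|) := by gcongr
      _ = B * ((w * δ) * δ / 2 * (R0 * N) + w * |τ₁|) := by ring
      _ ≤ B * (1 * δ / 2 * (R0 * N) + δ * T) := by gcongr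
      _ ≤ B * (R0 + 1) * δ * (N + T) := by
        have : 0 ≤ δ * R0 * N := by positivity
        have : 0 ≤ δ * R0 * T := by positivity
        have : 0 ≤ δ * N := by positivity
        calc _ ≤ B * ((R0 + 1) * δ * (N + T)) := by gcongr; linarith
          _ = _ := by ring
  have hr2le : |r2| ≤ (R0 + 1) * δ * (N + T) + K2 * δ * N1 := by
    have h1 : |δ / 2 * (ρ + ρ')| ≤ δ / 2 * (R0 * N + R0 * N1) :=
      abs_mul_le_mul (by rw [abs_of_pos (by positivity)]) (abs_add_le_add hρN hρN')
    -- The variation of b contributes δ · w²|b' - b||e'|, which is O(δ) because one factor w is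
    -- absorbed by δ in wδ ≤ 1 and the other by w|e'| ≤ B·N1.
    have h2 : |δ / 2 * (w ^ 2 * (b' - b) * e')| ≤ δ / 2 * (B ^ 2 * N1) := by
      refine abs_mul_le_mul (by rw [abs_of_pos (by positivity)]) ?_
      rw [abs_mul, abs_mul, abs_of_pos (by positivity)]
      calc w ^ 2 * |b' - b| * |e'| ≤ w ^ 2 * (B * δ) * |e'| := by gcongr
        _ = B * (w * δ) * (w * |e'|) := by ring
        _ ≤ B * 1 * (B * N1) := by gcongr
        _ = _ := by ring
    have h3 : |r2| ≤ δ / 2 * (R0 * N + R0 * N1) + δ / 2 * (B ^ 2 * N1) + δ * T := by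
      rw [hr2]
      exact abs_add_le_add ((abs_sub _ _).trans (add_le_add h1 h2)) hτ₂
    have h4 : 0 ≤ δ * (R0 * N) := by positivity
    have h5 : 0 ≤ δ * (R0 * N1) := by positivity
    have h6 : 0 ≤ δ * (B ^ 2 * N1) := by positivity
    have h7 : 0 ≤ δ * (R0 * T) := by positivity
    have h8 : 0 ≤ δ * N := by positivity
    rw [hK2]
    linarith
  obtain ⟨M, hM⟩ : ∃ M, M = N + T := ⟨_, rfl⟩
  have hM0 : 0 ≤ M := by rw [hM]; positivity
  have hNM : N ≤ M := by linarith
  rw [← hM] at hr1le hr2le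
  have hN1a : N1 ≤ N + K3 * δ * M + K2 * δ * N1 := by
    have h1 : N1 ≤ √(X0 ^ 2 + d0 ^ 2) + |r1| + |-(q / 2 * r1) + r2| := by
      rw [hN1, eX', ed']
      exact sqrt_add_sq_le _ _ _ _
    have h2 : |-(q / 2 * r1) + r2| ≤ B * |r1| + |r2| := by
      refine abs_add_le_add ?_ le_rfl
      rw [abs_neg]
      exact abs_mul_le_mul (by rw [abs_of_pos (by positivity)]; linarith) le_rfl
    have h3 : K1 * δ * N ≤ K1 * δ * M := by gcongr
    have h4 : (1 + B) * |r1| ≤ (1 + B) * (B * (R0 + 1) * δ * M) := by gcongr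
    rw [hK3]
    linarith
  -- The new velocity enters its own update; K2 δ ≤ 1/2 absorbs that term, and the crude bound is
  -- then inserted once more to restore the leading constant 1.
  have hN1b : N1 ≤ 2 * (1 + K3) * M := by
    have h1 : K2 * δ * N1 ≤ 1 / 2 * N1 := by gcongr
    have h2 : K3 * δ * M ≤ K3 * 1 * M := by gcongr
    linarith
  have hN1c : N1 ≤ N + K4 * δ * M := by
    have h1 : K2 * δ * N1 ≤ K2 * δ * (2 * (1 + K3) * M) := by gcongr
    rw [hK4]
    linarith
  have hN' : √(w ^ 2 * b' * e' ^ 2 + d' ^ 2) ≤ (1 + B ^ 2 * δ) * N1 := by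
    refine Real.sqrt_le_iff.2 ⟨by positivity, ?_⟩
    rw [mul_pow, hN1sq]
    have h1 : b' ≤ b * (1 + B ^ 2 * δ) := by
      have h2 : b' - b ≤ B * δ := (le_abs_self _).trans hbb
      have h3 : B * δ * 1 ≤ B * δ * (B * b) := by gcongr
      linarith
    have h4 : w ^ 2 * b' * e' ^ 2 ≤ (1 + B ^ 2 * δ) * X' ^ 2 := by
      calc _ ≤ w ^ 2 * (b * (1 + B ^ 2 * δ)) * e' ^ 2 := by gcongr
        _ = (1 + B ^ 2 * δ) * ((w ^ 2 * b) * e' ^ 2) := by ring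
        _ = _ := by rw [← hs2, hX']; ring
    have h5 : 0 ≤ B ^ 2 * δ := by positivity
    have h6 := sq_nonneg X'
    have h7 := sq_nonneg d'
    have h8 : (1 + B ^ 2 * δ) * (X' ^ 2 + d' ^ 2) ≤ (1 + B ^ 2 * δ) ^ 2 * (X' ^ 2 + d' ^ 2) := by
      gcongr
      exact le_self_pow₀ (by linarith) two_ne_zero
    have h9 : 0 ≤ B ^ 2 * δ * d' ^ 2 := by positivity
    linarith
  rw [hNeq, ← hM]
  have h1 : N1 ≤ (1 + K4) * M := by
    have : K4 * δ * M ≤ K4 * 1 * M := by gcongr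
    linarith
  have h2 : B ^ 2 * δ * N1 ≤ B ^ 2 * δ * ((1 + K4) * M) := by gcongr
  have h3 : 0 ≤ 2 * K2 * δ * M := by positivity
  linarith

/-! ### The discrete shooting solution and its global error. -/

/-- The size of the boundary error of a scheme on a mesh of size `h`. -/
def Scheme.boundaryErr : Scheme → ℝ → ℝ
  | .one, h => h
  | .two, _ => 0

theorem Scheme.boundaryErr_nonneg (sch : Scheme) {h : ℝ} (hh : 0 ≤ h) : 0 ≤ sch.boundaryErr h := by
  cases sch <;> simp [boundaryErr, hh]

theorem Scheme.boundaryErr_le (sch : Scheme) {h : ℝ} (hh : 0 ≤ h) : sch.boundaryErr h ≤ h := by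
  cases sch <;> simp [boundaryErr, hh]

/-- The relative error of the discrete shooting solution at frequency `w` and mesh size `h`. -/
def Scheme.errScale (sch : Scheme) (w h : ℝ) : ℝ := w ^ 3 * h ^ 2 + sch.boundaryErr h

theorem Scheme.errScale_nonneg (sch : Scheme) {w h : ℝ} (hw : 0 ≤ w) (hh : 0 ≤ h) :
    0 ≤ sch.errScale w h := by
  have := sch.boundaryErr_nonneg hh
  rw [errScale]; positivity

namespace StickyDiffusion

variable {D : StickyDiffusion}

namespace Grid

variable {n : ℕ}

theorem dplus_pos (S : D.Grid n) {i : ℕ} (hi : i ≤ n) : 0 < S.dplus i := sub_pos.2 (S.lt_succ i hi)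

theorem dplus_le_mesh (S : D.Grid n) {i : ℕ} (hi : i ≤ n) : S.dplus i ≤ S.mesh :=
  Finset.le_sup' S.dplus (Finset.mem_range.2 (by omega))

theorem mesh_pos (S : D.Grid n) : 0 < S.mesh := (S.dplus_pos (Nat.zero_le n)).trans_le
  (S.dplus_le_mesh (Nat.zero_le n))

theorem pt_mono (S : D.Grid n) {i j : ℕ} (hij : i ≤ j) (hj : j ≤ n + 1) : S.pt i ≤ S.pt j := by
  induction j, hij using Nat.le_induction with
  | base => exact le_rfl
  | succ j _ ih => exact (ih (by omega)).trans (S.lt_succ j (by omega)).le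

theorem pt_mem (S : D.Grid n) {i : ℕ} (hi : i ≤ n + 1) : S.pt i ∈ Icc D.l D.r := by
  have h1 := S.pt_mono (Nat.zero_le i) hi
  have h2 := S.pt_mono hi le_rfl
  rw [S.pt_zero] at h1
  rw [S.pt_last] at h2
  exact ⟨h1, h2⟩

/-- The discrete shooting solution and its discrete derivative, by the velocity Verlet scheme. -/
def verlet (S : D.Grid n) (sch : Scheme) (lam : ℝ) : ℕ → ℝ × ℝ
  -- The initial velocity is the one for which the first forward difference v + (δ/2) y'' equals (κ
  -- - λ)/(ρβ), as the boundary equation of the chain demands.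
  | 0 => (1, (D.κ (S.pt 0) - lam) * (1 / (D.ρ * S.beta sch) - S.dplus 0 / 2 * D.twoInvVar (S.pt 0))
      / (1 - D.driftRatio (S.pt 0) * S.dplus 0))
  | i + 1 =>
    let y := (verlet S sch lam i).1
    let v := (verlet S sch lam i).2
    let y' := y + S.dplus i * v + S.dplus i ^ 2 / 2 * D.accel lam (S.pt i) y v
    -- The velocity update is implicit in the drift term -2a'v'; division by 1 + a'δ solves it.
    (y', (v + S.dplus i / 2 * (D.accel lam (S.pt i) y v
      + D.twoInvVar (S.pt (i + 1)) * (D.κ (S.pt (i + 1)) - lam) * y'))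
      / (1 + D.driftRatio (S.pt (i + 1)) * S.dplus i))

/-- The discrete shooting solution. -/
def dsY (S : D.Grid n) (sch : Scheme) (lam : ℝ) (i : ℕ) : ℝ := (S.verlet sch lam i).1

/-- The discrete derivative of the discrete shooting solution. -/
def dsV (S : D.Grid n) (sch : Scheme) (lam : ℝ) (i : ℕ) : ℝ := (S.verlet sch lam i).2

theorem dsY_zero (S : D.Grid n) (sch : Scheme) (lam : ℝ) : S.dsY sch lam 0 = 1 := rfl

theorem dsV_zero (S : D.Grid n) (sch : Scheme) (lam : ℝ) : S.dsV sch lam 0 =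
    (D.κ (S.pt 0) - lam) * (1 / (D.ρ * S.beta sch) - S.dplus 0 / 2 * D.twoInvVar (S.pt 0))
      / (1 - D.driftRatio (S.pt 0) * S.dplus 0) := rfl

theorem dsY_succ (S : D.Grid n) (sch : Scheme) (lam : ℝ) (i : ℕ) : S.dsY sch lam (i + 1) =
    S.dsY sch lam i + S.dplus i * S.dsV sch lam i
      + S.dplus i ^ 2 / 2 * D.accel lam (S.pt i) (S.dsY sch lam i) (S.dsV sch lam i) := rfl

theorem dsV_succ' (S : D.Grid n) (sch : Scheme) (lam : ℝ) (i : ℕ) : S.dsV sch lam (i + 1) =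
    (S.dsV sch lam i + S.dplus i / 2 * (D.accel lam (S.pt i) (S.dsY sch lam i) (S.dsV sch lam i)
      + D.twoInvVar (S.pt (i + 1)) * (D.κ (S.pt (i + 1)) - lam) * S.dsY sch lam (i + 1)))
      / (1 + D.driftRatio (S.pt (i + 1)) * S.dplus i) := rfl

theorem continuous_dsY_dsV (S : D.Grid n) (sch : Scheme) (i : ℕ) :
    Continuous (fun lam => S.dsY sch lam i) ∧ Continuous (fun lam => S.dsV sch lam i) := by
  induction i with
  | zero =>
    refine ⟨continuous_const, ?_⟩
    simp only [dsV_zero]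
    fun_prop
  | succ i ih =>
    obtain ⟨h1, h2⟩ := ih
    have h3 : Continuous (fun lam => S.dsY sch lam (i + 1)) := by
      simp only [dsY_succ, accel]
      fun_prop
    refine ⟨h3, ?_⟩
    simp only [dsV_succ', accel]
    fun_prop

/-- The mesh is fine enough for the coefficients of the scheme to have the right signs. -/
def IsFine (S : D.Grid n) (H : D.CoeffBounds) : Prop := 4 * H.B ^ 2 * S.mesh ≤ 1

theorem IsFine.abs_mul_le {S : D.Grid n} {H : D.CoeffBounds} (hS : S.IsFine H) {i j : ℕ}
    (hi : i ≤ n) (hj : j ≤ n + 1) : |D.driftRatio (S.pt j) * S.dplus i| ≤ 1 / 4 := by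
  rw [abs_mul, abs_of_pos (S.dplus_pos hi)]
  have h1 := H.a_le _ (S.pt_mem hj)
  have h2 := S.dplus_le_mesh hi
  have h3 := S.dplus_pos hi
  have h4 := H.one_le
  have h5 : H.B * S.mesh ≤ H.B ^ 2 * S.mesh := by
    have := S.mesh_pos
    gcongr
    exact le_self_pow₀ h4 two_ne_zero
  have h6 : 4 * H.B ^ 2 * S.mesh ≤ 1 := hS
  calc _ ≤ H.B * S.mesh := by gcongr
    _ ≤ _ := by linarith

theorem IsFine.mesh_le {S : D.Grid n} {H : D.CoeffBounds} (hS : S.IsFine H) :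
    S.mesh ≤ 1 / 4 := by
  have h4 := one_le_pow₀ H.one_le (n := 2)
  have := S.mesh_pos
  have h6 : 4 * H.B ^ 2 * S.mesh ≤ 1 := hS
  have : 1 * S.mesh ≤ H.B ^ 2 * S.mesh := by gcongr
  linarith

theorem dsV_succ (S : D.Grid n) {H : D.CoeffBounds} (hS : S.IsFine H) (sch : Scheme) (lam : ℝ)
    {i : ℕ} (hi : i ≤ n) : S.dsV sch lam (i + 1) = S.dsV sch lam i + S.dplus i / 2 *
      (D.accel lam (S.pt i) (S.dsY sch lam i) (S.dsV sch lam i)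
      + D.accel lam (S.pt (i + 1)) (S.dsY sch lam (i + 1)) (S.dsV sch lam (i + 1))) := by
  have h1 := abs_le.1 (hS.abs_mul_le hi (j := i + 1) (by omega))
  have h2 : 1 + D.driftRatio (S.pt (i + 1)) * S.dplus i ≠ 0 := by
    intro h0; linarith [h1.1]
  have h3 := S.dsV_succ' sch lam i
  rw [eq_div_iff h2] at h3
  simp only [accel] at h3 ⊢
  linarith

/-- The quantity `1 / β`. -/
theorem one_div_beta (S : D.Grid n) (sch : Scheme) : 1 / S.beta sch = match sch with
    | .one => 1
    | .two => 1 + (D.ρ * D.twoInvVar (S.pt 0) / 2 - D.driftRatio (S.pt 0)) * S.dplus 0 := by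
  cases sch with
  | one => simp [beta]
  | two =>
    simp only [beta, one_div_one_div, twoInvVar, driftRatio]
    ring

theorem IsFine.beta_bounds {S : D.Grid n} {H : D.CoeffBounds} (hS : S.IsFine H) (sch : Scheme) :
    1 / 2 ≤ S.beta sch ∧ S.beta sch ≤ 2 := by
  cases sch with
  | one => constructor <;> norm_num [beta]
  | two =>
    have e := S.one_div_beta .two
    simp only at e
    have h0 := S.pt_mem (i := 0) (by omega)
    have hB := H.one_le
    have hB2 := H.B_pos
    have h1 : |(D.ρ * D.twoInvVar (S.pt 0) / 2 - D.driftRatio (S.pt 0)) * S.dplus 0|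
        ≤ 1 / 2 := by
      have h2 : |D.ρ * D.twoInvVar (S.pt 0) / 2 - D.driftRatio (S.pt 0)| ≤ 2 * H.B ^ 2 := by
        refine (abs_sub _ _).trans ?_
        have h3 : |D.ρ * D.twoInvVar (S.pt 0) / 2| ≤ H.B * H.B := by
          rw [abs_div, abs_two]
          have : |D.ρ * D.twoInvVar (S.pt 0)| ≤ H.B * H.B :=
            abs_mul_le_mul (by rw [abs_of_pos D.ρ_pos]; exact H.rho_le) (H.b_le _ h0)
          linarith [abs_nonneg (D.ρ * D.twoInvVar (S.pt 0))]
        have h4 : H.B ≤ H.B * H.B := le_mul_of_one_le_left hB2.le hB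
        have := H.a_le _ h0
        linarith
      have h3 : |S.dplus 0| ≤ S.mesh := by
        rw [abs_of_pos (S.dplus_pos (Nat.zero_le n))]; exact S.dplus_le_mesh (Nat.zero_le n)
      have h6 : 4 * H.B ^ 2 * S.mesh ≤ 1 := hS
      exact (abs_mul_le_mul h2 h3).trans (by linarith)
    rw [abs_le] at h1
    have hb : S.beta .two
        = 1 / (1 + (D.ρ * D.twoInvVar (S.pt 0) / 2 - D.driftRatio (S.pt 0)) * S.dplus 0) := by
      rw [← e, one_div_one_div]
    rw [hb]
    constructor
    · rw [div_le_div_iff₀ (by norm_num) (by linarith)]; linarith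
    · rw [div_le_iff₀ (by linarith)]; linarith

/-- For Scheme 2, 1/(ρβ) - δb/2 = (1 - aδ)/ρ, so the initial velocity is exactly the slope of the
shooting solution. With β = 1 it is off by a relative error of order δ. -/
theorem IsFine.abs_dsV_zero_sub_le {S : D.Grid n} {H : D.CoeffBounds} (hS : S.IsFine H)
    (sch : Scheme) {lam : ℝ} (hlam : -1 ≤ lam) :
    |S.dsV sch lam 0 - (D.κ D.l - lam) / D.ρ|
      ≤ 4 * (H.B + 2) * H.B ^ 2 * freq lam ^ 2 * sch.boundaryErr S.mesh := by
  have h1 := abs_le.1 (hS.abs_mul_le (Nat.zero_le n) (j := 0) (by omega))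
  have h2 : 1 - D.driftRatio (S.pt 0) * S.dplus 0 ≠ 0 := by
    intro h0; linarith [h1.2]
  have hρ := D.ρ_pos.ne'
  have hb : (1 : ℝ) / (D.ρ * S.beta sch) = 1 / D.ρ * (1 / S.beta sch) := by
    rw [one_div_mul_one_div]
  rw [dsV_zero, hb, one_div_beta, S.pt_zero]
  rw [S.pt_zero] at h1 h2
  cases sch with
  | two =>
    have e : (D.κ D.l - lam) * (1 / D.ρ * (1 + (D.ρ * D.twoInvVar D.l / 2 - D.driftRatio D.l)
        * S.dplus 0) - S.dplus 0 / 2 * D.twoInvVar D.l) / (1 - D.driftRatio D.l * S.dplus 0)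
        - (D.κ D.l - lam) / D.ρ = 0 := by
      field_simp
      ring
    simp only
    rw [e]
    simp [Scheme.boundaryErr]
  | one =>
    have e : (D.κ D.l - lam) * (1 / D.ρ * 1 - S.dplus 0 / 2 * D.twoInvVar D.l)
        / (1 - D.driftRatio D.l * S.dplus 0) - (D.κ D.l - lam) / D.ρ
        = (D.κ D.l - lam) * ((1 / D.ρ * D.driftRatio D.l - D.twoInvVar D.l / 2) * S.dplus 0)
          * (1 / (1 - D.driftRatio D.l * S.dplus 0)) := by
      obtain ⟨q, hq⟩ : ∃ q, q = 1 - D.driftRatio D.l * S.dplus 0 := ⟨_, rfl⟩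
      rw [← hq] at h2 ⊢
      field_simp
      rw [hq]
      ring
    simp only [Scheme.boundaryErr]
    rw [e]
    have hB := H.one_le
    have hB2 := H.B_pos
    have g1 := H.abs_killing_sub_le hlam (left_mem (D := D))
    have g2 : |S.dplus 0| ≤ S.mesh := by
      rw [abs_of_pos (S.dplus_pos (Nat.zero_le n))]; exact S.dplus_le_mesh (Nat.zero_le n)
    have g3 : |1 / (1 - D.driftRatio D.l * S.dplus 0)| ≤ 2 := by
      rw [abs_of_pos (by apply one_div_pos.2; linarith), div_le_iff₀ (by linarith)]
      linarith
    have g4 : |1 / D.ρ * D.driftRatio D.l - D.twoInvVar D.l / 2| ≤ 2 * H.B ^ 2 := by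
      refine (abs_sub _ _).trans ?_
      have h3 : |1 / D.ρ * D.driftRatio D.l| ≤ H.B * H.B :=
        abs_mul_le_mul (by rw [abs_of_pos (one_div_pos.2 D.ρ_pos)]; exact H.rho_ge)
          (H.a_le _ left_mem)
      have h5 : |D.twoInvVar D.l / 2| ≤ H.B := by
        rw [abs_div, abs_two]
        have := H.b_le D.l left_mem
        linarith
      have h4 : H.B ≤ H.B * H.B := le_mul_of_one_le_left hB2.le hB
      linarith
    refine (abs_mul_le_mul (abs_mul_le_mul g1 (abs_mul_le_mul g4 g2)) g3).trans_eq ?_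
    ring

/-- The error of the discrete shooting solution. -/
theorem exists_error_bound (H : D.CoeffBounds) : ∃ C : ℝ, 1 ≤ C ∧ ∀ (n : ℕ) (S : D.Grid n),
    C * S.mesh ≤ 1 → ∀ (sch : Scheme) (lam : ℝ), -1 ≤ lam → freq lam ^ 3 * S.mesh ^ 2 ≤ 1 →
    ∀ i ≤ n + 1,
      |S.dsY sch lam i - H.sol lam (S.pt i)| ≤ C * freq lam * sch.errScale (freq lam) S.mesh ∧
      |S.dsV sch lam i - H.dsol lam (S.pt i)|
        ≤ C * freq lam ^ 2 * sch.errScale (freq lam) S.mesh := by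
  obtain ⟨C, hC1, hC⟩ := H.exists_local_error
  obtain ⟨K, hK1, hK⟩ := exists_verlet_stability H.one_le
  have hB := H.one_le
  have hB0 := H.B_pos
  obtain ⟨A, hA⟩ : ∃ A, A = 4 * (H.B + 2) * H.B ^ 2 + C := ⟨_, rfl⟩
  have hA1 : 1 ≤ A := by rw [hA]; have : 0 ≤ 4 * (H.B + 2) * H.B ^ 2 := by positivity
                         linarith
  obtain ⟨E, hE⟩ : ∃ E, E = Real.exp (K * H.B) := ⟨_, rfl⟩
  have hE1 : 1 ≤ E := by rw [hE]; exact Real.one_le_exp (by positivity)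
  have hEA : 1 ≤ H.B * (E * A) :=
    one_le_mul_of_one_le_of_one_le hB (one_le_mul_of_one_le_of_one_le hE1 hA1)
  refine ⟨K + 4 * H.B ^ 2 + H.B * (E * A), by nlinarith [sq_nonneg H.B],
    fun n S hSm sch lam hlam hwh => ?_⟩
  have hm := S.mesh_pos
  have hKm : K * S.mesh ≤ 1 := by
    refine le_trans ?_ hSm
    gcongr
    nlinarith [sq_nonneg H.B]
  have hS : S.IsFine H := by
    refine le_trans ?_ hSm
    gcongr
    linarith
  have hw := one_le_freq hlam
  have hw2 := freq_sq hlam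
  have hsol := H.isShooting lam
  obtain ⟨w, hwdef⟩ : ∃ w, w = freq lam := ⟨_, rfl⟩
  have hinit := hS.abs_dsV_zero_sub_le sch hlam
  have hloc := hC lam hlam _ _ hsol
  rw [← hwdef] at hwh hw hw2 hinit hloc ⊢
  obtain ⟨h, hh⟩ : ∃ h, h = S.mesh := ⟨_, rfl⟩
  rw [← hh] at hwh hm hKm hinit ⊢
  -- The local errors, measured in the energy norm where positions carry a factor w, are at most δT
  -- with T = C w⁵h². Adding T to the norm turns the recursion into a homogeneous one.
  obtain ⟨T, hT⟩ : ∃ T, T = C * w ^ 5 * h ^ 2 := ⟨_, rfl⟩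
  have hT0 : 0 ≤ T := by rw [hT]; positivity
  let e : ℕ → ℝ := fun i => S.dsY sch lam i - H.sol lam (S.pt i)
  let d : ℕ → ℝ := fun i => S.dsV sch lam i - H.dsol lam (S.pt i)
  let N : ℕ → ℝ := fun i => √(w ^ 2 * D.twoInvVar (S.pt i) * e i ^ 2 + d i ^ 2) + T
  have hstep : ∀ i ≤ n, N (i + 1) ≤ (1 + K * (S.pt (i + 1) - S.pt i)) * N i := by
    intro i hi
    have hx := S.pt_mem (i := i) (by omega)
    have hz := S.pt_mem (i := i + 1) (by omega)
    have hδ := S.dplus_pos hi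
    have hδh : S.dplus i ≤ h := hh ▸ S.dplus_le_mesh hi
    obtain ⟨hl1, hl2⟩ := hloc _ _ hx hz (S.lt_succ i hi).le
    have hd : S.pt (i + 1) - S.pt i = S.dplus i := rfl
    rw [hd] at hl1 hl2 ⊢
    have hbb : |D.twoInvVar (S.pt (i + 1)) - D.twoInvVar (S.pt i)| ≤ H.B * S.dplus i := by
      have hsub : Icc (S.pt i) (S.pt (i + 1)) ⊆ Icc D.l D.r := Icc_subset_Icc hx.1 hz.2
      exact abs_sub_le_of_deriv_bound (fun t ht => (H.hb t (hsub ht)).mono hsub)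
        (fun t ht => H.b1_le t (hsub ht)) _ (right_mem_Icc.2 (S.lt_succ i hi).le)
    have hacc : ∀ x Y V y u, D.accel lam x Y V - D.accel lam x y u
        = -2 * D.driftRatio x * (V - u)
          + D.twoInvVar x * (D.κ x + 2 - w ^ 2) * (Y - y) := by
      intro x Y V y u
      rw [hw2]; simp only [accel]; ring
    refine hK w (S.dplus i) T (D.driftRatio (S.pt i)) (D.twoInvVar (S.pt i)) (D.κ (S.pt i))
      (D.driftRatio (S.pt (i + 1))) (D.twoInvVar (S.pt (i + 1))) (D.κ (S.pt (i + 1)))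
      (e i) (d i) (e (i + 1)) (d (i + 1))
      (-(H.sol lam (S.pt (i + 1)) - H.sol lam (S.pt i) - S.dplus i * H.dsol lam (S.pt i)
        - S.dplus i ^ 2 / 2 * D.accel lam (S.pt i) (H.sol lam (S.pt i)) (H.dsol lam (S.pt i))))
      (-(H.dsol lam (S.pt (i + 1)) - H.dsol lam (S.pt i) - S.dplus i / 2 *
        (D.accel lam (S.pt i) (H.sol lam (S.pt i)) (H.dsol lam (S.pt i))
        + D.accel lam (S.pt (i + 1)) (H.sol lam (S.pt (i + 1))) (H.dsol lam (S.pt (i + 1))))))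
      hw hδ ?_ ?_ (H.a_le _ hx) (H.a_le _ hz) (H.c_le _ hx) (H.c_le _ hz) (H.b_ge _ hx)
      ((le_abs_self _).trans (H.b_le _ hx)) ((le_abs_self _).trans (H.b_le _ hz)) (H.b_pos hz)
      hbb ?_ ?_ ?_ ?_
    · refine le_trans ?_ hwh
      gcongr
    · refine le_trans ?_ hKm
      gcongr
    · rw [abs_neg]
      calc _ ≤ w * (C * w ^ 4 * S.dplus i ^ 3) := by gcongr
        _ = S.dplus i * (C * w ^ 5 * S.dplus i ^ 2) := by ring
        _ ≤ _ := by rw [hT]; gcongr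
    · rw [abs_neg]
      calc _ ≤ C * w ^ 5 * S.dplus i ^ 3 := hl2
        _ = S.dplus i * (C * w ^ 5 * S.dplus i ^ 2) := by ring
        _ ≤ _ := by rw [hT]; gcongr
    · simp only [e, d]
      rw [← hacc, dsY_succ]
      ring
    · simp only [e, d]
      rw [← hacc, ← hacc]
      linear_combination S.dsV_succ hS sch lam hi
  -- Initially only the velocity is wrong, by O(w²) times the boundary error, and T = C w²(w³h²), so
  -- both fit into w² times the error scale. Position errors gain a factor 1/w at the end.
  have hN0 : N 0 ≤ A * w ^ 2 * sch.errScale w h := by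
    have he0 : e 0 = 0 := by simp only [e]; rw [S.pt_zero, hsol.left, dsY_zero, sub_self]
    have hd0 : d 0 = S.dsV sch lam 0 - (D.κ D.l - lam) / D.ρ := by
      simp only [d]; rw [S.pt_zero, hsol.left_deriv]
    have h1 : N 0 = |d 0| + T := by
      simp only [N]
      rw [he0, zero_pow two_ne_zero, mul_zero, zero_add, Real.sqrt_sq_eq_abs]
    rw [h1, hd0, hT, hA, Scheme.errScale]
    have h2 : 0 ≤ 4 * (H.B + 2) * H.B ^ 2 * w ^ 2 * (w ^ 3 * h ^ 2) := by positivity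
    have h3 : 0 ≤ C * w ^ 2 * sch.boundaryErr h := by
      have := sch.boundaryErr_nonneg hm.le; positivity
    linarith
  have hN0' : 0 ≤ N 0 := add_nonneg (Real.sqrt_nonneg _) hT0
  have hgr := discrete_gronwall_le (by linarith : 0 ≤ K) hN0' (t := S.pt)
    (fun i hi => (S.lt_succ i hi).le) hstep
  intro i hi
  have hx := S.pt_mem hi
  have herr := sch.errScale_nonneg (w := w) (by linarith) hm.le
  have hNi : √(w ^ 2 * D.twoInvVar (S.pt i) * e i ^ 2 + d i ^ 2)
      ≤ E * A * (w ^ 2 * sch.errScale w h) := by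
    have h1 : √(w ^ 2 * D.twoInvVar (S.pt i) * e i ^ 2 + d i ^ 2) ≤ N i := by
      simp only [N]; linarith
    refine h1.trans ((hgr i hi).trans ?_)
    have h2 : Real.exp (K * (S.pt i - S.pt 0)) ≤ E := by
      rw [hE, S.pt_zero]
      have := H.len_le
      refine Real.exp_le_exp.2 ?_
      gcongr
      linarith [hx.2]
    calc _ ≤ E * (A * w ^ 2 * sch.errScale w h) := by gcongr
      _ = _ := by ring
  have hb0 := H.b_pos hx
  have hd : |d i| ≤ √(w ^ 2 * D.twoInvVar (S.pt i) * e i ^ 2 + d i ^ 2) :=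
    Real.abs_le_sqrt (by
      have : 0 ≤ w ^ 2 * D.twoInvVar (S.pt i) * e i ^ 2 := by positivity
      linarith)
  have he : w * |e i| ≤ H.B * √(w ^ 2 * D.twoInvVar (S.pt i) * e i ^ 2 + d i ^ 2) := by
    have h1 : 0 ≤ w ^ 2 * D.twoInvVar (S.pt i) * e i ^ 2 + d i ^ 2 := by positivity
    refine le_of_sq_le_sq ?_ (by positivity)
    rw [mul_pow, mul_pow, Real.sq_sqrt h1, sq_abs]
    have h2 : w ^ 2 * e i ^ 2 * 1 ≤ w ^ 2 * e i ^ 2 * (H.B * D.twoInvVar (S.pt i)) := by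
      gcongr; exact H.b_ge _ hx
    have h3 : 0 ≤ w ^ 2 * e i ^ 2 * (H.B * D.twoInvVar (S.pt i)) := by positivity
    have h4 : 1 * (w ^ 2 * e i ^ 2 * (H.B * D.twoInvVar (S.pt i)))
        ≤ H.B * (w ^ 2 * e i ^ 2 * (H.B * D.twoInvVar (S.pt i))) := by gcongr
    have h5 : 0 ≤ H.B ^ 2 * d i ^ 2 := by positivity
    linarith
  have hbig : H.B * (E * A) ≤ K + 4 * H.B ^ 2 + H.B * (E * A) := by
    have : 0 ≤ 4 * H.B ^ 2 := by positivity
    linarith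
  constructor
  · have h1 : w * |e i| ≤ w * (H.B * (E * A) * w * sch.errScale w h) := by
      calc _ ≤ H.B * (E * A * (w ^ 2 * sch.errScale w h)) := he.trans (by gcongr)
        _ = _ := by ring
    refine (le_of_mul_le_mul_left h1 (by linarith)).trans ?_
    gcongr
  · refine (hd.trans hNi).trans ?_
    have h1 : E * A ≤ K + 4 * H.B ^ 2 + H.B * (E * A) := by
      refine le_trans ?_ hbig
      exact le_mul_of_one_le_left (by positivity) hB
    calc _ = E * A * w ^ 2 * sch.errScale w h := by ring
      _ ≤ _ := by gcongr

end Grid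
end StickyDiffusion

/-! ### Discrete eigenvectors, flux form and discrete Wronskian. -/

namespace StickyDiffusion.Grid

variable {D : StickyDiffusion} {n : ℕ} {S : D.Grid n} {H : D.CoeffBounds}

theorem IsFine.one_sub_pos (hS : S.IsFine H) {i j : ℕ} (hi : i ≤ n) (hj : j ≤ n + 1) :
    0 < 1 - D.driftRatio (S.pt j) * S.dplus i := by
  have := abs_le.1 (hS.abs_mul_le hi hj)
  linarith [this.2]

theorem IsFine.one_add_pos (hS : S.IsFine H) {i j : ℕ} (hi : i ≤ n) (hj : j ≤ n + 1) :
    0 < 1 + D.driftRatio (S.pt j) * S.dplus i := by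
  have := abs_le.1 (hS.abs_mul_le hi hj)
  linarith [this.1]

theorem IsFine.beta_pos (hS : S.IsFine H) (sch : Scheme) : 0 < S.beta sch := by
  linarith [(hS.beta_bounds sch).1]

/-- The node equation multiplied by 2δx/σ² = b δx: a relation between the two adjacent difference
quotients. -/
theorem generator_succ_eq_iff (H : D.CoeffBounds) (S : D.Grid n) (sch : Scheme) (nu : ℝ)
    (g : ℕ → ℝ) {j : ℕ} (hj : j + 1 ≤ n) :
    S.generator sch g (j + 1) = -nu * g (j + 1) ↔
      S.gradPlus g (j + 1) * (1 + D.driftRatio (S.pt (j + 1)) * S.dplus j)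
        = S.gradPlus g j * (1 - D.driftRatio (S.pt (j + 1)) * S.dplus (j + 1))
          + S.davg (j + 1) * (D.twoInvVar (S.pt (j + 1)) * (D.κ (S.pt (j + 1)) - nu)
            * g (j + 1)) := by
  have hs : D.σ (S.pt (j + 1)) ≠ 0 := fun h0 =>
    (H.var_pos _ (S.pt_mem (i := j + 1) (by omega))).ne' (by simp [h0])
  have e1 : S.dminus (j + 1) = S.dplus j := rfl
  have e2 : S.gradMinus g (j + 1) = S.gradPlus g j := rfl
  have h1 := S.dplus_pos (i := j) (by omega)
  have h2 := S.dplus_pos hj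
  have h3 : S.davg (j + 1) ≠ 0 := by rw [davg, e1]; positivity
  have h4 : 2 * S.davg (j + 1) = S.dplus (j + 1) + S.dplus j := by rw [davg, e1]; ring
  rw [generator, if_neg (Nat.succ_ne_zero j), grad, lap, e1, e2, driftRatio, twoInvVar]
  obtain ⟨X, hX⟩ : ∃ X, X = S.davg (j + 1) := ⟨_, rfl⟩
  rw [← hX] at h3 h4 ⊢
  constructor
  · intro h
    field_simp at h ⊢
    linear_combination h
  · intro h
    field_simp at h ⊢
    linear_combination h

theorem generator_zero_eq_iff (hS : S.IsFine H) (sch : Scheme) (nu : ℝ) (g : ℕ → ℝ) :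
    S.generator sch g 0 = -nu * g 0 ↔
      S.gradPlus g 0 = 1 / (D.ρ * S.beta sch) * ((D.κ (S.pt 0) - nu) * g 0) := by
  have h1 := (hS.beta_pos sch).ne'
  have h2 := D.ρ_pos.ne'
  rw [generator, if_pos rfl]
  constructor
  · intro h
    field_simp
    linear_combination h
  · intro h
    rw [h]
    field_simp
    ring

theorem gradPlus_dsY (S : D.Grid n) (sch : Scheme) (lam : ℝ) {i : ℕ} (hi : i ≤ n) :
    S.gradPlus (S.dsY sch lam) i = S.dsV sch lam i
      + S.dplus i / 2 * D.accel lam (S.pt i) (S.dsY sch lam i) (S.dsV sch lam i) := by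
  have h := (S.dplus_pos hi).ne'
  rw [gradPlus, dsY_succ]
  field_simp
  ring

theorem IsFine.gradPlus_dsY' (hS : S.IsFine H) (sch : Scheme) (lam : ℝ) {i : ℕ} (hi : i ≤ n) :
    S.gradPlus (S.dsY sch lam) i = S.dsV sch lam (i + 1) - S.dplus i / 2 *
      D.accel lam (S.pt (i + 1)) (S.dsY sch lam (i + 1)) (S.dsV sch lam (i + 1)) := by
  rw [S.gradPlus_dsY sch lam hi]
  linear_combination -S.dsV_succ hS sch lam hi

theorem add_mul_gradPlus (S : D.Grid n) (g : ℕ → ℝ) {i : ℕ} (hi : i ≤ n) :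
    g (i + 1) = g i + S.dplus i * S.gradPlus g i := by
  have h := (S.dplus_pos hi).ne'
  rw [gradPlus]
  field_simp
  ring

/-- Around a node with velocity V and acceleration A, the adjacent difference quotients are V -
(δ⁻/2)A and V + (δ⁺/2)A. Eliminating V between them leaves precisely the equation of the chain at
that node; this identifies the chain with the Verlet scheme. -/
theorem IsFine.gradPlus_dsY_succ (hS : S.IsFine H) (sch : Scheme) (lam : ℝ) {j : ℕ}
    (hj : j + 1 ≤ n) :
    S.gradPlus (S.dsY sch lam) (j + 1) * (1 + D.driftRatio (S.pt (j + 1)) * S.dplus j)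
        = S.gradPlus (S.dsY sch lam) j * (1 - D.driftRatio (S.pt (j + 1)) * S.dplus (j + 1))
          + S.davg (j + 1) * (D.twoInvVar (S.pt (j + 1)) * (D.κ (S.pt (j + 1)) - lam)
            * S.dsY sch lam (j + 1)) := by
  rw [S.gradPlus_dsY sch lam hj, hS.gradPlus_dsY' sch lam (i := j) (by omega), davg,
    show S.dminus (j + 1) = S.dplus j from rfl]
  simp only [accel]
  ring

theorem IsFine.gradPlus_dsY_zero (hS : S.IsFine H) (sch : Scheme) (lam : ℝ) :
    S.gradPlus (S.dsY sch lam) 0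
      = 1 / (D.ρ * S.beta sch) * ((D.κ (S.pt 0) - lam) * S.dsY sch lam 0) := by
  have h := (hS.one_sub_pos (i := 0) (j := 0) (by omega) (by omega)).ne'
  have h3 := S.dsV_zero sch lam
  rw [eq_div_iff h] at h3
  rw [S.gradPlus_dsY sch lam (Nat.zero_le n), dsY_zero]
  simp only [accel]
  linear_combination h3

theorem IsFine.eq_mul_dsY (hS : S.IsFine H) {sch : Scheme} {nu : ℝ} {g : ℕ → ℝ}
    (hg : S.IsEigenvector sch nu g) : ∀ i ≤ n + 1, g i = g 0 * S.dsY sch nu i := by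
  have key : ∀ i ≤ n, g i = g 0 * S.dsY sch nu i ∧
      S.gradPlus g i = g 0 * S.gradPlus (S.dsY sch nu) i := by
    intro i
    induction i with
    | zero =>
      intro _
      refine ⟨by rw [dsY_zero, mul_one], ?_⟩
      rw [(generator_zero_eq_iff hS sch nu g).1 (hg.eqn 0 (Nat.zero_le n)),
        hS.gradPlus_dsY_zero, dsY_zero]
      ring
    | succ i ih =>
      intro hi
      obtain ⟨h1, h2⟩ := ih (by omega)
      have h3 : g (i + 1) = g 0 * S.dsY sch nu (i + 1) := by
        rw [S.add_mul_gradPlus g (by omega : i ≤ n),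
          S.add_mul_gradPlus (S.dsY sch nu) (by omega : i ≤ n), h1, h2]
        ring
      refine ⟨h3, ?_⟩
      have h4 := (generator_succ_eq_iff H S sch nu g hi).1 (hg.eqn _ hi)
      have h5 := hS.gradPlus_dsY_succ sch nu hi
      have h6 := (hS.one_add_pos (i := i) (j := i + 1) (by omega) (by omega)).ne'
      refine mul_right_cancel₀ h6 ?_
      rw [h4, h2, h3]
      linear_combination (-g 0) * h5
  intro i hi
  -- The eigenvector equations stop at n, but the values at n and the difference quotient on the
  -- last edge already fix the value at n + 1.
  rcases Nat.lt_or_ge n i with h | h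
  · have : i = n + 1 := by omega
    subst this
    rw [S.add_mul_gradPlus g le_rfl, S.add_mul_gradPlus (S.dsY sch nu) le_rfl, (key n le_rfl).1,
      (key n le_rfl).2]
    ring
  · exact (key i h).1

theorem IsFine.isEigenvector_dsY (hS : S.IsFine H) {sch : Scheme} {nu : ℝ}
    (h : S.dsY sch nu (n + 1) = 0) : S.IsEigenvector sch nu (S.dsY sch nu) := by
  refine ⟨fun i hi => ?_, h, 0, Nat.zero_le n, by rw [dsY_zero]; norm_num⟩
  cases i with
  | zero => exact (generator_zero_eq_iff hS sch nu _).2 (hS.gradPlus_dsY_zero sch nu)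
  | succ i => exact (generator_succ_eq_iff H S sch nu _ hi).2 (hS.gradPlus_dsY_succ sch nu hi)

theorem IsFine.dsY_last_eq_zero (hS : S.IsFine H) {sch : Scheme} {nu : ℝ} {g : ℕ → ℝ}
    (hg : S.IsEigenvector sch nu g) : g 0 ≠ 0 ∧ S.dsY sch nu (n + 1) = 0 := by
  have h1 := hS.eq_mul_dsY hg
  have h2 : g 0 ≠ 0 := by
    intro h0
    obtain ⟨i, hi, hgi⟩ := hg.nonzero
    exact hgi (by rw [h1 i (by omega), h0, zero_mul])
  have h3 := h1 (n + 1) le_rfl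
  rw [hg.right] at h3
  exact ⟨h2, (mul_eq_zero.1 h3.symm).resolve_left h2⟩

theorem IsFine.mem_eigenvalues_iff (hS : S.IsFine H) {sch : Scheme} {nu : ℝ} :
    nu ∈ S.eigenvalues sch ↔ S.dsY sch nu (n + 1) = 0 :=
  ⟨fun ⟨_, h⟩ => (hS.dsY_last_eq_zero h).2, fun h => ⟨_, hS.isEigenvector_dsY h⟩⟩

/-- The conductance of the edge between `x_i` and `x_{i+1}`. -/
def edge (S : D.Grid n) (sch : Scheme) : ℕ → ℝ
  | 0 => S.speedMassZero sch * D.ρ * S.beta sch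
  | i + 1 => edge S sch i * (1 + D.driftRatio (S.pt (i + 1)) * S.dplus i)
      / (1 - D.driftRatio (S.pt (i + 1)) * S.dplus (i + 1))

theorem speedMassZero_pos (S : D.Grid n) (sch : Scheme) : 0 < S.speedMassZero sch :=
  mul_pos (one_div_pos.2 D.ρ_pos) (Real.exp_pos _)

theorem IsFine.edge_pos (hS : S.IsFine H) (sch : Scheme) {i : ℕ} (hi : i ≤ n) :
    0 < S.edge sch i := by
  induction i with
  | zero => exact mul_pos (mul_pos (S.speedMassZero_pos sch) D.ρ_pos) (hS.beta_pos sch)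
  | succ i ih =>
    exact div_pos (mul_pos (ih (by omega)) (hS.one_add_pos (by omega) (by omega)))
      (hS.one_sub_pos hi (by omega))

theorem IsFine.edge_succ (hS : S.IsFine H) (sch : Scheme) {i : ℕ} (hi : i + 1 ≤ n) :
    S.edge sch (i + 1) * (1 - D.driftRatio (S.pt (i + 1)) * S.dplus (i + 1))
      = S.edge sch i * (1 + D.driftRatio (S.pt (i + 1)) * S.dplus i) := by
  rw [edge, div_mul_cancel₀ _ (hS.one_sub_pos hi (by omega)).ne']

/-- Taking σ² out of every factor of the product leaves the ratios (1 + aδ⁻)/(1 - aδ⁺) that generate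
the edge conductances, and one factor 2/σ² at the last node. -/
theorem IsFine.speedDensity_succ (hS : S.IsFine H) (sch : Scheme) {i : ℕ} (hi : i + 1 ≤ n) :
    S.speedDensity sch (i + 1) = S.edge sch i * D.twoInvVar (S.pt (i + 1))
      / (1 - D.driftRatio (S.pt (i + 1)) * S.dplus (i + 1)) := by
  have hden : ∀ j, j ≤ n → -D.μ (S.pt j) * S.dplus j + D.σ (S.pt j) ^ 2
      = D.σ (S.pt j) ^ 2 * (1 - D.driftRatio (S.pt j) * S.dplus j) := by
    intro j hj
    have hs : D.σ (S.pt j) ≠ 0 := fun h0 =>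
      (H.var_pos _ (S.pt_mem (i := j) (by omega))).ne' (by simp [h0])
    rw [driftRatio]
    field_simp
    ring
  induction i with
  | zero =>
    have hs : D.σ (S.pt 1) ≠ 0 := fun h0 =>
      (H.var_pos _ (S.pt_mem (i := 1) (by omega))).ne' (by simp [h0])
    have h1 := (hS.one_sub_pos (i := 1) (j := 1) hi (by omega)).ne'
    rw [speedDensity, hden 1 hi, edge, twoInvVar]
    simp only [zero_add, Finset.Ico_self, Finset.prod_empty, mul_one]
    obtain ⟨q, hq⟩ : ∃ q, q = 1 - D.driftRatio (S.pt 1) * S.dplus 1 := ⟨_, rfl⟩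
    rw [← hq] at h1 ⊢
    field_simp
  | succ i ih =>
    have ih' := ih (by omega)
    have hs : D.σ (S.pt (i + 1)) ≠ 0 := fun h0 =>
      (H.var_pos _ (S.pt_mem (i := i + 1) (by omega))).ne' (by simp [h0])
    have hs' : D.σ (S.pt (i + 1 + 1)) ≠ 0 := fun h0 =>
      (H.var_pos _ (S.pt_mem (i := i + 1 + 1) (by omega))).ne' (by simp [h0])
    have hnum : D.μ (S.pt (i + 1)) * S.dminus (i + 1) + D.σ (S.pt (i + 1)) ^ 2
        = D.σ (S.pt (i + 1)) ^ 2 * (1 + D.driftRatio (S.pt (i + 1)) * S.dplus i) := by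
      rw [driftRatio, show S.dminus (i + 1) = S.dplus i from rfl]
      field_simp
      ring
    rw [speedDensity] at ih' ⊢
    rw [Finset.prod_Ico_succ_top (by omega), ← mul_assoc, ih', hnum, hden (i + 1 + 1) hi]
    have h1 := (hS.one_sub_pos (i := i + 1) (j := i + 1) (by omega) (by omega)).ne'
    have h2 := (hS.one_sub_pos (i := i + 1 + 1) (j := i + 1 + 1) hi (by omega)).ne'
    rw [show S.edge sch (i + 1) = S.edge sch i * (1 + D.driftRatio (S.pt (i + 1)) * S.dplus i)
      / (1 - D.driftRatio (S.pt (i + 1)) * S.dplus (i + 1)) from rfl, twoInvVar, twoInvVar]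
    obtain ⟨q, hq⟩ : ∃ q, q = 1 - D.driftRatio (S.pt (i + 1)) * S.dplus (i + 1) := ⟨_, rfl⟩
    obtain ⟨q', hq'⟩ : ∃ q', q' = 1 - D.driftRatio (S.pt (i + 1 + 1)) * S.dplus (i + 1 + 1) :=
      ⟨_, rfl⟩
    rw [← hq] at h1 ⊢
    rw [← hq'] at h2 ⊢
    field_simp

theorem IsFine.speedMass_succ (hS : S.IsFine H) (sch : Scheme) {i : ℕ} (hi : i + 1 ≤ n) :
    S.speedMass sch (i + 1) = S.edge sch i * D.twoInvVar (S.pt (i + 1))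
      / (1 - D.driftRatio (S.pt (i + 1)) * S.dplus (i + 1)) * S.davg (i + 1) := by
  rw [speedMass, if_neg (Nat.succ_ne_zero i), hS.speedDensity_succ sch hi]

theorem speedMass_zero (S : D.Grid n) (sch : Scheme) :
    S.speedMass sch 0 = S.speedMassZero sch := by
  rw [speedMass, if_pos rfl]

/-- The mass of an interior grid point, split between the two adjacent edges. -/
theorem IsFine.speedMass_succ_eq (hS : S.IsFine H) (sch : Scheme) {i : ℕ} (hi : i + 1 ≤ n) :
    S.speedMass sch (i + 1) = (S.edge sch (i + 1) * S.dplus (i + 1) + S.edge sch i * S.dplus i)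
      * D.twoInvVar (S.pt (i + 1)) / 2 := by
  have h1 := (hS.one_sub_pos (i := i + 1) (j := i + 1) hi (by omega)).ne'
  rw [hS.speedMass_succ sch hi, davg, show S.dminus (i + 1) = S.dplus i from rfl,
    show S.edge sch (i + 1) = S.edge sch i * (1 + D.driftRatio (S.pt (i + 1)) * S.dplus i)
      / (1 - D.driftRatio (S.pt (i + 1)) * S.dplus (i + 1)) from rfl]
  obtain ⟨q, hq⟩ : ∃ q, q = 1 - D.driftRatio (S.pt (i + 1)) * S.dplus (i + 1) := ⟨_, rfl⟩
  rw [← hq] at h1 ⊢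
  field_simp
  rw [hq]
  ring

theorem IsFine.speedMass_pos (hS : S.IsFine H) (sch : Scheme) {i : ℕ} (hi : i ≤ n) :
    0 < S.speedMass sch i := by
  cases i with
  | zero => rw [speedMass_zero]; exact S.speedMassZero_pos sch
  | succ i =>
    rw [hS.speedMass_succ_eq sch hi]
    have h1 := hS.edge_pos sch hi
    have h2 := hS.edge_pos sch (i := i) (by omega)
    have h3 := S.dplus_pos hi
    have h4 := S.dplus_pos (i := i) (by omega)
    have h5 := H.b_pos (S.pt_mem (i := i + 1) (by omega))
    positivity

theorem IsFine.flux_zero (hS : S.IsFine H) (sch : Scheme) (lam : ℝ) :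
    S.edge sch 0 * S.gradPlus (S.dsY sch lam) 0
      = S.speedMass sch 0 * ((D.κ (S.pt 0) - lam) * S.dsY sch lam 0) := by
  have h1 := (hS.beta_pos sch).ne'
  have h2 := D.ρ_pos.ne'
  rw [hS.gradPlus_dsY_zero, edge, speedMass_zero]
  field_simp

/-- The discrete form of (p y')' = m(κ - λ)y: the flux through an edge is conductance times
difference quotient, and its jump at a node is the mass times (κ - λ)y. -/
theorem IsFine.flux_succ (hS : S.IsFine H) (sch : Scheme) (lam : ℝ) {i : ℕ} (hi : i + 1 ≤ n) :
    S.edge sch (i + 1) * S.gradPlus (S.dsY sch lam) (i + 1)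
      = S.edge sch i * S.gradPlus (S.dsY sch lam) i
        + S.speedMass sch (i + 1) * ((D.κ (S.pt (i + 1)) - lam) * S.dsY sch lam (i + 1)) := by
  have h1 := (hS.one_sub_pos (i := i + 1) (j := i + 1) hi (by omega)).ne'
  have h2 := hS.gradPlus_dsY_succ sch lam hi
  rw [hS.speedMass_succ sch hi,
    show S.edge sch (i + 1) = S.edge sch i * (1 + D.driftRatio (S.pt (i + 1)) * S.dplus i)
      / (1 - D.driftRatio (S.pt (i + 1)) * S.dplus (i + 1)) from rfl]
  obtain ⟨q, hq⟩ : ∃ q, q = 1 - D.driftRatio (S.pt (i + 1)) * S.dplus (i + 1) := ⟨_, rfl⟩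
  rw [← hq] at h1 h2 ⊢
  field_simp
  linear_combination S.edge sch i * h2

/-- The discrete Wronskian identity. -/
theorem IsFine.wronskian (hS : S.IsFine H) (sch : Scheme) (lam nu : ℝ) :
    S.edge sch n * (S.gradPlus (S.dsY sch lam) n * S.dsY sch nu (n + 1)
      - S.dsY sch lam (n + 1) * S.gradPlus (S.dsY sch nu) n)
      = (nu - lam) * S.innerProd sch (S.dsY sch lam) (S.dsY sch nu) := by
  have key : ∀ i ≤ n, S.edge sch i * (S.gradPlus (S.dsY sch lam) i * S.dsY sch nu i
      - S.dsY sch lam i * S.gradPlus (S.dsY sch nu) i)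
      = (nu - lam) * ∑ j ∈ Finset.range (i + 1),
        S.dsY sch lam j * S.dsY sch nu j * S.speedMass sch j := by
    intro i
    induction i with
    | zero =>
      intro _
      rw [zero_add, Finset.sum_range_one]
      linear_combination S.dsY sch nu 0 * hS.flux_zero sch lam
        - S.dsY sch lam 0 * hS.flux_zero sch nu
    | succ i ih =>
      intro hi
      rw [Finset.sum_range_succ, mul_add, ← ih (by omega)]
      have h1 := S.add_mul_gradPlus (S.dsY sch lam) (by omega : i ≤ n)
      have h2 := S.add_mul_gradPlus (S.dsY sch nu) (by omega : i ≤ n)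
      linear_combination S.dsY sch nu (i + 1) * hS.flux_succ sch lam hi
        - S.dsY sch lam (i + 1) * hS.flux_succ sch nu hi
        + S.edge sch i * S.gradPlus (S.dsY sch lam) i * h2
        - S.edge sch i * S.gradPlus (S.dsY sch nu) i * h1
  -- On the last edge the values at n may be replaced by those at n + 1, since the products of the
  -- two difference quotients cancel in the Wronskian.
  rw [innerProd, ← key n le_rfl]
  have h1 := S.add_mul_gradPlus (S.dsY sch lam) (le_refl n)
  have h2 := S.add_mul_gradPlus (S.dsY sch nu) (le_refl n)
  linear_combination S.edge sch n * S.gradPlus (S.dsY sch lam) n * h2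
    - S.edge sch n * S.gradPlus (S.dsY sch nu) n * h1

/-- For ν < 0 all jumps of the flux have the sign of the solution. Starting from the value 1 and a
nonnegative flux, the solution stays positive and cannot vanish at the last point. -/
theorem IsFine.nonneg_of_mem_eigenvalues (hS : S.IsFine H) {sch : Scheme} {nu : ℝ}
    (hnu : nu ∈ S.eigenvalues sch) : 0 ≤ nu := by
  rw [hS.mem_eigenvalues_iff] at hnu
  by_contra hneg
  push Not at hneg
  have hk : ∀ i ≤ n, 0 < D.κ (S.pt i) - nu := fun i hi => by
    linarith [H.c_nonneg _ (S.pt_mem (i := i) (by omega))]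
  have key : ∀ i ≤ n, 0 < S.dsY sch nu i ∧ 0 ≤ S.edge sch i * S.gradPlus (S.dsY sch nu) i := by
    intro i
    induction i with
    | zero =>
      intro hi
      refine ⟨by rw [dsY_zero]; exact one_pos, ?_⟩
      rw [hS.flux_zero, dsY_zero]
      have := hS.speedMass_pos sch hi
      have := hk 0 hi
      positivity
    | succ i ih =>
      intro hi
      obtain ⟨h1, h2⟩ := ih (by omega)
      have h3 := nonneg_of_mul_nonneg_right h2 (hS.edge_pos sch (by omega : i ≤ n))
      have h4 : 0 < S.dsY sch nu (i + 1) := by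
        rw [S.add_mul_gradPlus (S.dsY sch nu) (by omega : i ≤ n)]
        have := S.dplus_pos (by omega : i ≤ n)
        positivity
      refine ⟨h4, ?_⟩
      rw [hS.flux_succ sch nu hi]
      have := hS.speedMass_pos sch hi
      have := hk _ hi
      positivity
  obtain ⟨h1, h2⟩ := key n le_rfl
  have h3 := nonneg_of_mul_nonneg_right h2 (hS.edge_pos sch le_rfl)
  rw [S.add_mul_gradPlus (S.dsY sch nu) le_rfl] at hnu
  have := S.dplus_pos (le_refl n)
  have : 0 ≤ S.dplus n * S.gradPlus (S.dsY sch nu) n := by positivity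
  linarith

end StickyDiffusion.Grid

/-! ### Boundary mass and weight: expansions to second order. -/

theorem abs_exp_mul_one_sub_sub_le {s t : ℝ} (hs : |s| ≤ 1) (ht : |t| ≤ 1) :
    |Real.exp s * (1 - t) - (1 + s - t)| ≤ 2 * s ^ 2 + |s| * |t| := by
  have h1 := Real.abs_exp_sub_one_sub_id_le hs
  have h2 : |1 - t| ≤ 2 := (abs_sub _ _).trans (by rw [abs_one]; linarith)
  have e : Real.exp s * (1 - t) - (1 + s - t) = (Real.exp s - 1 - s) * (1 - t) + -s * t := by ring
  rw [e]
  refine (abs_add_le_add (abs_mul_le_mul h1 h2) (abs_mul_le_mul (abs_neg s).le le_rfl)).trans_eq ?_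
  ring

namespace StickyDiffusion

namespace CoeffBounds

variable {D : StickyDiffusion}

theorem exists_speedDensity_derivatives (H : D.CoeffBounds) : ∃ (m1 m2 : ℝ → ℝ) (C : ℝ), 1 ≤ C ∧
    ∀ x ∈ Icc D.l D.r, HasDerivWithinAt D.speedDensity (m1 x) (Icc D.l D.r) x ∧
      HasDerivWithinAt m1 (m2 x) (Icc D.l D.r) x ∧
      |D.speedDensity x| ≤ C ∧ |m1 x| ≤ C ∧ |m2 x| ≤ C := by
  obtain ⟨P, hP1, hP⟩ := H.exists_weight_bound
  obtain ⟨B, hBdef⟩ : ∃ B, B = H.B := ⟨_, rfl⟩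
  have hB : 1 ≤ B := hBdef ▸ H.one_le
  refine ⟨fun x => (H.b1 x + 2 * (D.driftRatio x * D.twoInvVar x)) * D.weight x,
    fun x => (H.b2 x + 2 * (H.a1 x * D.twoInvVar x + D.driftRatio x * H.b1 x)
      + (H.b1 x + 2 * (D.driftRatio x * D.twoInvVar x)) * (2 * D.driftRatio x)) * D.weight x,
    11 * B ^ 3 * P, ?_, fun x hx => ⟨?_, ?_, ?_⟩⟩
  · have := one_le_pow₀ hB (n := 3)
    nlinarith
  · have : D.speedDensity = fun x => D.twoInvVar x * D.weight x := funext fun x => speedDensity_eq x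
    rw [this]
    exact ((H.hb x hx).mul (H.hasDerivWithinAt_weight hx)).congr_deriv (by ring)
  · exact (((H.hb1 x hx).add (((H.ha x hx).mul (H.hb x hx)).const_mul 2)).mul
      (H.hasDerivWithinAt_weight hx)).congr_deriv (by
        simp only [Pi.mul_apply, Pi.add_apply]; ring)
  · have ha := H.a_le x hx
    have ha1 := H.a1_le x hx
    have hb := H.b_le x hx
    have hb1 := H.b1_le x hx
    have hb2 := H.b2_le x hx
    rw [← hBdef] at ha ha1 hb hb1 hb2
    have hp : |D.weight x| ≤ P := by
      rw [abs_of_pos (weight_pos x)]; exact (hP x hx).1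
    have n2 : |(2 : ℝ)| ≤ 2 := by norm_num
    have k1 : B ≤ B ^ 3 := le_self_pow₀ hB (by norm_num)
    have k2 : B ^ 2 ≤ B ^ 3 := pow_le_pow_right₀ hB (by norm_num)
    have hP0 : 0 ≤ P := by linarith
    have hB0 : 0 ≤ B := by linarith
    rw [speedDensity_eq]
    refine ⟨(abs_mul_le_mul hb hp).trans ?_,
      (abs_mul_le_mul (abs_add_le_add hb1 (abs_mul_le_mul n2 (abs_mul_le_mul ha hb))) hp).trans ?_,
      (abs_mul_le_mul (abs_add_le_add (abs_add_le_add hb2 (abs_mul_le_mul n2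
        (abs_add_le_add (abs_mul_le_mul ha1 hb) (abs_mul_le_mul ha hb1))))
        (abs_mul_le_mul (abs_add_le_add hb1 (abs_mul_le_mul n2 (abs_mul_le_mul ha hb)))
          (abs_mul_le_mul n2 ha))) hp).trans ?_⟩ <;>
    refine mul_le_mul_of_nonneg_right ?_ hP0 <;> nlinarith

/-- The trapezoidal rule for the weight. -/
theorem exists_weight_trapezoid (H : D.CoeffBounds) : ∃ C : ℝ, 1 ≤ C ∧ ∀ x z : ℝ,
    x ∈ Icc D.l D.r → z ∈ Icc D.l D.r → x ≤ z →
      |D.weight z - D.weight x - (z - x) / 2 * (2 * D.driftRatio x * D.weight x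
        + 2 * D.driftRatio z * D.weight z)| ≤ C * (z - x) ^ 3 ∧
      |D.weight z - D.weight x| ≤ C * (z - x) ∧
      |D.driftRatio z - D.driftRatio x| ≤ C * (z - x) := by
  obtain ⟨P, hP1, hP⟩ := H.exists_weight_bound
  obtain ⟨B, hBdef⟩ : ∃ B, B = H.B := ⟨_, rfl⟩
  have hB : 1 ≤ B := hBdef ▸ H.one_le
  have hB0 : 0 ≤ B := by linarith
  have hP0 : 0 ≤ P := by linarith
  have k3 := one_le_pow₀ hB (n := 3)
  refine ⟨22 * B ^ 3 * P, by nlinarith, fun x z hx hz hxz => ?_⟩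
  have hsub : Icc x z ⊆ Icc D.l D.r := Icc_subset_Icc hx.1 hz.2
  have hzm : z ∈ Icc x z := right_mem_Icc.2 hxz
  have hd : 0 ≤ z - x := sub_nonneg.2 hxz
  have n2 : |(2 : ℝ)| ≤ 2 := by norm_num
  have k1 : B ≤ B ^ 3 := le_self_pow₀ hB (by norm_num)
  have k2 : B ^ 2 ≤ B ^ 3 := pow_le_pow_right₀ hB (by norm_num)
  have hp : ∀ t ∈ Icc x z, |D.weight t| ≤ P := fun t ht => by
    rw [abs_of_pos (weight_pos t)]; exact (hP t (hsub ht)).1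
  have ha : ∀ t ∈ Icc x z, |D.driftRatio t| ≤ B := fun t ht => hBdef ▸ H.a_le t (hsub ht)
  have ha1 : ∀ t ∈ Icc x z, |H.a1 t| ≤ B := fun t ht => hBdef ▸ H.a1_le t (hsub ht)
  have ha2 : ∀ t ∈ Icc x z, |H.a2 t| ≤ B := fun t ht => hBdef ▸ H.a2_le t (hsub ht)
  have dp : ∀ t ∈ Icc x z, HasDerivWithinAt D.weight (2 * D.driftRatio t * D.weight t)
      (Icc x z) t := fun t ht => (H.hasDerivWithinAt_weight (hsub ht)).mono hsub
  have da : ∀ t ∈ Icc x z, HasDerivWithinAt D.driftRatio (H.a1 t) (Icc x z) t :=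
    fun t ht => (H.ha t (hsub ht)).mono hsub
  have da1 : ∀ t ∈ Icc x z, HasDerivWithinAt H.a1 (H.a2 t) (Icc x z) t :=
    fun t ht => (H.ha1 t (hsub ht)).mono hsub
  refine ⟨?_, (abs_sub_le_of_deriv_bound dp (B := 2 * B * P) (fun t ht =>
    abs_mul_le_mul (abs_mul_le_mul n2 (ha t ht)) (hp t ht)) z hzm).trans ?_,
    (abs_sub_le_of_deriv_bound da ha1 z hzm).trans ?_⟩
  · refine abs_trapezoid_le hxz
      (f2 := fun t => (2 * H.a1 t + 4 * (D.driftRatio t * D.driftRatio t)) * D.weight t)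
      (f3 := fun t => (2 * H.a2 t + 12 * (D.driftRatio t * H.a1 t)
        + 8 * (D.driftRatio t * D.driftRatio t * D.driftRatio t)) * D.weight t) dp
      (fun t ht => ?_) (fun t ht => ?_) fun t ht => ?_
    · exact (((da t ht).const_mul 2).mul (dp t ht)).congr_deriv (by ring)
    · exact ((((da1 t ht).const_mul 2).add (((da t ht).mul (da t ht)).const_mul 4)).mul
        (dp t ht)).congr_deriv (by simp only [Pi.mul_apply, Pi.add_apply]; ring)
    · have n12 : |(12 : ℝ)| ≤ 12 := by norm_num
      have n8 : |(8 : ℝ)| ≤ 8 := by norm_num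
      refine (abs_mul_le_mul (abs_add_le_add (abs_add_le_add (abs_mul_le_mul n2 (ha2 t ht))
        (abs_mul_le_mul n12 (abs_mul_le_mul (ha t ht) (ha1 t ht)))) (abs_mul_le_mul n8
        (abs_mul_le_mul (abs_mul_le_mul (ha t ht) (ha t ht)) (ha t ht)))) (hp t ht)).trans ?_
      refine mul_le_mul_of_nonneg_right ?_ hP0
      nlinarith
  · refine mul_le_mul_of_nonneg_right (mul_le_mul_of_nonneg_right ?_ hP0) hd
    linarith
  · refine mul_le_mul_of_nonneg_right ?_ hd
    nlinarith

end CoeffBounds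

namespace Grid

variable {D : StickyDiffusion} {n : ℕ} {S : D.Grid n} {H : D.CoeffBounds}

theorem speedMassZero_mul (S : D.Grid n) (sch : Scheme) :
    S.speedMassZero sch * D.ρ = Real.exp (S.alpha sch / D.σ (S.pt 0) ^ 2 * S.dplus 0) := by
  have := D.ρ_pos.ne'
  rw [speedMassZero]
  field_simp

theorem abs_rho_mul_le (S : D.Grid n) (H : D.CoeffBounds) :
    |D.ρ / D.σ (S.pt 0) ^ 2 * S.dplus 0| ≤ H.B ^ 2 * S.mesh := by
  have h1 := H.b_le _ (S.pt_mem (i := 0) (by omega))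
  have h2 := H.rho_le
  have h3 := S.dplus_le_mesh (Nat.zero_le n)
  have h4 := S.dplus_pos (Nat.zero_le n)
  have e : D.ρ / D.σ (S.pt 0) ^ 2 * S.dplus 0 = D.ρ * (D.twoInvVar (S.pt 0) * (S.dplus 0 / 2)) := by
    rw [twoInvVar]; ring
  rw [e]
  refine (abs_mul_le_mul ((abs_of_pos D.ρ_pos).trans_le h2) (abs_mul_le_mul h1
    (y := S.dplus 0 / 2) (Y := S.mesh) ?_)).trans_eq (by ring)
  rw [abs_of_pos (by positivity)]; linarith

theorem abs_drift_mul_le (S : D.Grid n) (H : D.CoeffBounds) {i j : ℕ} (hi : i ≤ n)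
    (hj : j ≤ n + 1) : |D.driftRatio (S.pt j) * S.dplus i| ≤ H.B * S.mesh :=
  abs_mul_le_mul (H.a_le _ (S.pt_mem hj)) ((abs_of_pos (S.dplus_pos hi)).trans_le
    (S.dplus_le_mesh hi))

/-- With t = aδ and s = ρδ/σ² this is the expansion of e^t(1 - t) for Scheme 1 and of e^s(1 - t)/(1
+ s - t) for Scheme 2. In both cases the first order terms cancel, so α is matched to β. -/
theorem IsFine.abs_edge_zero_sub_le (hS : S.IsFine H) (sch : Scheme) :
    |S.edge sch 0 * (1 - D.driftRatio (S.pt 0) * S.dplus 0) - 1| ≤ 6 * H.B ^ 4 * S.mesh ^ 2 := by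
  have hB := H.one_le
  have hh := S.mesh_pos
  have ht := S.abs_drift_mul_le H (Nat.zero_le n) (Nat.zero_le (n + 1))
  have ht1 := hS.abs_mul_le (Nat.zero_le n) (Nat.zero_le (n + 1))
  have hs := S.abs_rho_mul_le H
  have hs1 : |D.ρ / D.σ (S.pt 0) ^ 2 * S.dplus 0| ≤ 1 / 4 := by
    have : 4 * H.B ^ 2 * S.mesh ≤ 1 := hS
    linarith
  rw [edge, S.speedMassZero_mul]
  have hb := hS.beta_bounds sch
  cases sch with
  | one =>
    have e1 : S.alpha .one / D.σ (S.pt 0) ^ 2 * S.dplus 0 = D.driftRatio (S.pt 0) * S.dplus 0 := by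
      rw [alpha, driftRatio]
    rw [e1, beta]
    obtain ⟨t, htd⟩ : ∃ t, t = D.driftRatio (S.pt 0) * S.dplus 0 := ⟨_, rfl⟩
    rw [← htd] at ht ht1 ⊢
    have h := abs_exp_mul_one_sub_sub_le (s := t) (t := t) (by linarith) (by linarith)
    have e2 : Real.exp t * 1 * (1 - t) - 1 = Real.exp t * (1 - t) - (1 + t - t) := by ring
    rw [e2]
    refine h.trans ?_
    have h2 : t ^ 2 ≤ (H.B * S.mesh) ^ 2 := sq_le_sq' (abs_le.1 ht).1 (abs_le.1 ht).2
    have h3 : H.B ^ 2 * S.mesh ^ 2 ≤ H.B ^ 4 * S.mesh ^ 2 := by gcongr; norm_num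
    rw [← abs_mul, abs_mul_self]
    rw [mul_pow] at h2
    have : 0 ≤ H.B ^ 4 * S.mesh ^ 2 := by positivity
    nlinarith
  | two =>
    have e1 : S.alpha .two = D.ρ := rfl
    have e3 : S.beta .two = 1 / (1 + D.ρ / D.σ (S.pt 0) ^ 2 * S.dplus 0
        - D.driftRatio (S.pt 0) * S.dplus 0) := by
      rw [beta, driftRatio, sub_div, sub_mul, add_sub_assoc]
    rw [e1]
    obtain ⟨t, htd⟩ : ∃ t, t = D.driftRatio (S.pt 0) * S.dplus 0 := ⟨_, rfl⟩
    obtain ⟨s, hsd⟩ : ∃ s, s = D.ρ / D.σ (S.pt 0) ^ 2 * S.dplus 0 := ⟨_, rfl⟩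
    rw [← htd, ← hsd] at e3
    rw [← htd] at ht ht1 ⊢
    rw [← hsd] at hs hs1 ⊢
    obtain ⟨β, hβ⟩ : ∃ β, β = S.beta .two := ⟨_, rfl⟩
    rw [← hβ] at e3 hb ⊢
    have hpos : 0 < 1 + s - t := by linarith [(abs_le.1 hs1).1, (abs_le.1 ht1).2]
    have h := abs_exp_mul_one_sub_sub_le (s := s) (t := t) (by linarith) (by linarith)
    have e4 : β * (1 + s - t) = 1 := by rw [e3]; field_simp
    have e2 : Real.exp s * β * (1 - t) - 1 = β * (Real.exp s * (1 - t) - (1 + s - t)) := by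
      linear_combination e4
    rw [e2]
    refine (abs_mul_le_mul (x := β) (X := 2) (abs_le.2 ⟨by linarith, hb.2⟩) h).trans ?_
    have h2 : s ^ 2 ≤ (H.B ^ 2 * S.mesh) ^ 2 := sq_le_sq' (abs_le.1 hs).1 (abs_le.1 hs).2
    have h3 : |s| * |t| ≤ H.B ^ 2 * S.mesh * (H.B * S.mesh) :=
      mul_le_mul hs ht (abs_nonneg _) (by positivity)
    have h4 : H.B ^ 3 * S.mesh ^ 2 ≤ H.B ^ 4 * S.mesh ^ 2 := by gcongr; norm_num
    have e5 : H.B ^ 2 * S.mesh * (H.B * S.mesh) = H.B ^ 3 * S.mesh ^ 2 := by ring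
    have e6 : (H.B ^ 2 * S.mesh) ^ 2 = H.B ^ 4 * S.mesh ^ 2 := by ring
    linarith

/-- The mass at the sticky boundary, without the part that belongs to the first edge. -/
theorem IsFine.abs_boundary_mass_sub_le (hS : S.IsFine H) (sch : Scheme) :
    |S.speedMass sch 0 - S.edge sch 0 * S.dplus 0 * D.twoInvVar (S.pt 0) / 2 - 1 / D.ρ|
      ≤ 6 * H.B ^ 5 * (S.mesh ^ 2 + sch.boundaryErr S.mesh) := by
  have hB := H.one_le
  have hh := S.mesh_pos
  have ht := S.abs_drift_mul_le H (Nat.zero_le n) (Nat.zero_le (n + 1))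
  have ht1 := hS.abs_mul_le (Nat.zero_le n) (Nat.zero_le (n + 1))
  have hs := S.abs_rho_mul_le H
  have hs1 : |D.ρ / D.σ (S.pt 0) ^ 2 * S.dplus 0| ≤ 1 / 4 := by
    have : 4 * H.B ^ 2 * S.mesh ≤ 1 := hS
    linarith
  have hρ := D.ρ_pos
  have hρB := H.rho_ge
  have e0 : S.speedMassZero sch = 1 / D.ρ * (S.speedMassZero sch * D.ρ) := by field_simp
  have he := hS.abs_edge_zero_sub_le sch
  have hb := hS.beta_bounds sch
  have hρ1 : |1 / D.ρ| ≤ H.B := by rw [abs_of_pos (by positivity)]; exact hρB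
  rw [speedMass_zero]
  rw [edge] at he ⊢
  have e2 : D.twoInvVar (S.pt 0) / 2 * S.dplus 0
      = 1 / D.ρ * (D.ρ / D.σ (S.pt 0) ^ 2 * S.dplus 0) := by
    rw [twoInvVar]; field_simp
  obtain ⟨E, hE⟩ : ∃ E, E = S.speedMassZero sch * D.ρ := ⟨_, rfl⟩
  have hE' := hE.trans (S.speedMassZero_mul sch)
  rw [← hE] at e0 he ⊢
  rw [e0]
  cases sch with
  -- Here the excess over 1/ρ is ((E - 1) - E s)/ρ, whose first order part (t - s)/ρ does not vanish
  -- in general.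
  | one =>
    have e1 : S.alpha .one / D.σ (S.pt 0) ^ 2 * S.dplus 0 = D.driftRatio (S.pt 0) * S.dplus 0 := by
      rw [alpha, driftRatio]
    rw [e1] at hE'
    rw [show S.beta .one = 1 from rfl]
    have e3 : 1 / D.ρ * E - E * 1 * S.dplus 0 * D.twoInvVar (S.pt 0) / 2 - 1 / D.ρ
        = 1 / D.ρ * ((E - 1) - E * (D.ρ / D.σ (S.pt 0) ^ 2 * S.dplus 0)) := by
      linear_combination -E * e2
    rw [e3]
    obtain ⟨t, htd⟩ : ∃ t, t = D.driftRatio (S.pt 0) * S.dplus 0 := ⟨_, rfl⟩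
    obtain ⟨s, hsd⟩ : ∃ s, s = D.ρ / D.σ (S.pt 0) ^ 2 * S.dplus 0 := ⟨_, rfl⟩
    rw [← htd] at ht ht1 hE'
    rw [← hsd] at hs hs1 ⊢
    have h1 : |E - 1| ≤ 2 * |t| := by
      rw [hE']; exact Real.abs_exp_sub_one_le (by linarith)
    have h2 : |E| ≤ 2 := by
      have : E = (E - 1) + 1 := by ring
      rw [this]
      refine (abs_add_le _ _).trans ?_
      rw [abs_one]; linarith
    have h3 : |E - 1 - E * s| ≤ 2 * (H.B * S.mesh) + 2 * (H.B ^ 2 * S.mesh) :=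
      (abs_sub _ _).trans (add_le_add (h1.trans (by linarith)) (abs_mul_le_mul h2 hs))
    refine (abs_mul_le_mul hρ1 h3).trans ?_
    have k2 : H.B ^ 2 * S.mesh ≤ H.B ^ 5 * S.mesh := by gcongr; norm_num
    have k3 : H.B ^ 3 * S.mesh ≤ H.B ^ 5 * S.mesh := by gcongr; norm_num
    have e4 : H.B * (2 * (H.B * S.mesh) + 2 * (H.B ^ 2 * S.mesh))
      = 2 * (H.B ^ 2 * S.mesh) + 2 * (H.B ^ 3 * S.mesh) := by ring
    have : 0 ≤ H.B ^ 5 * S.mesh ^ 2 := by positivity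
    have : 0 ≤ H.B ^ 5 * S.mesh := by positivity
    rw [Scheme.boundaryErr]
    linarith
  -- Since β(1 + s - t) = 1, one has 1 - βs = β(1 - t). The excess is therefore (Eβ(1 - t) - 1)/ρ,
  -- the quantity already known to be of second order.
  | two =>
    have e3 : S.beta .two = 1 / (1 + D.ρ / D.σ (S.pt 0) ^ 2 * S.dplus 0
        - D.driftRatio (S.pt 0) * S.dplus 0) := by
      rw [beta, driftRatio, sub_div, sub_mul, add_sub_assoc]
    obtain ⟨t, htd⟩ : ∃ t, t = D.driftRatio (S.pt 0) * S.dplus 0 := ⟨_, rfl⟩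
    obtain ⟨s, hsd⟩ : ∃ s, s = D.ρ / D.σ (S.pt 0) ^ 2 * S.dplus 0 := ⟨_, rfl⟩
    rw [← htd, ← hsd] at e3
    rw [← htd] at ht ht1 he
    rw [← hsd] at hs hs1 e2
    obtain ⟨β, hβ⟩ : ∃ β, β = S.beta .two := ⟨_, rfl⟩
    rw [← hβ] at e3 hb he ⊢
    have hpos : 0 < 1 + s - t := by linarith [(abs_le.1 hs1).1, (abs_le.1 ht1).2]
    have e4 : β * (1 + s - t) = 1 := by rw [e3]; field_simp
    have e5 : 1 / D.ρ * E - E * β * S.dplus 0 * D.twoInvVar (S.pt 0) / 2 - 1 / D.ρ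
        = 1 / D.ρ * (E * β * (1 - t) - 1) := by
      linear_combination (-E * β) * e2 - 1 / D.ρ * E * e4
    rw [e5]
    refine (abs_mul_le_mul hρ1 he).trans_eq ?_
    rw [Scheme.boundaryErr]
    ring

end Grid

end StickyDiffusion

/-! ### Nodal weights and the speed measure as a quadrature rule. -/

namespace StickyDiffusion.Grid

variable {D : StickyDiffusion} {n : ℕ} {S : D.Grid n} {H : D.CoeffBounds}

/-- The discrete analogue of the weight at the grid points. -/
def node (S : D.Grid n) (sch : Scheme) : ℕ → ℝ
  | 0 => S.edge sch 0 * (1 - D.driftRatio (S.pt 0) * S.dplus 0)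
  | i + 1 => S.edge sch i * (1 + D.driftRatio (S.pt (i + 1)) * S.dplus i)

theorem IsFine.node_eq (hS : S.IsFine H) (sch : Scheme) {i : ℕ} (hi : i ≤ n) :
    S.node sch i = S.edge sch i * (1 - D.driftRatio (S.pt i) * S.dplus i) := by
  cases i with
  | zero => rfl
  | succ i => exact (hS.edge_succ sch hi).symm

/-- Consecutive nodal weights satisfy R'(1 - aδ) = R(1 + a'δ), a second order one-step method for p'
= 2ap: the exact weight obeys it up to its trapezoidal error and δ(a' - a)(p' - p), both O(δ³).
Grönwall, with h² added to the error, concludes. -/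
theorem exists_node_bound (H : D.CoeffBounds) : ∃ C : ℝ, 1 ≤ C ∧ ∀ (n : ℕ) (S : D.Grid n),
    S.IsFine H → ∀ sch, ∀ i ≤ n + 1, |S.node sch i - D.weight (S.pt i)| ≤ C * S.mesh ^ 2 := by
  obtain ⟨T, hT1, hT⟩ := H.exists_weight_trapezoid
  have hB := H.one_le
  obtain ⟨B, hBdef⟩ : ∃ B, B = H.B := ⟨_, rfl⟩
  rw [← hBdef] at hB
  obtain ⟨K, hK⟩ : ∃ K, K = 4 * B + 4 * T ^ 2 := ⟨_, rfl⟩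
  have hK0 : 0 ≤ K := by rw [hK]; positivity
  have hB4 := one_le_pow₀ hB (n := 4)
  refine ⟨Real.exp (K * B) * (6 * B ^ 4 + 1), ?_, fun n S hS sch i hi => ?_⟩
  · have := Real.one_le_exp (x := K * B) (by positivity)
    nlinarith
  have hh := S.mesh_pos
  obtain ⟨N, hN⟩ : ∃ N : ℕ → ℝ, N = fun i => |S.node sch i - D.weight (S.pt i)| + S.mesh ^ 2 :=
    ⟨_, rfl⟩
  have hN0 : 0 ≤ N 0 := by rw [hN]; positivity
  have key := discrete_gronwall_le (n := n) (N := N) (t := S.pt) (K := K) hK0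
    hN0 (fun i hi => (S.lt_succ i hi).le) ?_ i hi
  · have h0 : N 0 ≤ (6 * B ^ 4 + 1) * S.mesh ^ 2 := by
      have := hS.abs_edge_zero_sub_le sch
      rw [← hBdef] at this
      rw [hN]
      simp only [node, S.pt_zero, CoeffBounds.weight_left]
      rw [S.pt_zero] at this
      linarith
    have h1 : S.pt i - S.pt 0 ≤ B := by
      have h2 := (S.pt_mem hi).2
      have h3 := H.len_le
      rw [S.pt_zero]; linarith
    have h2 : N i ≤ Real.exp (K * B) * ((6 * B ^ 4 + 1) * S.mesh ^ 2) :=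
      key.trans (by gcongr)
    rw [hN] at h2
    have h3 : 0 ≤ S.mesh ^ 2 := by positivity
    simp only at h2
    linarith
  · intro i hi
    have hδ := S.dplus_pos hi
    have hδh := S.dplus_le_mesh hi
    obtain ⟨t1, t2, t3⟩ := hT _ _ (S.pt_mem (i := i) (by omega)) (S.pt_mem (i := i + 1) (by omega))
      (S.lt_succ i hi).le
    have e1 := hS.node_eq sch hi
    have e2 : S.node sch (i + 1) = S.edge sch i * (1 + D.driftRatio (S.pt (i + 1)) * S.dplus i) :=
      rfl
    have s1 := abs_le.1 (hS.abs_mul_le hi (j := i) (by omega))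
    have s2 := abs_le.1 (hS.abs_mul_le hi (j := i + 1) (by omega))
    have a1 := abs_le.1 (H.a_le _ (S.pt_mem (i := i) (by omega)))
    have a2 := abs_le.1 (H.a_le _ (S.pt_mem (i := i + 1) (by omega)))
    rw [← hBdef] at a1 a2
    rw [hN]
    simp only
    rw [show S.pt (i + 1) - S.pt i = S.dplus i from rfl] at t1 t2 t3 ⊢
    obtain ⟨δ, hδd⟩ : ∃ δ, δ = S.dplus i := ⟨_, rfl⟩
    obtain ⟨a, had⟩ : ∃ a, a = D.driftRatio (S.pt i) := ⟨_, rfl⟩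
    obtain ⟨a', had'⟩ : ∃ a', a' = D.driftRatio (S.pt (i + 1)) := ⟨_, rfl⟩
    obtain ⟨p, hp⟩ : ∃ p, p = D.weight (S.pt i) := ⟨_, rfl⟩
    obtain ⟨p', hp'⟩ : ∃ p', p' = D.weight (S.pt (i + 1)) := ⟨_, rfl⟩
    obtain ⟨R, hR⟩ : ∃ R, R = S.node sch i := ⟨_, rfl⟩
    obtain ⟨R', hR'⟩ : ∃ R', R' = S.node sch (i + 1) := ⟨_, rfl⟩
    obtain ⟨E, hE⟩ : ∃ E, E = S.edge sch i := ⟨_, rfl⟩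
    obtain ⟨h, hhd⟩ : ∃ h, h = S.mesh := ⟨_, rfl⟩
    simp only [← hδd, ← had, ← had', ← hp, ← hp', ← hR, ← hR', ← hE, ← hhd] at *
    have hτ : |p' * (1 - a * δ) - p * (1 + a' * δ)| ≤ 2 * T ^ 2 * δ ^ 3 := by
      have e : p' * (1 - a * δ) - p * (1 + a' * δ)
          = (p' - p - δ / 2 * (2 * a * p + 2 * a' * p')) + δ * ((a' - a) * (p' - p)) := by ring
      rw [e]
      refine (abs_add_le_add t1 (abs_mul_le_mul (abs_of_pos hδ).le (abs_mul_le_mul t3 t2))).trans ?_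
      have : T ≤ T ^ 2 := le_self_pow₀ hT1 two_ne_zero
      have h3 : T * δ ^ 3 ≤ T ^ 2 * δ ^ 3 := by gcongr
      linarith
    have e3 : (R' - p') * (1 - a * δ)
        = (R - p) * (1 + a' * δ) + -(p' * (1 - a * δ) - p * (1 + a' * δ)) := by
      rw [e2, e1]; ring
    have h4 : |R' - p'| * (1 - a * δ) ≤ |R - p| * (1 + a' * δ) + 2 * T ^ 2 * δ ^ 3 := by
      have h5 := abs_add_le ((R - p) * (1 + a' * δ)) (-(p' * (1 - a * δ) - p * (1 + a' * δ)))
      rw [← e3, abs_mul, abs_mul, abs_neg, abs_of_pos (by linarith : 0 < 1 - a * δ),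
        abs_of_pos (by linarith : 0 < 1 + a' * δ)] at h5
      linarith
    have h6 : 1 + a' * δ ≤ (1 + 4 * B * δ) * (1 - a * δ) := by
      have k1 : a' * δ ≤ B * δ := by gcongr; exact a2.2
      have k2 : a * δ ≤ B * δ := by gcongr; exact a1.2
      have k3 : 4 * B * δ * (a * δ) ≤ 4 * B * δ * (1 / 4) := by gcongr; exact s1.2
      have : 0 ≤ B * δ := by positivity
      linarith
    have h7 : 2 * T ^ 2 * δ ^ 3 ≤ 4 * T ^ 2 * δ * h ^ 2 * (1 - a * δ) := by
      have k1 : δ ^ 3 ≤ δ * h ^ 2 := by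
        have : δ ^ 2 ≤ h ^ 2 := by gcongr
        calc δ ^ 3 = δ * δ ^ 2 := by ring
          _ ≤ _ := by gcongr
      have k2 : 2 * T ^ 2 * δ ^ 3 ≤ 2 * T ^ 2 * (δ * h ^ 2) := by gcongr
      have k3 : 4 * T ^ 2 * δ * h ^ 2 * (1 / 2) ≤ 4 * T ^ 2 * δ * h ^ 2 * (1 - a * δ) := by
        gcongr; linarith
      linarith
    have h8 : |R' - p'| ≤ |R - p| * (1 + 4 * B * δ) + 4 * T ^ 2 * δ * h ^ 2 := by
      refine le_of_mul_le_mul_right ?_ (by linarith : 0 < 1 - a * δ)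
      have : |R - p| * (1 + a' * δ) ≤ |R - p| * ((1 + 4 * B * δ) * (1 - a * δ)) := by gcongr
      linarith
    rw [hK]
    have k1 : 0 ≤ 4 * T ^ 2 * δ * |R - p| := by positivity
    have k2 : 0 ≤ 4 * B * δ * h ^ 2 := by positivity
    linarith

theorem exists_edge_bound (H : D.CoeffBounds) : ∃ C : ℝ, 1 ≤ C ∧ ∀ (n : ℕ) (S : D.Grid n),
    S.IsFine H → ∀ sch, ∀ i ≤ n, S.edge sch i ≤ C := by
  obtain ⟨C, hC1, hC⟩ := exists_node_bound H
  obtain ⟨P, hP1, hP⟩ := H.exists_weight_bound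
  refine ⟨2 * (P + C), by linarith, fun n S hS sch i hi => ?_⟩
  have h1 := (abs_le.1 (hC n S hS sch i (by omega))).2
  have h2 := (hP _ (S.pt_mem (i := i) (by omega))).1
  have h3 := (abs_le.1 (hS.abs_mul_le hi (j := i) (by omega))).2
  have h4 := hS.edge_pos sch hi
  have h5 : S.mesh ^ 2 ≤ 1 := pow_le_one₀ S.mesh_pos.le (by linarith [hS.mesh_le])
  have h6 : C * S.mesh ^ 2 ≤ C * 1 := by gcongr
  rw [hS.node_eq sch hi] at h1
  have h7 : S.edge sch i * (D.driftRatio (S.pt i) * S.dplus i) ≤ S.edge sch i * (1 / 4) := by gcongr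
  linarith

/-- Each nodal mass is shared by its two edges, so the sum becomes a trapezoidal sum over cells.
What remains is the surplus mass at the sticky point and the missing half cell at r. -/
theorem IsFine.sum_speedMass_mul (hS : S.IsFine H) (sch : Scheme) (q : ℕ → ℝ) :
    ∑ i ∈ Finset.range (n + 1), q i * S.speedMass sch i
      = (S.speedMass sch 0 - S.edge sch 0 * S.dplus 0 * D.twoInvVar (S.pt 0) / 2) * q 0
        + ∑ i ∈ Finset.range (n + 1), S.edge sch i * S.dplus i / 2 *
          (D.twoInvVar (S.pt i) * q i + D.twoInvVar (S.pt (i + 1)) * q (i + 1))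
        - S.edge sch n * S.dplus n * D.twoInvVar (S.pt (n + 1)) / 2 * q (n + 1) := by
  have key : ∀ k ≤ n, ∑ i ∈ Finset.range (k + 1), q i * S.speedMass sch i
      = (S.speedMass sch 0 - S.edge sch 0 * S.dplus 0 * D.twoInvVar (S.pt 0) / 2) * q 0
        + ∑ i ∈ Finset.range (k + 1), S.edge sch i * S.dplus i / 2 *
          (D.twoInvVar (S.pt i) * q i + D.twoInvVar (S.pt (i + 1)) * q (i + 1))
        - S.edge sch k * S.dplus k * D.twoInvVar (S.pt (k + 1)) / 2 * q (k + 1) := by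
    intro k
    induction k with
    | zero =>
      intro _
      rw [zero_add, Finset.sum_range_one, Finset.sum_range_one]
      ring
    | succ k ih =>
      intro hk
      rw [Finset.sum_range_succ, ih (by omega), Finset.sum_range_succ _ (k + 1),
        hS.speedMass_succ_eq sch hk]
      ring
  exact key n le_rfl

theorem sum_dplus (S : D.Grid n) : ∑ i ∈ Finset.range (n + 1), S.dplus i = D.r - D.l := by
  simp only [dplus]
  rw [Finset.sum_range_sub, S.pt_zero, S.pt_last]

theorem integral_eq_sum (S : D.Grid n) {f : ℝ → ℝ} (hf : ContinuousOn f (Icc D.l D.r)) :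
    ∫ x in D.l..D.r, f x
      = ∑ i ∈ Finset.range (n + 1), ∫ x in S.pt i..S.pt (i + 1), f x := by
  rw [intervalIntegral.sum_integral_adjacent_intervals, S.pt_zero, S.pt_last]
  intro k hk
  exact (hf.mono (Icc_subset_Icc (S.pt_mem (i := k) (by omega)).1
    (S.pt_mem (i := k + 1) (by omega)).2)).intervalIntegrable_of_Icc (S.lt_succ k (by omega)).le

end StickyDiffusion.Grid

namespace StickyDiffusion.Grid

variable {D : StickyDiffusion} {n : ℕ} {S : D.Grid n} {H : D.CoeffBounds}

/-- The edge conductance differs from the nodal weights at its two ends by first order terms of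
opposite sign. In the symmetric sum these combine into δ times the increment of a b q, which is
second order. After replacing nodal weights by p, the rest is the trapezoidal rule. -/
theorem exists_cell_error (H : D.CoeffBounds) : ∃ C : ℝ, 1 ≤ C ∧ ∀ (n : ℕ) (S : D.Grid n),
    S.IsFine H → ∀ sch, ∀ (q q1 q2 : ℝ → ℝ) (Q : ℝ),
    (∀ x ∈ Icc D.l D.r, HasDerivWithinAt q (q1 x) (Icc D.l D.r) x) →
    (∀ x ∈ Icc D.l D.r, HasDerivWithinAt q1 (q2 x) (Icc D.l D.r) x) →
    (∀ x ∈ Icc D.l D.r, |q x| ≤ Q ∧ |q1 x| ≤ Q ∧ |q2 x| ≤ Q) → ∀ i ≤ n,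
    |S.edge sch i * S.dplus i / 2 * (D.twoInvVar (S.pt i) * q (S.pt i)
        + D.twoInvVar (S.pt (i + 1)) * q (S.pt (i + 1)))
      - ∫ x in S.pt i..S.pt (i + 1), q x * D.speedDensity x| ≤ C * S.mesh ^ 2 * Q * S.dplus i := by
  obtain ⟨Cn, hCn1, hCn⟩ := exists_node_bound H
  obtain ⟨Ce, hCe1, hCe⟩ := exists_edge_bound H
  obtain ⟨m1, m2, Cm, hCm1, hCm⟩ := H.exists_speedDensity_derivatives
  obtain ⟨B, hBdef⟩ : ∃ B, B = H.B := ⟨_, rfl⟩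
  have hB : 1 ≤ B := hBdef ▸ H.one_le
  refine ⟨B * Cn + 2 * Ce * B ^ 2 + 4 * Cm, ?_, fun n S hS sch q q1 q2 Q hq hq1 hQ i hi => ?_⟩
  · have : 0 ≤ B * Cn + 2 * Ce * B ^ 2 := by positivity
    linarith
  have hx := S.pt_mem (i := i) (by omega)
  have hz := S.pt_mem (i := i + 1) (by omega)
  have hxz := (S.lt_succ i hi).le
  have hsub : Icc (S.pt i) (S.pt (i + 1)) ⊆ Icc D.l D.r := Icc_subset_Icc hx.1 hz.2
  have hzm : S.pt (i + 1) ∈ Icc (S.pt i) (S.pt (i + 1)) := right_mem_Icc.2 hxz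
  have hQ0 : 0 ≤ Q := (abs_nonneg _).trans (hQ _ hx).1
  have tr := abs_integral_trapezoid_le hxz (f := fun t => q t * D.speedDensity t)
    (f1 := fun t => q1 t * D.speedDensity t + q t * m1 t)
    (f2 := fun t => q2 t * D.speedDensity t + q1 t * m1 t + (q1 t * m1 t + q t * m2 t))
    (B := 4 * Cm * Q)
    (fun t ht => (((hq t (hsub ht)).mul (hCm t (hsub ht)).1).mono hsub))
    (fun t ht => ((((hq1 t (hsub ht)).mul (hCm t (hsub ht)).1).add
      ((hq t (hsub ht)).mul (hCm t (hsub ht)).2.1)).mono hsub)) (fun t ht => by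
      obtain ⟨-, -, b1, b2, b3⟩ := hCm t (hsub ht)
      obtain ⟨c1, c2, c3⟩ := hQ t (hsub ht)
      exact (abs_add_le_add (abs_add_le_add (abs_mul_le_mul c3 b1) (abs_mul_le_mul c2 b2))
        (abs_add_le_add (abs_mul_le_mul c2 b2) (abs_mul_le_mul c1 b3))).trans_eq (by ring))
  have lip := abs_sub_le_of_deriv_bound
    (f := fun t => D.driftRatio t * D.twoInvVar t * q t)
    (f1 := fun t => (H.a1 t * D.twoInvVar t + D.driftRatio t * H.b1 t) * q t
      + D.driftRatio t * D.twoInvVar t * q1 t) (B := 3 * B ^ 2 * Q)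
    (fun t ht => ((((H.ha t (hsub ht)).mul (H.hb t (hsub ht))).mul (hq t (hsub ht))).mono hsub))
    (fun t ht => by
      have b0 := H.a_le t (hsub ht)
      have b1 := H.a1_le t (hsub ht)
      have b2 := H.b_le t (hsub ht)
      have b3 := H.b1_le t (hsub ht)
      rw [← hBdef] at b0 b1 b2 b3
      obtain ⟨c1, c2, c3⟩ := hQ t (hsub ht)
      exact (abs_add_le_add (abs_mul_le_mul (abs_add_le_add (abs_mul_le_mul b1 b2)
        (abs_mul_le_mul b0 b3)) c1) (abs_mul_le_mul (abs_mul_le_mul b0 b2) c2)).trans_eq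
        (by ring)) _ hzm
  rw [show S.pt (i + 1) - S.pt i = S.dplus i from rfl] at tr lip
  have hδ := S.dplus_pos hi
  have hδh := S.dplus_le_mesh hi
  have n0 := hCn n S hS sch i (by omega)
  have n1 := hCn n S hS sch (i + 1) (by omega)
  have E0 := hS.node_eq sch hi
  have E1 : S.node sch (i + 1) = S.edge sch i * (1 + D.driftRatio (S.pt (i + 1)) * S.dplus i) := rfl
  have hEp := hS.edge_pos sch hi
  have hEC := hCe n S hS sch i hi
  have hb0 := H.b_le _ hx
  have hb1 := H.b_le _ hz
  have hq0 := (hQ _ hx).1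
  have hq1' := (hQ _ hz).1
  simp only [speedDensity_eq] at tr ⊢
  rw [← hBdef] at hb0 hb1
  obtain ⟨I, hI⟩ : ∃ I, I = ∫ t in S.pt i..S.pt (i + 1), q t * (D.twoInvVar t * D.weight t) :=
    ⟨_, rfl⟩
  rw [← hI] at tr ⊢
  obtain ⟨e0, he0⟩ : ∃ e0, e0 = S.node sch i - D.weight (S.pt i) := ⟨_, rfl⟩
  obtain ⟨e1, he1⟩ : ∃ e1, e1 = S.node sch (i + 1) - D.weight (S.pt (i + 1)) := ⟨_, rfl⟩
  rw [← he0] at n0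
  rw [← he1] at n1
  obtain ⟨δ, hδd⟩ : ∃ δ, δ = S.dplus i := ⟨_, rfl⟩
  obtain ⟨E, hEd⟩ : ∃ E, E = S.edge sch i := ⟨_, rfl⟩
  obtain ⟨h, hhd⟩ : ∃ h, h = S.mesh := ⟨_, rfl⟩
  rw [← hEd] at E0 E1 hEp hEC ⊢
  rw [← hδd] at E0 E1 hδ hδh tr lip ⊢
  rw [← hhd] at hδh n0 n1 ⊢
  have ident : E * δ / 2 * (D.twoInvVar (S.pt i) * q (S.pt i)
        + D.twoInvVar (S.pt (i + 1)) * q (S.pt (i + 1))) - I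
      = δ / 2 * (D.twoInvVar (S.pt i) * q (S.pt i) * e0
          + D.twoInvVar (S.pt (i + 1)) * q (S.pt (i + 1)) * e1
          + -(δ * E * (D.driftRatio (S.pt (i + 1)) * D.twoInvVar (S.pt (i + 1)) * q (S.pt (i + 1))
            - D.driftRatio (S.pt i) * D.twoInvVar (S.pt i) * q (S.pt i))))
        + -(I - δ / 2 * (q (S.pt i) * (D.twoInvVar (S.pt i) * D.weight (S.pt i))
          + q (S.pt (i + 1)) * (D.twoInvVar (S.pt (i + 1)) * D.weight (S.pt (i + 1))))) := by
    rw [he0, he1, E0, E1]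
    ring
  rw [ident]
  have hδ2 : |δ / 2| ≤ δ / 2 := (abs_of_pos (by positivity)).le
  have hh0 : 0 ≤ h := hδ.le.trans hδh
  have hδE : |δ * E| ≤ h * Ce := by
    rw [abs_of_pos (by positivity)]; gcongr
  refine (abs_add_le_add (abs_mul_le_mul hδ2 (abs_add_le_add (abs_add_le_add
    (abs_mul_le_mul (abs_mul_le_mul hb0 hq0) n0) (abs_mul_le_mul (abs_mul_le_mul hb1 hq1') n1))
    ((abs_neg _).trans_le (abs_mul_le_mul hδE lip)))) ((abs_neg _).trans_le tr)).trans ?_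
  have k1 : 4 * Cm * Q * δ ^ 3 ≤ 4 * Cm * Q * (δ * h ^ 2) := by
    have : δ ^ 2 ≤ h ^ 2 := by gcongr
    have : δ ^ 3 ≤ δ * h ^ 2 := by
      calc δ ^ 3 = δ * δ ^ 2 := by ring
        _ ≤ _ := by gcongr
    gcongr
  have k2 : h * Ce * (3 * B ^ 2 * Q * δ) ≤ h * Ce * (3 * B ^ 2 * Q * h) := by gcongr
  have k3 : δ / 2 * (h * Ce * (3 * B ^ 2 * Q * δ)) ≤ δ / 2 * (h * Ce * (3 * B ^ 2 * Q * h)) := by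
    gcongr
  have k4 : 0 ≤ Ce * B ^ 2 * Q * h ^ 2 * δ := by positivity
  linarith

/-- The discrete speed measure as a quadrature rule. -/
theorem exists_quadrature_error (H : D.CoeffBounds) : ∃ C : ℝ, 1 ≤ C ∧ ∀ (n : ℕ) (S : D.Grid n),
    S.IsFine H → ∀ sch, ∀ (q q1 q2 : ℝ → ℝ) (Q : ℝ),
    (∀ x ∈ Icc D.l D.r, HasDerivWithinAt q (q1 x) (Icc D.l D.r) x) →
    (∀ x ∈ Icc D.l D.r, HasDerivWithinAt q1 (q2 x) (Icc D.l D.r) x) →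
    (∀ x ∈ Icc D.l D.r, |q x| ≤ Q ∧ |q1 x| ≤ Q ∧ |q2 x| ≤ Q) →
    |∑ i ∈ Finset.range (n + 1), q (S.pt i) * S.speedMass sch i
      - (1 / D.ρ * q D.l + ∫ x in D.l..D.r, q x * D.speedDensity x)|
      ≤ C * (S.mesh ^ 2 * Q + S.mesh * |q D.r| + sch.boundaryErr S.mesh * |q D.l|) := by
  obtain ⟨Cc, hCc1, hCc⟩ := exists_cell_error H
  obtain ⟨Ce, hCe1, hCe⟩ := exists_edge_bound H
  obtain ⟨B, hBdef⟩ : ∃ B, B = H.B := ⟨_, rfl⟩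
  have hB : 1 ≤ B := hBdef ▸ H.one_le
  obtain ⟨C, hC⟩ : ∃ C, C = Cc * B + 6 * B ^ 5 + Ce * B := ⟨_, rfl⟩
  refine ⟨C, ?_, fun n S hS sch q q1 q2 Q hq hq1 hQ => ?_⟩
  · have : 1 * 1 ≤ Cc * B := by gcongr
    have : 0 ≤ 6 * B ^ 5 + Ce * B := by positivity
    linarith
  have hh := S.mesh_pos
  have hQ0 : 0 ≤ Q := (abs_nonneg _).trans (hQ _ left_mem).1
  have hint := S.integral_eq_sum (f := fun x => q x * D.speedDensity x)
    (ContinuousOn.mul (fun x hx => (hq x hx).continuousWithinAt) H.continuousOn_speedDensity)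
  have hsum := hS.sum_speedMass_mul sch (fun i => q (S.pt i))
  have h1 : |∑ i ∈ Finset.range (n + 1), (S.edge sch i * S.dplus i / 2 *
        (D.twoInvVar (S.pt i) * q (S.pt i) + D.twoInvVar (S.pt (i + 1)) * q (S.pt (i + 1)))
      - ∫ x in S.pt i..S.pt (i + 1), q x * D.speedDensity x)| ≤ Cc * S.mesh ^ 2 * Q * B := by
    refine (Finset.abs_sum_le_sum_abs _ _).trans ((Finset.sum_le_sum fun i hi =>
      hCc n S hS sch q q1 q2 Q hq hq1 hQ i (by rw [Finset.mem_range] at hi; omega)).trans ?_)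
    rw [← Finset.mul_sum, S.sum_dplus]
    have := H.len_le
    rw [← hBdef] at this
    gcongr
  rw [Finset.sum_sub_distrib, ← hint] at h1
  have h2 := hS.abs_boundary_mass_sub_le sch
  rw [← hBdef] at h2
  -- The half cell next to r carries no mass; the loss is O(h) |q(r)| and is kept separate because
  -- q(r) = 0 in the normalization of eigenfunctions.
  have h3 : |S.edge sch n * S.dplus n * D.twoInvVar (S.pt (n + 1)) / 2| ≤ Ce * S.mesh * B := by
    have e : S.edge sch n * S.dplus n * D.twoInvVar (S.pt (n + 1)) / 2
      = S.edge sch n * S.dplus n * (D.twoInvVar (S.pt (n + 1)) / 2) := by ring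
    rw [e]
    have p1 := hS.edge_pos sch (le_refl n)
    have p2 := S.dplus_pos (le_refl n)
    have p3 := hCe n S hS sch n le_rfl
    have p4 := S.dplus_le_mesh (le_refl n)
    have p5 := H.b_le _ (S.pt_mem (le_refl (n + 1)))
    rw [← hBdef] at p5
    refine abs_mul_le_mul ?_ ?_
    · rw [abs_of_pos (by positivity)]; gcongr
    · rw [abs_div, abs_two]; linarith [abs_nonneg (D.twoInvVar (S.pt (n + 1)))]
  rw [hsum]
  rw [S.pt_last] at h3 ⊢
  rw [S.pt_zero] at h2 ⊢
  obtain ⟨X, hX⟩ : ∃ X, X = S.speedMass sch 0 - S.edge sch 0 * S.dplus 0 * D.twoInvVar D.l / 2 :=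
    ⟨_, rfl⟩
  obtain ⟨Y, hY⟩ : ∃ Y, Y = S.edge sch n * S.dplus n * D.twoInvVar D.r / 2 := ⟨_, rfl⟩
  obtain ⟨s, hs⟩ : ∃ s, s = ∑ i ∈ Finset.range (n + 1), S.edge sch i * S.dplus i / 2 *
    (D.twoInvVar (S.pt i) * q (S.pt i) + D.twoInvVar (S.pt (i + 1)) * q (S.pt (i + 1))) := ⟨_, rfl⟩
  obtain ⟨I, hI⟩ : ∃ I, I = ∫ x in D.l..D.r, q x * D.speedDensity x := ⟨_, rfl⟩
  rw [← hX] at h2 ⊢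
  rw [← hY] at h3 ⊢
  rw [← hs, ← hI] at h1 ⊢
  have e : X * q D.l + s - Y * q D.r - (1 / D.ρ * q D.l + I)
    = (s - I) + (X - 1 / D.ρ) * q D.l + -(Y * q D.r) := by ring
  rw [e]
  refine (abs_add_le_add (abs_add_le_add h1 (abs_mul_le_mul h2 le_rfl))
    ((abs_neg _).trans_le (abs_mul_le_mul h3 le_rfl))).trans ?_
  have hbe := sch.boundaryErr_nonneg hh.le
  have hql := (hQ _ left_mem).1
  have k1 : S.mesh ^ 2 * |q D.l| ≤ S.mesh ^ 2 * Q := by gcongr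
  have k2 : 6 * B ^ 5 * (S.mesh ^ 2 * |q D.l|) ≤ 6 * B ^ 5 * (S.mesh ^ 2 * Q) := by gcongr
  have k3 : 0 ≤ (Cc * B + 6 * B ^ 5) * (S.mesh * |q D.r|) := by positivity
  have k4 : 0 ≤ (Cc * B + Ce * B) * (sch.boundaryErr S.mesh * |q D.l|) := by positivity
  have k5 : 0 ≤ Ce * B * (S.mesh ^ 2 * Q) := by positivity
  rw [hC]
  linarith

theorem exists_sum_speedMass_le (H : D.CoeffBounds) : ∃ C : ℝ, 1 ≤ C ∧ ∀ (n : ℕ) (S : D.Grid n),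
    S.IsFine H → ∀ sch, ∑ i ∈ Finset.range (n + 1), S.speedMass sch i ≤ C := by
  obtain ⟨C, hC1, hC⟩ := exists_quadrature_error H
  refine ⟨3 * C + |1 / D.ρ + ∫ x in D.l..D.r, D.speedDensity x|,
    by linarith [abs_nonneg (1 / D.ρ + ∫ x in D.l..D.r, D.speedDensity x)], fun n S hS sch => ?_⟩
  have h := hC n S hS sch (fun _ => 1) (fun _ => 0) (fun _ => 0) 1
    (fun x _ => hasDerivWithinAt_const _ _ _) (fun x _ => hasDerivWithinAt_const _ _ _)
    (fun x _ => by simp)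
  simp only [one_mul, mul_one, abs_one] at h
  have hh := S.mesh_pos
  have hh1 : S.mesh ≤ 1 := by linarith [hS.mesh_le]
  have h2 : S.mesh ^ 2 ≤ 1 := pow_le_one₀ hh.le hh1
  have h3 := sch.boundaryErr_le hh.le
  have h4 : C * (S.mesh ^ 2 + S.mesh + sch.boundaryErr S.mesh) ≤ C * 3 := by
    gcongr; linarith
  have h5 := le_abs_self (1 / D.ρ + ∫ x in D.l..D.r, D.speedDensity x)
  linarith [(abs_le.1 h).2]

end StickyDiffusion.Grid

/-! ### Inner products of discrete shooting solutions. -/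

theorem Scheme.errScale_le (sch : Scheme) {w h : ℝ} (hw : 1 ≤ w) (hh : 0 ≤ h) (hwh : w ^ 2 * h ≤ 1) :
    sch.errScale w h ≤ 2 * (w * h) := by
  have h1 := sch.boundaryErr_le hh
  have h2 : w ^ 2 * h * (w * h) ≤ 1 * (w * h) := by gcongr
  have h3 : 1 * h ≤ w * h := by gcongr
  rw [errScale]
  linarith

theorem Scheme.errScale_mono (sch : Scheme) {v w h : ℝ} (hv : 0 ≤ v) (hvw : v ≤ w) :
    sch.errScale v h ≤ sch.errScale w h := by
  rw [errScale, errScale]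
  gcongr

namespace StickyDiffusion.Grid

variable {D : StickyDiffusion} {n : ℕ} {S : D.Grid n} {H : D.CoeffBounds}

/-- The global error bound in a form uniform over all λ of frequency at most w, so that it covers a
whole neighbourhood of an eigenvalue. Smallness of w²h implies both w³h² ≤ 1 and fineness of the
grid. -/
theorem exists_pointwise_error (H : D.CoeffBounds) : ∃ C : ℝ, 1 ≤ C ∧ ∀ (n : ℕ) (S : D.Grid n)
    (sch : Scheme) (w : ℝ), 1 ≤ w → C * (w ^ 2 * S.mesh) ≤ 1 → S.IsFine H ∧
    ∀ lam : ℝ, -1 ≤ lam → freq lam ≤ w → ∀ i ≤ n + 1,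
      |S.dsY sch lam i - H.sol lam (S.pt i)| ≤ C * w * sch.errScale w S.mesh ∧
      |S.dsV sch lam i - H.dsol lam (S.pt i)| ≤ C * w ^ 2 * sch.errScale w S.mesh := by
  obtain ⟨C, hC1, hC⟩ := exists_error_bound H
  have hB := H.one_le
  refine ⟨C + 4 * H.B ^ 2, by nlinarith, fun n S sch w hw hs => ?_⟩
  have hh := S.mesh_pos
  have hw2 : S.mesh ≤ w ^ 2 * S.mesh := le_mul_of_one_le_left hh.le (one_le_pow₀ hw)
  have hB2 : 1 ≤ 4 * H.B ^ 2 := by nlinarith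
  have h1 : (C + 4 * H.B ^ 2) * S.mesh ≤ 1 := le_trans (by gcongr) hs
  have h2 : w ^ 2 * S.mesh ≤ 1 := le_trans (le_mul_of_one_le_left (by positivity) (by linarith)) hs
  have h3 : 0 ≤ C * S.mesh := by positivity
  have h4 : 0 ≤ 4 * H.B ^ 2 * S.mesh := by positivity
  refine ⟨by rw [IsFine]; linarith, fun lam hlam hf i hi => ?_⟩
  have hf1 := one_le_freq hlam
  have h5 : freq lam ^ 3 * S.mesh ^ 2 ≤ 1 := by
    calc freq lam ^ 3 * S.mesh ^ 2 ≤ w ^ 3 * S.mesh ^ 2 := by gcongr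
      _ ≤ w ^ 4 * S.mesh ^ 2 := by gcongr; norm_num
      _ = (w ^ 2 * S.mesh) ^ 2 := by ring
      _ ≤ 1 := pow_le_one₀ (by positivity) h2
  obtain ⟨e1, e2⟩ := hC n S (by linarith) sch lam hlam h5 i hi
  have e3 := sch.errScale_mono (h := S.mesh) (by linarith) hf
  have e4 := sch.errScale_nonneg (w := freq lam) (h := S.mesh) (by linarith) hh.le
  refine ⟨e1.trans ?_, e2.trans ?_⟩ <;> gcongr <;> linarith

/-- Replacing the grid functions by samples of the exact solutions costs θw times the total mass.
The product of the samples has two derivatives of size O(w⁴), which is the quadrature error. The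
term at r is retained because it vanishes at eigenvalues. -/
theorem exists_innerProd_error (H : D.CoeffBounds) : ∃ C : ℝ, 1 ≤ C ∧ ∀ (n : ℕ) (S : D.Grid n),
    S.IsFine H → ∀ (sch : Scheme) (w lam nu θ : ℝ) (g g' : ℕ → ℝ), -1 ≤ lam → -1 ≤ nu →
    freq lam ≤ w → freq nu ≤ w → θ ≤ w →
    (∀ i ≤ n + 1, |g i - H.sol lam (S.pt i)| ≤ θ) →
    (∀ i ≤ n + 1, |g' i - H.sol nu (S.pt i)| ≤ θ) →
    |S.innerProd sch g g' - D.innerProd (H.sol lam) (H.sol nu)|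
      ≤ C * (θ * w + S.mesh ^ 2 * w ^ 4 + S.mesh * |H.sol lam D.r * H.sol nu D.r|
        + sch.boundaryErr S.mesh) := by
  obtain ⟨A, hA1, hA⟩ := H.exists_shooting_bound
  obtain ⟨A', hA'1, hA'⟩ := H.exists_derivatives_bound
  obtain ⟨Q, hQ1, hQ⟩ := exists_quadrature_error H
  obtain ⟨M, hM1, hM⟩ := exists_sum_speedMass_le H
  obtain ⟨P, hP⟩ : ∃ P, P = 2 * A ^ 2 + 2 * A * A' := ⟨_, rfl⟩
  have hP1 : 1 ≤ P := by rw [hP]; nlinarith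
  have hQP : 1 * 1 ≤ Q * P := by gcongr
  have hAM : 0 ≤ 3 * A * M := by positivity
  refine ⟨Q * P + 3 * A * M, by linarith,
    fun n S hS sch w lam nu θ g g' hlam hnu hwl hwn hθw hg hg' => ?_⟩
  have hw1 : 1 ≤ w := (one_le_freq hlam).trans hwl
  have hfl := one_le_freq hlam
  have hfn := one_le_freq hnu
  have hh := S.mesh_pos
  have hθ0 : 0 ≤ θ := (abs_nonneg _).trans (hg 0 (by omega))
  have sl := H.isShooting lam
  have sn := H.isShooting nu
  have bl : ∀ x ∈ Icc D.l D.r, |H.sol lam x| ≤ A * w ∧ |H.dsol lam x| ≤ A * w ^ 2 ∧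
      |D.accel lam x (H.sol lam x) (H.dsol lam x)| ≤ A' * w ^ 3 := fun x hx =>
    ⟨((hA lam hlam _ _ sl x hx).1).trans (by gcongr), ((hA lam hlam _ _ sl x hx).2).trans (by gcongr),
      ((hA' lam hlam _ _ sl x hx).1).trans (by gcongr)⟩
  have bn : ∀ x ∈ Icc D.l D.r, |H.sol nu x| ≤ A * w ∧ |H.dsol nu x| ≤ A * w ^ 2 ∧
      |D.accel nu x (H.sol nu x) (H.dsol nu x)| ≤ A' * w ^ 3 := fun x hx =>
    ⟨((hA nu hnu _ _ sn x hx).1).trans (by gcongr), ((hA nu hnu _ _ sn x hx).2).trans (by gcongr),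
      ((hA' nu hnu _ _ sn x hx).1).trans (by gcongr)⟩
  have quad := hQ n S hS sch (fun x => H.sol lam x * H.sol nu x)
    (fun x => H.dsol lam x * H.sol nu x + H.sol lam x * H.dsol nu x)
    (fun x => D.accel lam x (H.sol lam x) (H.dsol lam x) * H.sol nu x + H.dsol lam x * H.dsol nu x
      + (H.dsol lam x * H.dsol nu x + H.sol lam x * D.accel nu x (H.sol nu x) (H.dsol nu x)))
    (P * w ^ 4) (fun x hx => (sl.deriv x hx).mul (sn.deriv x hx))
    (fun x hx => ((sl.deriv_deriv x hx).mul (sn.deriv x hx)).add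
      ((sl.deriv x hx).mul (sn.deriv_deriv x hx))) (fun x hx => by
      obtain ⟨l1, l2, l3⟩ := bl x hx
      obtain ⟨n1, n2, n3⟩ := bn x hx
      have k1 : A ^ 2 * w ^ 2 ≤ A ^ 2 * w ^ 4 := by gcongr; norm_num
      have k2 : A ^ 2 * w ^ 3 ≤ A ^ 2 * w ^ 4 := by gcongr; norm_num
      have k3 : 0 ≤ A * A' * w ^ 4 := by positivity
      have k4 : 0 ≤ A ^ 2 * w ^ 4 := by positivity
      refine ⟨(abs_mul_le_mul l1 n1).trans ?_,
        (abs_add_le_add (abs_mul_le_mul l2 n1) (abs_mul_le_mul l1 n2)).trans ?_,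
        (abs_add_le_add (abs_add_le_add (abs_mul_le_mul l3 n1) (abs_mul_le_mul l2 n2))
          (abs_add_le_add (abs_mul_le_mul l2 n2) (abs_mul_le_mul l1 n3))).trans ?_⟩ <;>
      rw [hP] <;> linarith)
  have hlr : H.sol lam D.l * H.sol nu D.l = 1 := by rw [sl.left, sn.left, one_mul]
  have eD : D.innerProd (H.sol lam) (H.sol nu) = 1 / D.ρ * (H.sol lam D.l * H.sol nu D.l)
      + ∫ x in D.l..D.r, H.sol lam x * H.sol nu x * D.speedDensity x := by
    rw [StickyDiffusion.innerProd, mul_assoc]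
  rw [← eD, hlr, abs_one, mul_one] at quad
  have diff : |S.innerProd sch g g' - ∑ i ∈ Finset.range (n + 1),
      H.sol lam (S.pt i) * H.sol nu (S.pt i) * S.speedMass sch i| ≤ 3 * A * (θ * w) * M := by
    rw [innerProd, ← Finset.sum_sub_distrib]
    refine (Finset.abs_sum_le_sum_abs _ _).trans ((Finset.sum_le_sum (g := fun i =>
      3 * A * (θ * w) * S.speedMass sch i) fun i hi => ?_).trans ?_)
    · rw [Finset.mem_range] at hi
      have hm := hS.speedMass_pos sch (i := i) (by omega)
      have e1 := hg i (by omega)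
      have e2 := hg' i (by omega)
      have e3 := (bl _ (S.pt_mem (i := i) (by omega))).1
      have e4 := (bn _ (S.pt_mem (i := i) (by omega))).1
      rw [← sub_mul, abs_mul, abs_of_pos hm]
      refine mul_le_mul_of_nonneg_right ?_ hm.le
      have e : g i * g' i - H.sol lam (S.pt i) * H.sol nu (S.pt i)
        = (g i - H.sol lam (S.pt i)) * (g' i - H.sol nu (S.pt i))
          + (g i - H.sol lam (S.pt i)) * H.sol nu (S.pt i)
          + H.sol lam (S.pt i) * (g' i - H.sol nu (S.pt i)) := by ring
      rw [e]
      refine (abs_add_le_add (abs_add_le_add (abs_mul_le_mul e1 e2) (abs_mul_le_mul e1 e4))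
        (abs_mul_le_mul e3 e2)).trans ?_
      have k1 : θ * θ ≤ θ * w := by gcongr
      have k2 : 1 * (θ * w) ≤ A * (θ * w) := by gcongr
      linarith
    · rw [← Finset.mul_sum]
      have := hM n S hS sch
      gcongr
  have hbe := sch.boundaryErr_nonneg hh.le
  have htri := abs_sub_le (S.innerProd sch g g') (∑ i ∈ Finset.range (n + 1),
      H.sol lam (S.pt i) * H.sol nu (S.pt i) * S.speedMass sch i)
      (D.innerProd (H.sol lam) (H.sol nu))
  refine htri.trans ((add_le_add diff quad).trans ?_)
  obtain ⟨F, hF⟩ : ∃ F, F = |H.sol lam D.r * H.sol nu D.r| := ⟨_, rfl⟩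
  have hF0 : 0 ≤ F := hF ▸ abs_nonneg _
  rw [← hF]
  have k1 : Q * (S.mesh * F + sch.boundaryErr S.mesh) * 1
      ≤ Q * (S.mesh * F + sch.boundaryErr S.mesh) * P := by gcongr
  have k2 : 0 ≤ Q * P * (θ * w) := by positivity
  have k3 : 0 ≤ 3 * A * M * (S.mesh ^ 2 * w ^ 4 + S.mesh * F + sch.boundaryErr S.mesh) := by
    positivity
  linarith

/-- The lower bound for the diffusion survives discretization: all errors are at most a constant
times (w²h)w², hence a small fraction of w². The working frequency 2w covers the neighbouring ν. -/
theorem exists_innerProd_near (H : D.CoeffBounds) : ∃ c R C : ℝ, 0 < c ∧ 0 < R ∧ R ≤ 1 ∧ 1 ≤ C ∧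
    ∀ (n : ℕ) (S : D.Grid n) (sch : Scheme) (lam nu : ℝ), -1 ≤ lam → -1 ≤ nu → |nu - lam| ≤ R →
    C * (freq lam ^ 2 * S.mesh) ≤ 1 →
    c * freq lam ^ 2 ≤ S.innerProd sch (S.dsY sch lam) (S.dsY sch nu) := by
  obtain ⟨c, R, hc, hR, hR1, hcR⟩ := H.exists_innerProd_near
  obtain ⟨A, hA1, hA⟩ := exists_pointwise_error H
  obtain ⟨E, hE1, hE⟩ := exists_innerProd_error H
  obtain ⟨Y, hY1, hY⟩ := H.exists_shooting_bound
  obtain ⟨T, hT⟩ : ∃ T, T = E * (2 * A + 2 + Y ^ 2) := ⟨_, rfl⟩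
  have hT0 : 0 < T := by rw [hT]; positivity
  refine ⟨c / 2, R, 8 * A + 32 * T / c, by positivity, hR, hR1, ?_,
    fun n S sch lam nu hlam hnu hln hs => ?_⟩
  · have : 0 < 32 * T / c := by positivity
    linarith
  have hf := one_le_freq hlam
  have hh := S.mesh_pos
  obtain ⟨w, hw⟩ : ∃ w, w = 2 * freq lam := ⟨_, rfl⟩
  have hw1 : 1 ≤ w := by rw [hw]; linarith
  have hnw : freq nu ≤ w := by
    rw [hw]
    refine freq_le_two_mul hlam ?_
    linarith [(abs_le.1 hln).2]
  have hlw : freq lam ≤ w := by rw [hw]; linarith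
  obtain ⟨z, hz⟩ : ∃ z, z = freq lam ^ 2 * S.mesh := ⟨_, rfl⟩
  have hz0 : 0 < z := by rw [hz]; positivity
  have hwz : w ^ 2 * S.mesh = 4 * z := by rw [hw, hz]; ring
  rw [← hz] at hs
  have hs1 : A * (8 * z) ≤ 1 := by
    have : 0 < 32 * T / c * z := by positivity
    linarith
  have hs2 : 32 * T * z ≤ c := by
    have h1 : 32 * T / c * z ≤ 1 := by
      have : 0 < 8 * A * z := by positivity
      linarith
    have h2 : 32 * T / c * z = 32 * T * z / c := by ring
    rw [h2, div_le_one hc] at h1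
    exact h1
  have hz1 : 1 * (8 * z) ≤ A * (8 * z) := by gcongr
  obtain ⟨hS, herr⟩ := hA n S sch w hw1 (by rw [hwz]; linarith)
  have heps := sch.errScale_le hw1 hh.le (by rw [hwz]; linarith)
  have heps0 := sch.errScale_nonneg (w := w) (by linarith) hh.le
  have hwh : w * S.mesh ≤ w ^ 2 * S.mesh := by
    gcongr
    exact le_self_pow₀ hw1 two_ne_zero
  have hθ : A * w * sch.errScale w S.mesh ≤ w * (A * (8 * z)) := by
    calc A * w * sch.errScale w S.mesh ≤ A * w * (2 * (w ^ 2 * S.mesh)) := by gcongr; linarith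
      _ = _ := by rw [hwz]; ring
  have hθw : A * w * sch.errScale w S.mesh ≤ w :=
    hθ.trans (mul_le_of_le_one_right (by linarith) hs1)
  have key := hE n S hS sch w lam nu _ _ _ hlam hnu hlw hnw hθw
    (fun i hi => (herr lam hlam hlw i hi).1) (fun i hi => (herr nu hnu hnw i hi).1)
  have low := hcR lam nu hlam hnu (hln.trans (le_mul_of_one_le_right hR.le hf)) _ _ _ _
    (H.isShooting lam) (H.isShooting nu)
  have F1 : |H.sol lam D.r * H.sol nu D.r| ≤ Y * w * (Y * w) :=
    abs_mul_le_mul (((hY lam hlam _ _ (H.isShooting lam) _ right_mem).1).trans (by gcongr))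
      (((hY nu hnu _ _ (H.isShooting nu) _ right_mem).1).trans (by gcongr))
  have bE := sch.boundaryErr_le hh.le
  have total : E * (A * w * sch.errScale w S.mesh * w + S.mesh ^ 2 * w ^ 4
      + S.mesh * |H.sol lam D.r * H.sol nu D.r| + sch.boundaryErr S.mesh) ≤ 4 * T * z * w ^ 2 := by
    have q1 : A * w * sch.errScale w S.mesh * w ≤ w * (A * (8 * z)) * w := by gcongr
    have q2 : S.mesh ^ 2 * w ^ 4 ≤ 4 * z * w ^ 2 := by
      have e : S.mesh ^ 2 * w ^ 4 = S.mesh * w ^ 2 * (w ^ 2 * S.mesh) := by ring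
      have q : S.mesh * w ^ 2 * (w ^ 2 * S.mesh) ≤ 1 * w ^ 2 * (4 * z) := by
        rw [hwz]
        have : S.mesh ≤ 1 := by linarith [hS.mesh_le]
        gcongr
      linarith
    have hm : S.mesh ≤ 4 * z := by
      rw [← hwz]; exact le_mul_of_one_le_left hh.le (one_le_pow₀ hw1)
    have q3 : S.mesh * |H.sol lam D.r * H.sol nu D.r| ≤ 4 * z * (Y * w * (Y * w)) := by gcongr
    have q4 : sch.boundaryErr S.mesh ≤ 4 * z * w ^ 2 :=
      (bE.trans hm).trans (le_mul_of_one_le_right (by positivity) (one_le_pow₀ hw1))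
    calc _ ≤ E * (w * (A * (8 * z)) * w + 4 * z * w ^ 2 + 4 * z * (Y * w * (Y * w))
          + 4 * z * w ^ 2) := by gcongr
      _ = 4 * T * z * w ^ 2 := by rw [hT]; ring
  have fin : 4 * T * z * w ^ 2 ≤ c / 2 * freq lam ^ 2 := by
    have e : 4 * T * z * w ^ 2 = 32 * T * z / 2 * freq lam ^ 2 := by rw [hw]; ring
    rw [e]
    gcongr
  linarith [(abs_le.1 key).1]

end StickyDiffusion.Grid

/-! ### Perturbation and counting of simple zeros. -/

/-- `F` vanishes at `x` to first order: it changes sign there with slope at least `κ`, in the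
interval of radius `R`. -/
def HasSlope (F : ℝ → ℝ) (x κ R : ℝ) : Prop :=
  ∃ G : ℝ, |G| ≤ 1 ∧ ∀ y, |y - x| ≤ R → κ * (y - x) ^ 2 ≤ (y - x) * (F y * G)

theorem HasSlope.eq_of_eq_zero {F : ℝ → ℝ} {x κ R y : ℝ} (h : HasSlope F x κ R) (hκ : 0 < κ)
    (hy : |y - x| ≤ R) (hF : F y = 0) : y = x := by
  obtain ⟨G, -, hG⟩ := h
  have h1 := hG y hy
  rw [hF, zero_mul, mul_zero] at h1
  by_contra hne
  have h2 := sq_pos_of_ne_zero (sub_ne_zero.2 hne)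
  have : 0 < κ * (y - x) ^ 2 := by positivity
  linarith

/-- At x ± η the function F G has opposite signs and modulus at least κη, so a perturbation of size
κη leaves the signs weakly opposite and the intermediate value theorem applies. -/
theorem HasSlope.exists_zero {F E : ℝ → ℝ} {x κ R η : ℝ} (h : HasSlope F x κ R) (hκ : 0 < κ)
    (hη : 0 < η) (hηR : η ≤ R) (hE : ContinuousOn E (Icc (x - η) (x + η)))
    (hEF : ∀ y, |y - x| ≤ η → |E y - F y| ≤ κ * η) : ∃ y, |y - x| ≤ η ∧ E y = 0 := by
  obtain ⟨G, hG1, hG⟩ := h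
  have d1 : |x + η - x| = η := by rw [add_sub_cancel_left, abs_of_pos hη]
  have d2 : |x - η - x| = η := by rw [sub_sub_cancel_left, abs_neg, abs_of_pos hη]
  have g1 := hG (x + η) (d1.trans_le hηR)
  have g2 := hG (x - η) (d2.trans_le hηR)
  have f1 := abs_le.1 (abs_mul_le_mul (hEF (x + η) d1.le) hG1)
  have f2 := abs_le.1 (abs_mul_le_mul (hEF (x - η) d2.le) hG1)
  have k1 : κ * η ≤ F (x + η) * G := by
    refine le_of_mul_le_mul_left ?_ hη
    linarith
  have k2 : F (x - η) * G ≤ -(κ * η) := by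
    refine le_of_mul_le_mul_left ?_ hη
    linarith
  have hG0 : G ≠ 0 := by
    rintro rfl
    have : 0 < κ * η := by positivity
    linarith
  obtain ⟨y, hy, hy0⟩ := intermediate_value_Icc (by linarith : x - η ≤ x + η)
    (hE.mul (continuousOn_const (c := G)))
    (show (0 : ℝ) ∈ Icc (E (x - η) * G) (E (x + η) * G) from ⟨by linarith [f2.2], by linarith [f1.1]⟩)
  exact ⟨y, abs_le.2 ⟨by linarith [hy.1], by linarith [hy.2]⟩,
    (mul_eq_zero.1 hy0).resolve_right hG0⟩

/-- If every zero of `F` up to its `k`-th zero `x` is approximated by a zero of `E`, then the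
`k`-th zero of `E` is not much larger than `x`. -/
theorem le_add_of_encard_eq {Z Z' : Set ℝ} {x x' η : ℝ} {k : ℕ} (hx : x ∈ Z)
    (hk : {y | y ∈ Z ∧ y < x}.encard + 1 = (k : ℕ∞))
    (hk' : {y | y ∈ Z' ∧ y < x'}.encard + 1 = (k : ℕ∞))
    (hsep : ∀ y ∈ Z, ∀ z ∈ Z, y ≤ x → z ≤ x → |y - z| ≤ 2 * η → y = z)
    (hnear : ∀ y ∈ Z, y ≤ x → ∃ z ∈ Z', |z - y| ≤ η) : x' ≤ x + η := by
  by_contra hcon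
  push Not at hcon
  choose! f hfZ hf using hnear
  have hins : {y | y ∈ Z ∧ y ≤ x} = insert x {y | y ∈ Z ∧ y < x} := by
    ext y
    simp only [mem_ofPred_eq, mem_insert_iff]
    constructor
    · rintro ⟨h1, h2⟩
      rcases h2.eq_or_lt with h | h
      · exact Or.inl h
      · exact Or.inr ⟨h1, h⟩
    · rintro (rfl | ⟨h1, h2⟩)
      · exact ⟨hx, le_rfl⟩
      · exact ⟨h1, h2.le⟩
  have hcard : {y | y ∈ Z ∧ y ≤ x}.encard = (k : ℕ∞) := by
    rw [hins, encard_insert_of_notMem (fun h => lt_irrefl x h.2), hk]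
  have hinj : InjOn f {y | y ∈ Z ∧ y ≤ x} := by
    rintro y ⟨hy, hyx⟩ z ⟨hz, hzx⟩ hyz
    refine hsep y hy z hz hyx hzx ?_
    have h1 := hf y hy hyx
    have h2 := hf z hz hzx
    rw [hyz] at h1
    have := abs_sub_le y (f z) z
    rw [abs_sub_comm y (f z)] at this
    linarith
  have hmap : MapsTo f {y | y ∈ Z ∧ y ≤ x} {y | y ∈ Z' ∧ y < x'} := by
    rintro y ⟨hy, hyx⟩
    exact ⟨hfZ y hy hyx, by linarith [(abs_le.1 (hf y hy hyx)).2]⟩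
  -- If x' were larger than x + η, the k zeros of Z up to and including x would inject into the
  -- zeros of Z' strictly below x', of which there are only k - 1.
  have hle := encard_le_encard_of_injOn hmap hinj
  rw [hcard, ← hk'] at hle
  have hfin : {y | y ∈ Z' ∧ y < x'}.encard ≠ ⊤ := by
    intro htop
    rw [htop] at hk'
    exact ENat.natCast_ne_top k hk'.symm
  exact absurd ((ENat.add_one_le_iff hfin).1 hle) (lt_irrefl _)

/-! ### Uniform slopes of the two shooting functions. -/

namespace StickyDiffusion

variable {D : StickyDiffusion}

/-- At an eigenvalue the Wronskian identity reads p(r)y_λ'(r) y_ν(r) = (ν - λ)(y_λ, y_ν). The inner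
product is at least c w² and the flux at most P A w², so the powers of w cancel and the slope is
uniform in λ. The normalized flux serves as the witness `G`. -/
theorem CoeffBounds.exists_hasSlope (H : D.CoeffBounds) : ∃ κ R : ℝ, 0 < κ ∧ 0 < R ∧ R ≤ 1 ∧
    ∀ lam ∈ D.eigenvalues, HasSlope (fun nu => H.sol nu D.r) lam κ R := by
  obtain ⟨c, R, hc, hR, hR1, hcR⟩ := H.exists_innerProd_near
  obtain ⟨A, hA1, hA⟩ := H.exists_shooting_bound
  obtain ⟨P, hP1, hP⟩ := H.exists_weight_bound
  refine ⟨c / (P * A), R, by positivity, hR, hR1, fun lam hlam => ?_⟩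
  have hlam0 := H.nonneg_of_mem_eigenvalues hlam
  have hF := H.mem_eigenvalues_iff.1 hlam
  have hw := one_le_freq (by linarith : -1 ≤ lam)
  obtain ⟨w, hwd⟩ : ∃ w, w = freq lam := ⟨_, rfl⟩
  rw [← hwd] at hw
  refine ⟨D.weight D.r * H.dsol lam D.r / (P * A * w ^ 2), ?_, fun nu hnu => ?_⟩
  · rw [abs_div, abs_of_pos (by positivity : 0 < P * A * w ^ 2), div_le_one (by positivity)]
    have h1 := (hA lam (by linarith) _ _ (H.isShooting lam) _ right_mem).2
    rw [← hwd] at h1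
    have h2 : |D.weight D.r| ≤ P := by
      rw [abs_of_pos (weight_pos _)]; exact (hP _ right_mem).1
    exact (abs_mul_le_mul h2 h1).trans_eq (by ring)
  · have hnu1 : -1 ≤ nu := by linarith [(abs_le.1 hnu).1]
    have h1 := H.wronskian (H.isShooting lam) (H.isShooting nu)
    rw [hF, zero_mul, sub_zero] at h1
    have h2 := hcR lam nu (by linarith) hnu1
      (hnu.trans (le_mul_of_one_le_right hR.le (hwd ▸ hw))) _ _ _ _ (H.isShooting lam)
      (H.isShooting nu)
    rw [← hwd] at h2
    have e : (nu - lam) * (H.sol nu D.r * (D.weight D.r * H.dsol lam D.r / (P * A * w ^ 2)))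
        = (nu - lam) ^ 2 * D.innerProd (H.sol lam) (H.sol nu) / (P * A * w ^ 2) := by
      linear_combination (nu - lam) / (P * A * w ^ 2) * h1
    have e2 : c / (P * A) * (nu - lam) ^ 2 = (nu - lam) ^ 2 * (c * w ^ 2) / (P * A * w ^ 2) := by
      field_simp
    rw [e, e2]
    gcongr

theorem Grid.exists_hasSlope (H : D.CoeffBounds) : ∃ κ R C : ℝ, 0 < κ ∧ 0 < R ∧ R ≤ 1 ∧ 1 ≤ C ∧
    ∀ (n : ℕ) (S : D.Grid n) (sch : Scheme), ∀ lam ∈ S.eigenvalues sch,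
      0 ≤ lam → C * (freq lam ^ 2 * S.mesh) ≤ 1 →
      HasSlope (fun nu => S.dsY sch nu (n + 1)) lam κ R := by
  obtain ⟨c, R, C₀, hc, hR, hR1, hC₀, hcR⟩ := exists_innerProd_near H
  obtain ⟨A, hA1, hA⟩ := H.exists_shooting_bound
  obtain ⟨P, hP1, hP⟩ := exists_edge_bound H
  obtain ⟨C₁, hC₁, herr⟩ := exists_pointwise_error H
  obtain ⟨B, hBdef⟩ : ∃ B, B = H.B := ⟨_, rfl⟩
  have hB : 1 ≤ B := hBdef ▸ H.one_le
  obtain ⟨A', hA'⟩ : ∃ A', A' = A + 2 := ⟨_, rfl⟩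
  have hA'0 : 0 < A' := by linarith
  obtain ⟨G, hGd⟩ : ∃ G, G = A' + (2 * B * A' + B * (B + 2) * A') := ⟨_, rfl⟩
  have hG0 : 0 < G := by rw [hGd]; positivity
  refine ⟨c / (P * G), R, C₀ + C₁, by positivity, hR, hR1, by linarith,
    fun n S sch lam hlam hlam0 hs => ?_⟩
  have hlam1 : -1 ≤ lam := by linarith
  have hw := one_le_freq hlam1
  have hh := S.mesh_pos
  have hkap : ∀ x ∈ Icc D.l D.r, |D.κ x - lam| ≤ (B + 2) * freq lam ^ 2 := fun x hx =>
    hBdef ▸ H.abs_killing_sub_le hlam1 hx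
  obtain ⟨w, hwd⟩ : ∃ w, w = freq lam := ⟨_, rfl⟩
  rw [← hwd] at hw hs hkap
  have hz0 : 0 < w ^ 2 * S.mesh := by positivity
  have hs0 : C₀ * (w ^ 2 * S.mesh) ≤ 1 := by
    have : 0 < C₁ * (w ^ 2 * S.mesh) := by positivity
    linarith
  have hs1 : C₁ * (w ^ 2 * S.mesh) ≤ 1 := by
    have : 0 < C₀ * (w ^ 2 * S.mesh) := by positivity
    linarith
  have hs2 : w ^ 2 * S.mesh ≤ 1 := (le_mul_of_one_le_left hz0.le hC₁).trans hs1
  obtain ⟨hS, hpt⟩ := herr n S sch w hw hs1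
  have hF := hS.mem_eigenvalues_iff.1 hlam
  have hwm : w * S.mesh ≤ w ^ 2 * S.mesh := by
    gcongr
    exact le_self_pow₀ hw two_ne_zero
  have heps := sch.errScale_le hw hh.le hs2
  have heps1 : C₁ * sch.errScale w S.mesh ≤ 2 := by
    have : C₁ * sch.errScale w S.mesh ≤ C₁ * (2 * (w ^ 2 * S.mesh)) := by gcongr; linarith
    linarith
  -- The last difference quotient is the velocity, O(w²), plus half a step of the acceleration, O(h
  -- w³) = O(w²) since wh ≤ 1.
  have hgrad : |S.gradPlus (S.dsY sch lam) n| ≤ G * w ^ 2 := by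
    obtain ⟨p1, p2⟩ := hpt lam hlam1 hwd.ge n (by omega)
    have hmem := S.pt_mem (i := n) (by omega)
    obtain ⟨q1, q2⟩ := hA lam hlam1 _ _ (H.isShooting lam) _ hmem
    rw [← hwd] at q1 q2
    have y1 : |S.dsY sch lam n| ≤ A' * w := by
      have := abs_add_le (S.dsY sch lam n - H.sol lam (S.pt n)) (H.sol lam (S.pt n))
      rw [sub_add_cancel] at this
      have e : C₁ * w * sch.errScale w S.mesh ≤ 2 * w := by
        calc _ = C₁ * sch.errScale w S.mesh * w := by ring
          _ ≤ _ := by gcongr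
      rw [hA']; linarith
    have v1 : |S.dsV sch lam n| ≤ A' * w ^ 2 := by
      have := abs_add_le (S.dsV sch lam n - H.dsol lam (S.pt n)) (H.dsol lam (S.pt n))
      rw [sub_add_cancel] at this
      have e : C₁ * w ^ 2 * sch.errScale w S.mesh ≤ 2 * w ^ 2 := by
        calc _ = C₁ * sch.errScale w S.mesh * w ^ 2 := by ring
          _ ≤ _ := by gcongr
      rw [hA']; linarith
    have ha := H.a_le _ hmem
    have hb := H.b_le _ hmem
    rw [← hBdef] at ha hb
    have acc : |D.accel lam (S.pt n) (S.dsY sch lam n) (S.dsV sch lam n)|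
        ≤ 2 * B * (A' * w ^ 2) + B * ((B + 2) * w ^ 2) * (A' * w) :=
      abs_add_le_add (abs_mul_le_mul (abs_mul_le_mul (by norm_num) ha) v1)
        (abs_mul_le_mul (abs_mul_le_mul hb (hkap _ hmem)) y1)
    have hδ : |S.dplus n / 2| ≤ S.mesh := by
      have h1 := S.dplus_pos (le_refl n)
      have h2 := S.dplus_le_mesh (le_refl n)
      rw [abs_of_pos (by positivity)]; linarith
    rw [S.gradPlus_dsY sch lam le_rfl]
    refine (abs_add_le_add v1 (abs_mul_le_mul hδ acc)).trans ?_
    have hm1 : S.mesh ≤ 1 := by linarith [hS.mesh_le]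
    have hwm1 : w * S.mesh ≤ 1 := hwm.trans hs2
    have k1 : 2 * B * (A' * w ^ 2) * S.mesh ≤ 2 * B * (A' * w ^ 2) * 1 := by gcongr
    have k2 : B * ((B + 2) * w ^ 2) * A' * (w * S.mesh) ≤ B * ((B + 2) * w ^ 2) * A' * 1 := by
      gcongr
    rw [hGd]
    linarith
  refine ⟨S.edge sch n * S.gradPlus (S.dsY sch lam) n / (P * G * w ^ 2), ?_, fun nu hnu => ?_⟩
  · rw [abs_div, abs_of_pos (by positivity : 0 < P * G * w ^ 2), div_le_one (by positivity)]
    have h2 : |S.edge sch n| ≤ P := by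
      rw [abs_of_pos (hS.edge_pos sch le_rfl)]; exact hP n S hS sch n le_rfl
    exact (abs_mul_le_mul h2 hgrad).trans_eq (by ring)
  · have hnu1 : -1 ≤ nu := by linarith [(abs_le.1 hnu).1]
    have h1 := hS.wronskian sch lam nu
    rw [hF, zero_mul, sub_zero] at h1
    have h2 := hcR n S sch lam nu hlam1 hnu1 hnu (hwd ▸ hs0)
    rw [← hwd] at h2
    have e : (nu - lam) * (S.dsY sch nu (n + 1)
          * (S.edge sch n * S.gradPlus (S.dsY sch lam) n / (P * G * w ^ 2)))
        = (nu - lam) ^ 2 * S.innerProd sch (S.dsY sch lam) (S.dsY sch nu) / (P * G * w ^ 2) := by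
      linear_combination (nu - lam) / (P * G * w ^ 2) * h1
    have e2 : c / (P * G) * (nu - lam) ^ 2 = (nu - lam) ^ 2 * (c * w ^ 2) / (P * G * w ^ 2) := by
      field_simp
    rw [e, e2]
    gcongr

end StickyDiffusion

/-! ### Errors of eigenvalues and of normalized eigenvectors. -/

theorem Scheme.errScale_two_mul_le (sch : Scheme) {w h : ℝ} (hh : 0 ≤ h) :
    sch.errScale (2 * w) h ≤ 8 * sch.errScale w h := by
  have := sch.boundaryErr_nonneg hh
  rw [errScale, errScale, mul_pow]
  linarith

theorem Scheme.errScale_pos (sch : Scheme) {w h : ℝ} (hw : 0 < w) (hh : 0 < h) :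
    0 < sch.errScale w h := by
  have := sch.boundaryErr_nonneg hh.le
  rw [errScale]; positivity

theorem exists_sign_abs_sub_le {a b : ℝ} : ∃ e : ℝ, (e = 1 ∨ e = -1) ∧
    ∀ y z : ℝ, |e * (b * z) - a * y| = |(|b| * z - |a| * y)| := by
  rcases le_total 0 a with ha | ha <;> rcases le_total 0 b with hb | hb
  · exact ⟨1, Or.inl rfl, fun y z => by rw [abs_of_nonneg ha, abs_of_nonneg hb, one_mul]⟩
  · refine ⟨-1, Or.inr rfl, fun y z => ?_⟩
    rw [abs_of_nonneg ha, abs_of_nonpos hb]; congr 1; ring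
  · refine ⟨-1, Or.inr rfl, fun y z => ?_⟩
    rw [abs_of_nonpos ha, abs_of_nonneg hb, ← abs_neg]; congr 1; ring
  · refine ⟨1, Or.inl rfl, fun y z => ?_⟩
    rw [abs_of_nonpos ha, abs_of_nonpos hb, ← abs_neg]; congr 1; ring

/-- The normalizing amplitude is O(1/w), because the squared norm of the shooting solution is at
least c w². -/
theorem mul_le_of_sq_mul_eq_one {A N c w : ℝ} (hc : 0 < c)
    (hN : c * w ^ 2 ≤ N) (h : A ^ 2 * N = 1) : A * w ≤ 1 + 1 / c := by
  have h1 : A ^ 2 * (c * w ^ 2) ≤ 1 := by rw [← h]; gcongr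
  have h2 : (A * w) ^ 2 ≤ 1 / c := by
    rw [le_div_iff₀ hc]; linarith
  have hc' : 0 < 1 / c := by positivity
  refine le_of_sq_le_sq ?_ (by positivity)
  nlinarith

/-- From A²N = A'²N' = 1 one gets (A' - A)(A' + A) = A²A'²(N - N'). Dividing by A' ≤ A' + A and
using A, A' ≤ K/w trades the factor w² in the norm error for 1/w in the amplitude error. -/
theorem abs_normalization_sub_le {A A' N N' K d w : ℝ} (hA : 0 < A) (hA' : 0 < A')
    (hw : 0 < w) (h : A ^ 2 * N = 1) (h' : A' ^ 2 * N' = 1) (hK : A * w ≤ K) (hK' : A' * w ≤ K)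
    (hd : |N' - N| ≤ w ^ 2 * d) : w * |A' - A| ≤ K ^ 3 * d := by
  have hd0 : 0 ≤ d := by
    have : 0 ≤ w ^ 2 * d := (abs_nonneg _).trans hd
    exact nonneg_of_mul_nonneg_right this (by positivity)
  have hK0 : 0 < K := lt_of_lt_of_le (by positivity) hK
  have e : (A' - A) * (A' + A) = A' ^ 2 * A ^ 2 * -(N' - N) := by
    linear_combination (-A' ^ 2) * h + A ^ 2 * h'
  have h1 : |A' - A| * (A' + A) ≤ A' ^ 2 * A ^ 2 * (w ^ 2 * d) := by
    have h2 := congrArg abs e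
    rw [abs_mul, abs_mul, abs_neg, abs_of_pos (by positivity : 0 < A' + A),
      abs_of_pos (by positivity : 0 < A' ^ 2 * A ^ 2)] at h2
    rw [h2]
    gcongr
  have h3 : |A' - A| * A' ≤ |A' - A| * (A' + A) := by gcongr; linarith
  have h4 : |A' - A| ≤ A' * A ^ 2 * (w ^ 2 * d) := by
    refine le_of_mul_le_mul_right ?_ hA'
    linarith
  calc w * |A' - A| ≤ w * (A' * A ^ 2 * (w ^ 2 * d)) := by gcongr
    _ = (A' * w) * (A * w) ^ 2 * d := by ring
    _ ≤ K * K ^ 2 * d := by gcongr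
    _ = K ^ 3 * d := by ring

namespace StickyDiffusion

variable {D : StickyDiffusion}

/-- Zeros of either shooting function are perturbed to zeros of the other within η, where η is the
sup distance of the two functions divided by the slope. Since 2η lies within the radius of
uniqueness, distinct zeros have distinct partners, and counting bounds each k-th eigenvalue by the
other plus η. -/
theorem Grid.exists_eigenvalue_error (H : D.CoeffBounds) : ∃ C : ℝ, 1 ≤ C ∧
    ∀ (n : ℕ) (S : D.Grid n) (sch : Scheme) (k : ℕ) (lam lamn : ℝ), lam ∈ D.eigenvalues →
    {nu | nu ∈ D.eigenvalues ∧ nu < lam}.encard + 1 = (k : ℕ∞) → lamn ∈ S.eigenvalues sch →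
    {nu | nu ∈ S.eigenvalues sch ∧ nu < lamn}.encard + 1 = (k : ℕ∞) →
    C * (freq lam ^ 2 * S.mesh) ≤ 1 →
    |lamn - lam| ≤ 1 ∧ |lamn - lam| ≤ C * freq lam * sch.errScale (freq lam) S.mesh := by
  obtain ⟨κ₁, R₁, hκ₁, hR₁, hR₁1, slope₁⟩ := H.exists_hasSlope
  obtain ⟨κ₂, R₂, C₂, hκ₂, hR₂, hR₂1, hC₂, slope₂⟩ := Grid.exists_hasSlope H
  obtain ⟨A, hA1, hA⟩ := exists_pointwise_error H
  obtain ⟨R, hRd⟩ : ∃ R, R = min R₁ R₂ := ⟨_, rfl⟩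
  have hR : 0 < R := by rw [hRd]; exact lt_min hR₁ hR₂
  have hRR₁ : R ≤ R₁ := hRd ▸ min_le_left _ _
  have hRR₂ : R ≤ R₂ := hRd ▸ min_le_right _ _
  obtain ⟨K, hKd⟩ : ∃ K, K = 1 / κ₁ + 1 / κ₂ := ⟨_, rfl⟩
  have hK0 : 0 < K := by rw [hKd]; positivity
  have hK1 : 1 ≤ κ₁ * K := by
    rw [hKd, mul_add, mul_one_div_cancel hκ₁.ne']
    have : 0 < κ₁ * (1 / κ₂) := by positivity
    linarith
  have hK2 : 1 ≤ κ₂ * K := by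
    rw [hKd, mul_add, mul_one_div_cancel hκ₂.ne']
    have : 0 < κ₂ * (1 / κ₁) := by positivity
    linarith
  have hKA : 16 * K * A ≤ 16 * K * A / R := by
    rw [le_div_iff₀ hR]
    exact mul_le_of_le_one_right (by positivity) (by linarith)
  obtain ⟨C, hCd⟩ : ∃ C, C = 4 * A + 4 * C₂ + 16 * K * A / R := ⟨_, rfl⟩
  have hq0 : 0 < 16 * K * A / R := by positivity
  refine ⟨C, by rw [hCd]; linarith, fun n S sch k lam lamn hlam hk hlamn hkn hs => ?_⟩
  have hlam0 := H.nonneg_of_mem_eigenvalues hlam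
  have hw := one_le_freq (by linarith : -1 ≤ lam)
  have hh := S.mesh_pos
  obtain ⟨w, hwd⟩ : ∃ w, w = freq lam := ⟨_, rfl⟩
  have hfreq : ∀ nu, nu ≤ lam + 1 → freq nu ≤ 2 * w := fun nu hnu => by
    rw [hwd]; exact freq_le_two_mul (by linarith) (by linarith)
  rw [← hwd] at hw hs ⊢
  obtain ⟨z, hz⟩ : ∃ z, z = w ^ 2 * S.mesh := ⟨_, rfl⟩
  have hz0 : 0 < z := by rw [hz]; positivity
  rw [← hz, hCd] at hs
  have p1 : 0 < A * z := by positivity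
  have p2 : 0 < C₂ * z := by positivity
  have p3 : 0 < 16 * K * A / R * z := by positivity
  have hs1 : A * ((2 * w) ^ 2 * S.mesh) ≤ 1 := by
    have e : A * ((2 * w) ^ 2 * S.mesh) = 4 * (A * z) := by rw [hz]; ring
    linarith
  have hs2 : (2 * w) ^ 2 * S.mesh ≤ 1 :=
    (le_mul_of_one_le_left (by positivity) hA1).trans hs1
  have hs3 : C₂ * ((2 * w) ^ 2 * S.mesh) ≤ 1 := by
    have e : C₂ * ((2 * w) ^ 2 * S.mesh) = 4 * (C₂ * z) := by rw [hz]; ring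
    linarith
  have hs4 : 16 * K * A * z ≤ R := by
    have h1 : 16 * K * A / R * z ≤ 1 := by linarith
    have h2 : 16 * K * A / R * z = 16 * K * A * z / R := by ring
    rw [h2, div_le_one hR] at h1
    exact h1
  obtain ⟨hS, herr⟩ := hA n S sch (2 * w) (by linarith) hs1
  have heps := sch.errScale_le (w := 2 * w) (by linarith) hh.le hs2
  have hepos := sch.errScale_pos (w := 2 * w) (by linarith) hh
  -- K = 1/κ₁ + 1/κ₂ makes κᵢη at least the distance of the two shooting functions for both slopes.
  obtain ⟨η, hη⟩ : ∃ η, η = K * (A * (2 * w) * sch.errScale (2 * w) S.mesh) := ⟨_, rfl⟩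
  have hη0 : 0 < η := by rw [hη]; positivity
  have hηR : 2 * η ≤ R := by
    have e : A * (2 * w) * sch.errScale (2 * w) S.mesh ≤ A * (2 * w) * (2 * (2 * w * S.mesh)) := by
      gcongr
    have e2 : K * (A * (2 * w) * sch.errScale (2 * w) S.mesh)
        ≤ K * (A * (2 * w) * (2 * (2 * w * S.mesh))) := by gcongr
    have e3 : K * (A * (2 * w) * (2 * (2 * w * S.mesh))) = 8 * (K * A * z) := by rw [hz]; ring
    rw [hη]
    linarith
  have hηC : η ≤ C * w * sch.errScale w S.mesh := by
    have e1 := sch.errScale_two_mul_le (w := w) hh.le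
    have e0 := sch.errScale_nonneg (w := w) (by linarith) hh.le
    calc η ≤ K * (A * (2 * w) * (8 * sch.errScale w S.mesh)) := by rw [hη]; gcongr
      _ = 16 * K * A * (w * sch.errScale w S.mesh) := by ring
      _ ≤ C * (w * sch.errScale w S.mesh) := by
        gcongr
        linarith
      _ = _ := by ring
  have close : ∀ nu, -1 ≤ nu → nu ≤ lam + 1 → |S.dsY sch nu (n + 1) - H.sol nu D.r|
      ≤ A * (2 * w) * sch.errScale (2 * w) S.mesh := fun nu h1 h2 => by
    have := (herr nu h1 (hfreq nu h2) (n + 1) le_rfl).1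
    rwa [S.pt_last] at this
  have hX0 : 0 ≤ A * (2 * w) * sch.errScale (2 * w) S.mesh := by positivity
  have close₁ : A * (2 * w) * sch.errScale (2 * w) S.mesh ≤ κ₁ * η := by
    rw [hη, ← mul_assoc κ₁]; exact le_mul_of_one_le_left hX0 hK1
  have close₂ : A * (2 * w) * sch.errScale (2 * w) S.mesh ≤ κ₂ * η := by
    rw [hη, ← mul_assoc κ₂]; exact le_mul_of_one_le_left hX0 hK2
  have upper : lamn ≤ lam + η := by
    refine le_add_of_encard_eq hlam hk hkn (fun y hy z hz _ _ hyz => ?_) fun y hy hyl => ?_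
    · exact (slope₁ z hz).eq_of_eq_zero hκ₁ (by linarith) (H.mem_eigenvalues_iff.1 hy)
    · have hy0 := H.nonneg_of_mem_eigenvalues hy
      obtain ⟨x, hx, hx0⟩ := (slope₁ y hy).exists_zero (E := fun nu => S.dsY sch nu (n + 1)) hκ₁ hη0
        (by linarith) (S.continuous_dsY_dsV sch (n + 1)).1.continuousOn (fun x hx =>
          (close x (by linarith [(abs_le.1 hx).1]) (by linarith [(abs_le.1 hx).2])).trans close₁)
      exact ⟨x, hS.mem_eigenvalues_iff.2 hx0, hx⟩
  -- The upper bound for the discrete eigenvalue is used here: it keeps the frequencies of all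
  -- discrete eigenvalues up to the k-th below 2w, where the slope estimate is available.
  have slope₂' : ∀ y ∈ S.eigenvalues sch, y ≤ lamn →
      HasSlope (fun nu => S.dsY sch nu (n + 1)) y κ₂ R₂ := fun y hy hyl => by
    have hy0 := hS.nonneg_of_mem_eigenvalues hy
    refine slope₂ n S sch y hy hy0 (le_trans ?_ hs3)
    have h1 := hfreq y (by linarith)
    have h2 := one_le_freq (by linarith : -1 ≤ y)
    gcongr
  have lower : lam ≤ lamn + η := by
    refine le_add_of_encard_eq hlamn hkn hk (fun y hy z hz _ hzl hyz => ?_) fun y hy hyl => ?_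
    · exact (slope₂' z hz hzl).eq_of_eq_zero hκ₂ (by linarith) (hS.mem_eigenvalues_iff.1 hy)
    · have hy0 := hS.nonneg_of_mem_eigenvalues hy
      obtain ⟨x, hx, hx0⟩ := (slope₂' y hy hyl).exists_zero (E := fun nu => H.sol nu D.r) hκ₂ hη0
        (by linarith) (fun x hx => (H.continuousAt_sol_right
          (by linarith [hx.1])).continuousWithinAt) (fun x hx => by
          rw [abs_sub_comm]
          exact (close x (by linarith [(abs_le.1 hx).1])
            (by linarith [(abs_le.1 hx).2])).trans close₂)
      exact ⟨x, H.mem_eigenvalues_iff.2 hx0, hx⟩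
  have fin : |lamn - lam| ≤ η := abs_le.2 ⟨by linarith, by linarith⟩
  exact ⟨by linarith, fin.trans hηC⟩

theorem CoeffBounds.innerProd_eigenfunction (H : D.CoeffBounds) {lam : ℝ} {f : ℝ → ℝ}
    (h : D.IsEigenfunction lam f) :
    D.innerProd f f = f D.l ^ 2 * D.innerProd (H.sol lam) (H.sol lam) := by
  have e : ∫ x in D.l..D.r, f x * f x * D.speedDensity x
      = ∫ x in D.l..D.r, f D.l ^ 2 * (H.sol lam x * H.sol lam x * D.speedDensity x) := by
    refine intervalIntegral.integral_congr fun x hx => ?_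
    rw [uIcc_of_le D.l_lt_r.le] at hx
    rw [H.eq_mul_sol h x hx]
    ring
  rw [innerProd, innerProd, e, intervalIntegral.integral_const_mul, (H.isShooting lam).left]
  ring

theorem Grid.IsFine.innerProd_eigenvector {n : ℕ} {S : D.Grid n} {H : D.CoeffBounds}
    (hS : S.IsFine H) {sch : Scheme} {nu : ℝ} {g : ℕ → ℝ} (hg : S.IsEigenvector sch nu g) :
    S.innerProd sch g g = g 0 ^ 2 * S.innerProd sch (S.dsY sch nu) (S.dsY sch nu) := by
  rw [Grid.innerProd, Grid.innerProd, Finset.mul_sum]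
  refine Finset.sum_congr rfl fun i hi => ?_
  rw [hS.eq_mul_dsY hg i (by rw [Finset.mem_range] at hi; omega)]
  ring

/-- Eigenfunction and eigenvector are amplitudes times shooting solutions. The shooting solutions
differ by O(w ε), from the Verlet error and the Lipschitz effect of the eigenvalue error. The
squared norms differ by O(w²ε). As amplitudes are O(1/w) and differ by O(ε/w), while the solutions
are O(w), the total error is O(ε). -/
theorem Grid.exists_eigenvector_error (H : D.CoeffBounds) : ∃ C : ℝ, 1 ≤ C ∧
    ∀ (n : ℕ) (S : D.Grid n) (sch : Scheme) (k : ℕ) (lam lamn : ℝ) (φ : ℝ → ℝ) (φn : ℕ → ℝ),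
    D.IsEigenfunction lam φ → {nu | nu ∈ D.eigenvalues ∧ nu < lam}.encard + 1 = (k : ℕ∞) →
    D.innerProd φ φ = 1 → S.IsEigenvector sch lamn φn →
    {nu | nu ∈ S.eigenvalues sch ∧ nu < lamn}.encard + 1 = (k : ℕ∞) →
    S.innerProd sch φn φn = 1 → C * (freq lam ^ 2 * S.mesh) ≤ 1 →
    ∃ e : ℝ, (e = 1 ∨ e = -1) ∧ ∀ i ≤ n + 1,
      |e * φn i - φ (S.pt i)| ≤ C * sch.errScale (freq lam) S.mesh := by
  obtain ⟨V, hV1, hV⟩ := Grid.exists_eigenvalue_error H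
  obtain ⟨A, hA1, hA⟩ := exists_pointwise_error H
  obtain ⟨L, hL1, hL⟩ := H.exists_shooting_lipschitz
  obtain ⟨Y, hY1, hY⟩ := H.exists_shooting_bound
  obtain ⟨E, hE1, hE⟩ := exists_innerProd_error H
  obtain ⟨c, hc, hcl⟩ := H.exists_innerProd_lower
  obtain ⟨Θ, hΘ⟩ : ∃ Θ, Θ = 16 * A + L * V := ⟨_, rfl⟩
  have hΘ0 : 0 < Θ := by rw [hΘ]; positivity
  obtain ⟨T, hT⟩ : ∃ T, T = E * (Θ + 2) := ⟨_, rfl⟩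
  have hT0 : 0 < T := by rw [hT]; positivity
  obtain ⟨K, hK⟩ : ∃ K, K = 1 + 1 / (c / 2) := ⟨_, rfl⟩
  have hK0 : 0 < K := by rw [hK]; positivity
  obtain ⟨C, hCd⟩ : ∃ C, C = V + 4 * A + 2 * Θ + 4 * T / c + (K * Θ + K ^ 3 * T * Y) := ⟨_, rfl⟩
  have q1 : 0 < 4 * T / c := by positivity
  have q2 : 0 < K * Θ + K ^ 3 * T * Y := by positivity
  refine ⟨C, by rw [hCd]; linarith,
    fun n S sch k lam lamn φ φn hφ hk hφ1 hφn hkn hφn1 hs => ?_⟩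
  have hlam : lam ∈ D.eigenvalues := ⟨φ, hφ⟩
  have hlamn : lamn ∈ S.eigenvalues sch := ⟨φn, hφn⟩
  have hlam0 := H.nonneg_of_mem_eigenvalues hlam
  have hlam1 : -1 ≤ lam := by linarith
  have hw := one_le_freq hlam1
  have hh := S.mesh_pos
  have hVs : V * (freq lam ^ 2 * S.mesh) ≤ 1 := by
    refine le_trans ?_ hs
    gcongr
    linarith
  obtain ⟨ev1, ev2⟩ := hV n S sch k lam lamn hlam hk hlamn hkn hVs
  have lip := hL lam lamn hlam1
  have shl := hY lam hlam1 _ _ (H.isShooting lam)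
  have low := hcl lam hlam1 _ _ (H.isShooting lam)
  have hfn : freq lamn ≤ 2 * freq lam := freq_le_two_mul hlam1 (by linarith [(abs_le.1 ev1).2])
  have hln : lamn ≤ lam + freq lam := by linarith [(abs_le.1 ev1).2]
  obtain ⟨w, hwd⟩ : ∃ w, w = freq lam := ⟨_, rfl⟩
  rw [← hwd] at hw hs ev2 shl low hfn ⊢
  obtain ⟨z, hz⟩ : ∃ z, z = w ^ 2 * S.mesh := ⟨_, rfl⟩
  have hz0 : 0 < z := by rw [hz]; positivity
  rw [← hz, hCd] at hs
  have p1 : 0 < V * z := by positivity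
  have p2 : 0 < A * z := by positivity
  have p3 : 0 < Θ * z := by positivity
  have p4 : 0 < 4 * T / c * z := by positivity
  have p5 : 0 < (K * Θ + K ^ 3 * T * Y) * z := by positivity
  have hs1 : A * ((2 * w) ^ 2 * S.mesh) ≤ 1 := by
    have e : A * ((2 * w) ^ 2 * S.mesh) = 4 * (A * z) := by rw [hz]; ring
    linarith
  have hzA : 1 * z ≤ A * z := by gcongr
  have hs2 : 4 * T * z ≤ c := by
    have h1 : 4 * T / c * z ≤ 1 := by linarith
    have h2 : 4 * T / c * z = 4 * T * z / c := by ring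
    rw [h2, div_le_one hc] at h1
    exact h1
  obtain ⟨hS, herr⟩ := hA n S sch (2 * w) (by linarith) hs1
  have hlamn0 := hS.nonneg_of_mem_eigenvalues hlamn
  obtain ⟨ε, hε⟩ : ∃ ε, ε = sch.errScale w S.mesh := ⟨_, rfl⟩
  have hε0 : 0 ≤ ε := hε ▸ sch.errScale_nonneg (by linarith) hh.le
  have hε2 := sch.errScale_two_mul_le (w := w) hh.le
  have hεz : ε ≤ 2 * z := by
    have h1 := sch.errScale_le hw hh.le (by rw [← hz]; linarith)
    have h2 : w * S.mesh ≤ w ^ 2 * S.mesh := by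
      gcongr
      exact le_self_pow₀ hw two_ne_zero
    rw [hε]; linarith
  rw [← hε] at ev2 hε2 ⊢
  have hpt : ∀ i ≤ n + 1, |S.dsY sch lamn i - H.sol lam (S.pt i)| ≤ Θ * w * ε := fun i hi => by
    have h1 := (herr lamn (by linarith) hfn i hi).1
    have h2 := (lip (by linarith) hln _ _ _ _ (H.isShooting lam) (H.isShooting lamn) _
      (S.pt_mem hi)).1
    have h3 : A * (2 * w) * sch.errScale (2 * w) S.mesh ≤ A * (2 * w) * (8 * ε) := by gcongr
    have h4 : L * |lamn - lam| ≤ L * (V * w * ε) := by gcongr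
    have h5 := abs_sub_le (S.dsY sch lamn i) (H.sol lamn (S.pt i)) (H.sol lam (S.pt i))
    rw [hΘ]
    linarith
  have hθw : Θ * w * ε ≤ w := by
    have h1 : Θ * ε ≤ Θ * (2 * z) := by gcongr
    have h2 : Θ * ε ≤ 1 := by linarith
    calc Θ * w * ε = w * (Θ * ε) := by ring
      _ ≤ w := mul_le_of_le_one_right (by linarith) h2
  have ip := hE n S hS sch w lam lam _ _ _ hlam1 hlam1 hwd.ge hwd.ge hθw hpt hpt
  -- The eigenfunction vanishes at r, which removes the first order quadrature error there.
  rw [(H.sol_right_eq_zero hφ).2] at ip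
  simp only [mul_zero, abs_zero, add_zero] at ip
  obtain ⟨N, hN⟩ : ∃ N, N = D.innerProd (H.sol lam) (H.sol lam) := ⟨_, rfl⟩
  obtain ⟨N', hN'⟩ : ∃ N', N' = S.innerProd sch (S.dsY sch lamn) (S.dsY sch lamn) := ⟨_, rfl⟩
  rw [← hN] at ip low
  rw [← hN'] at ip
  have hNN : |N' - N| ≤ w ^ 2 * (T * ε) := by
    refine ip.trans ?_
    have hε' : ε = w ^ 3 * S.mesh ^ 2 + sch.boundaryErr S.mesh := hε
    have hbe := sch.boundaryErr_nonneg hh.le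
    have hw2 : 1 ≤ w ^ 2 := one_le_pow₀ hw
    have hww2 : w ≤ w ^ 2 := le_self_pow₀ hw two_ne_zero
    have k1 : S.mesh ^ 2 * w ^ 4 ≤ w ^ 2 * ε := by
      calc S.mesh ^ 2 * w ^ 4 = w * (w ^ 3 * S.mesh ^ 2) := by ring
        _ ≤ w ^ 2 * ε := by gcongr; linarith
    have k2 : sch.boundaryErr S.mesh ≤ w ^ 2 * ε := by
      have : 0 ≤ w ^ 3 * S.mesh ^ 2 := by positivity
      exact (by linarith : sch.boundaryErr S.mesh ≤ ε).trans (le_mul_of_one_le_left hε0 hw2)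
    calc _ ≤ E * (Θ * w * ε * w + w ^ 2 * ε + w ^ 2 * ε) := by gcongr
      _ = _ := by rw [hT]; ring
  have hTε : T * ε ≤ c / 2 := by
    have : T * ε ≤ T * (2 * z) := by gcongr
    linarith
  have low' : c / 2 * w ^ 2 ≤ N' := by
    have h1 : w ^ 2 * (T * ε) ≤ w ^ 2 * (c / 2) := by gcongr
    linarith [(abs_le.1 hNN).1]
  have low2 : c / 2 * w ^ 2 ≤ N := by
    have : 0 ≤ c / 2 * w ^ 2 := by positivity
    linarith
  have hφl : φ D.l ≠ 0 := (H.sol_right_eq_zero hφ).1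
  have hφ0 : φn 0 ≠ 0 := (hS.dsY_last_eq_zero hφn).1
  have n1 : |φ D.l| ^ 2 * N = 1 := by
    rw [sq_abs, hN, ← H.innerProd_eigenfunction hφ, hφ1]
  have n2 : |φn 0| ^ 2 * N' = 1 := by
    rw [sq_abs, hN', ← hS.innerProd_eigenvector hφn, hφn1]
  have a1 := mul_le_of_sq_mul_eq_one (by positivity) low2 n1
  have a2 := mul_le_of_sq_mul_eq_one (by positivity) low' n2
  rw [← hK] at a1 a2
  have nd := abs_normalization_sub_le (abs_pos.2 hφl) (abs_pos.2 hφ0) (by linarith) n1 n2 a1 a2 hNN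
  -- The sign makes both amplitudes effectively positive, so that only their absolute values need to
  -- be compared.
  obtain ⟨e, he, hsign⟩ := exists_sign_abs_sub_le (a := φ D.l) (b := φn 0)
  refine ⟨e, he, fun i hi => ?_⟩
  have hmem := S.pt_mem hi
  rw [hS.eq_mul_dsY hφn i hi, H.eq_mul_sol hφ _ hmem, hsign]
  have e1 : |φn 0| * S.dsY sch lamn i - |φ D.l| * H.sol lam (S.pt i)
      = |φn 0| * (S.dsY sch lamn i - H.sol lam (S.pt i))
        + (|φn 0| - |φ D.l|) * H.sol lam (S.pt i) := by ring
  rw [e1]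
  refine (abs_add_le_add (abs_mul_le_mul (abs_abs _).le (hpt i hi))
    (abs_mul_le_mul le_rfl (shl _ hmem).1)).trans ?_
  calc |φn 0| * (Θ * w * ε) + |(|φn 0| - |φ D.l|)| * (Y * w)
      = |φn 0| * w * (Θ * ε) + w * |(|φn 0| - |φ D.l|)| * Y := by ring
    _ ≤ K * (Θ * ε) + K ^ 3 * (T * ε) * Y := by gcongr
    _ = (K * Θ + K ^ 3 * T * Y) * ε := by ring
    _ ≤ C * ε := by
      gcongr
      rw [hCd]; linarith

end StickyDiffusion

end

/-! ### From the frequency to the index k. -/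

theorem proposition4p3 (D : StickyDiffusion) (hD : D.Regular)
    (S : (n : ℕ) → D.Grid n)
    (hmesh : Tendsto (fun n => (S n).mesh) atTop (𝓝 0))
    (hratio : ∃ K > 0, ∀ n, (S n).mesh / (S n).minStep ≤ K)
    (sch : Scheme) :
    ∃ δ > 0, ∃ C > 0, ∀ n : ℕ, (S n).mesh < δ →
      ∀ k : ℕ, 1 ≤ k → (k : ℝ) ≤ (S n).mesh ^ (-(1 / 5) : ℝ) →
        ∀ (φ : ℝ → ℝ) (φn : ℕ → ℝ), D.IsNormalizedEigenfunction k φ →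
          (S n).IsNormalizedEigenvector sch k φn →
          -- normalized eigenvectors are determined up to their sign
          ∃ ε : ℝ, (ε = 1 ∨ ε = -1) ∧
            (S n).supNorm (fun i => ε * φn i - φ ((S n).pt i))
              ≤ C * (k : ℝ) ^ 4 * (S n).mesh ^ sch.order := by
  obtain ⟨H⟩ := hD.nonempty_coeffBounds
  obtain ⟨V, hV1, hV⟩ := StickyDiffusion.Grid.exists_eigenvector_error H
  obtain ⟨W, hW1, hW⟩ := H.exists_eigenvalue_bound
  -- The eigenvector estimate needs V w²h ≤ 1. As w² ≤ 3W k², it suffices that T k²h ≤ 1.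
  obtain ⟨T, hT⟩ : ∃ T, T = V * (3 * W) := ⟨_, rfl⟩
  have hT0 : 0 < T := by rw [hT]; positivity
  refine ⟨min 1 ((1 / T) ^ 2), by positivity, V * (9 * W ^ 2 + 1), by positivity,
    fun n hn k hk hkh φ φn hφ hφn => ?_⟩
  obtain ⟨lam, hφe, hφk, hφ1⟩ := hφ
  obtain ⟨lamn, hφne, hφnk, hφn1⟩ := hφn
  have hh := (S n).mesh_pos
  obtain ⟨h, hhd⟩ : ∃ h, h = (S n).mesh := ⟨_, rfl⟩
  have hVn := hV n (S n) sch k lam lamn φ φn hφe hφk hφ1 hφne hφnk hφn1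
  rw [← hhd] at hn hh hkh hVn ⊢
  have hk1 : (1 : ℝ) ≤ k := by exact_mod_cast hk
  have hn1 : h ≤ 1 := (hn.le.trans (min_le_left _ _))
  have hn2 : h ≤ (1 / T) ^ 2 := (hn.le.trans (min_le_right _ _))
  have hk5 : (k : ℝ) ^ 5 * h ≤ 1 := by
    have h1 : (k : ℝ) ^ 5 ≤ (h ^ (-(1 / 5) : ℝ)) ^ 5 := by gcongr
    have h2 : (h ^ (-(1 / 5) : ℝ)) ^ 5 = h⁻¹ := by
      rw [← Real.rpow_natCast, ← Real.rpow_mul hh.le, ← Real.rpow_neg_one]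
      norm_num
    rw [h2] at h1
    calc (k : ℝ) ^ 5 * h ≤ h⁻¹ * h := by gcongr
      _ = 1 := inv_mul_cancel₀ hh.ne'
  -- From k⁵h ≤ 1 follows (k²h)² = (k⁴h)h ≤ h, and h is at most 1/T² by the choice of δ.
  have hk2 : (k : ℝ) ^ 2 * h ≤ 1 / T := by
    refine le_of_sq_le_sq ?_ (by positivity)
    calc ((k : ℝ) ^ 2 * h) ^ 2 = (k : ℝ) ^ 4 * h * h := by ring
      _ ≤ (k : ℝ) ^ 5 * h * h := by gcongr; norm_num
      _ ≤ 1 * h := by gcongr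
      _ ≤ (1 / T) ^ 2 := by linarith
  have hlam0 : 0 ≤ lam := hφe.nonneg H
  have hw1 := one_le_freq (by linarith : -1 ≤ lam)
  have hw2 : freq lam ^ 2 ≤ 3 * W * (k : ℝ) ^ 2 := by
    rw [freq_sq (by linarith)]
    have h1 := hW k hk lam hφk
    have h2 : 1 * 1 ≤ W * (k : ℝ) ^ 2 := by
      gcongr
      exact one_le_pow₀ hk1
    linarith
  obtain ⟨e, he, hbound⟩ := hVn (by
    calc V * (freq lam ^ 2 * h) ≤ V * (3 * W * (k : ℝ) ^ 2 * h) := by gcongr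
      _ = T * ((k : ℝ) ^ 2 * h) := by rw [hT]; ring
      _ ≤ T * (1 / T) := by gcongr
      _ = 1 := by field_simp)
  refine ⟨e, he, ?_⟩
  have hscale : sch.errScale (freq lam) h
      ≤ (9 * W ^ 2 + 1) * (k : ℝ) ^ 4 * h ^ sch.order := by
    -- The factor k⁴ arises by rounding w³, which is O(k³), up to w⁴.
    have h3 : freq lam ^ 3 ≤ 9 * W ^ 2 * (k : ℝ) ^ 4 := by
      calc freq lam ^ 3 ≤ freq lam ^ 4 := by gcongr; norm_num
        _ = (freq lam ^ 2) ^ 2 := by ring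
        _ ≤ (3 * W * (k : ℝ) ^ 2) ^ 2 := by gcongr
        _ = _ := by ring
    have h4 : freq lam ^ 3 * h ^ 2 ≤ 9 * W ^ 2 * (k : ℝ) ^ 4 * h ^ 2 := by gcongr
    rw [Scheme.errScale]
    cases sch with
    | one =>
      have h5 : 9 * W ^ 2 * (k : ℝ) ^ 4 * h ^ 2 ≤ 9 * W ^ 2 * (k : ℝ) ^ 4 * h := by
        gcongr
        exact pow_le_of_le_one hh.le hn1 two_ne_zero
      have h6 : h ≤ (k : ℝ) ^ 4 * h := le_mul_of_one_le_left hh.le (one_le_pow₀ hk1)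
      rw [Scheme.boundaryErr, Scheme.order, pow_one]
      linarith
    | two =>
      have : 0 ≤ (k : ℝ) ^ 4 * h ^ 2 := by positivity
      rw [Scheme.boundaryErr, Scheme.order]
      linarith
  refine Finset.sup'_le _ _ fun i hi => ?_
  rw [Finset.mem_range] at hi
  refine (hbound i (by omega)).trans ?_
  calc V * sch.errScale (freq lam) h
      ≤ V * ((9 * W ^ 2 + 1) * (k : ℝ) ^ 4 * h ^ sch.order) := by gcongr
    _ = _ := by ring
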